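/- A \emph{rank-1 symmetric space} means a metric space isometric, up to a constant rescaling of the metric, to real, complex or quaternionic hyperbolic space $\mathbb{H}^n_{\mathbb{R}}$, $\mathbb{H}^n_{\mathbb{C}}$, $\mathbb{H}^n_{\mathbb{H}}$ with $n\ge 2$, or to the Cayley hyperbolic plane $\mathbb{H}^2_{\mathbf{Ca}}$. An \emph{ideal graph of spaces} is a space $Z$ obtained from a finite connected graph by taking, for each vertex, either a point or a closed manifold whose universal cover is a rank-1 symmetric space and, for each edge, a unit interval whose two ends are glued to points of the corresponding vertex spaces; $Z$ carries the induced length metric. An \emph{ideal model geometry} is a proper geodesic metric space $X$ isometric to the universal cover $\tilde Z$ of an ideal graph of spaces $Z$; equivalently, $X$ is a tree of spaces whose vertex spaces are points and rank-1 symmetric spaces and whose edges are unit intervals, with the gluing metric, and some group of isometries preserving this decomposition acts on $X$ freely, properly and cocompactly. Equip $\operatorname{Isom}(X)$ with the compact-open topology (equivalently, that of pointwise convergence). A \emph{uniform lattice} of $\operatorname{Isom}(X)$ is a discrete subgroup $\Gamma$ with $\operatorname{Isom}(X)/\Gamma$ compact. \textbf{Theorem.} Let $X$ be an ideal model geometry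 that is neither a rank-1 symmetric space nor isometric to the real line $\mathbb{R}$. Let $\Gamma$ and $\Gamma'$ be uniform lattices of $\operatorname{Isom}(X)$. If $\Gamma$ and $\Gamma'$ are residually finite, then they are weakly commensurable in $\operatorname{Isom}(X)$: there is $g\in\operatorname{Isom}(X)$ such that $g\Gamma g^{-1}\cap\Gamma'$ has finite index in both $g\Gamma g^{-1}$ and $\Gamma'$. -/

import Mathlib

/-! ### Rank-one symmetric spaces of noncompact type -/

/-- The Cayley octonions, as the Cayley–Dickson double of Hamilton's quaternions. -/
@[ext]
structure Octonion where
  fst : Quaternion ℝ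
  snd : Quaternion ℝ

namespace Octonion

/-- Cayley–Dickson multiplication `(a, b)(c, d) = (ac - d̄b, da + bc̄)`. -/
noncomputable instance : Mul Octonion :=
  ⟨fun p q => ⟨p.fst * q.fst - star q.snd * p.snd, q.snd * p.fst + p.snd * star q.fst⟩⟩

/-- Octonionic conjugation `(a, b) ↦ (ā, -b)`. -/
noncomputable instance : Star Octonion := ⟨fun p => ⟨star p.fst, -p.snd⟩⟩

/-- The real part of an octonion. -/
def re (p : Octonion) : ℝ := p.fst.re

end Octonion

section Hyperbolic

variable {F : Type*} [Mul F] [Star F]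

/-- The squared Euclidean norm `∑ᵢ |xᵢ|²` of a vector in `Fⁿ`, where `re` is the real part on `F`. -/
def normSqOver (re : F → ℝ) {n : ℕ} (x : Fin n → F) : ℝ :=
  ∑ i, re (x i * star (x i))

/-- For `X = (x, 1)` and `Y = (y, 1)` in `Fⁿ⁺¹` with the form `Φ = diag(1, …, 1, -1)`, this is
`Re tr ((X X* Φ) (Y Y* Φ))`. For associative `F` it is the squared modulus
`|⟨X, Y⟩|² = |1 - ∑ᵢ ȳᵢ xᵢ|²` of the Hermitian form; for the octonions and `n = 2` it is the
trace form of the exceptional Jordan algebra. -/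
def pairingSqOver (re : F → ℝ) {n : ℕ} (x y : Fin n → F) : ℝ :=
  1 - 2 * ∑ i, re (star (y i) * x i) +
    ∑ i, ∑ j, re ((x i * star (x j)) * (y j * star (y i)))

/-- `S` is isometric, up to a constant rescaling of the metric, to the `F`-hyperbolic space
`ℍⁿ_F`, in the projective ball model: the points are the `x ∈ Fⁿ` with `|x| < 1`, and
`cosh² d(x, y) = |⟨X, Y⟩|² / (⟨X, X⟩ ⟨Y, Y⟩)` with `X = (x, 1)`, `Y = (y, 1)`. -/
def IsHyperbolicSpaceOver (re : F → ℝ) (n : ℕ) (S : Type*) [MetricSpace S] : Prop :=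
  ∃ (c : ℝ) (f : S → Fin n → F), 0 < c ∧ Function.Injective f ∧
    Set.range f = {x | normSqOver re x < 1} ∧
    ∀ s t, Real.cosh (dist s t / c) ^ 2 =
      pairingSqOver re (f s) (f t) /
        ((1 - normSqOver re (f s)) * (1 - normSqOver re (f t)))

end Hyperbolic

/-- `S` is a rank-one symmetric space of noncompact type, with any normalization of its metric:
real, complex or quaternionic hyperbolic space of dimension `n ≥ 2` over the respective algebra,
or the Cayley hyperbolic plane. -/
def IsRankOneSymmetricSpace (S : Type*) [MetricSpace S] : Prop :=
  (∃ n ≥ 2, IsHyperbolicSpaceOver (fun a : ℝ => a) n S) ∨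
  (∃ n ≥ 2, IsHyperbolicSpaceOver (fun a : ℂ => a.re) n S) ∨
  (∃ n ≥ 2, IsHyperbolicSpaceOver (fun a : Quaternion ℝ => a.re) n S) ∨
  IsHyperbolicSpaceOver Octonion.re 2 S

/-! ### Isometry groups, lattices, commensurability -/

section Isometries

variable {X : Type*} [MetricSpace X]

/-- The topology of pointwise convergence on `Isom(X)`; on isometries of a metric space it is the
compact-open topology. -/
instance isomTopology : TopologicalSpace (X ≃ᵢ X) :=
  TopologicalSpace.induced (fun g x => g x) (inferInstanceAs (TopologicalSpace (X → X)))

/-- A uniform lattice of `Isom(X)`: a discrete subgroup with compact quotient. -/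
def IsUniformLattice (Γ : Subgroup (X ≃ᵢ X)) : Prop :=
  DiscreteTopology Γ ∧ CompactSpace ((X ≃ᵢ X) ⧸ Γ)

/-- `Γ` acts properly (in the sense of discrete groups) and cocompactly on `X`. -/
def ActsGeometrically (Γ : Subgroup (X ≃ᵢ X)) : Prop :=
  (∀ K : Set X, IsCompact K → {g : X ≃ᵢ X | g ∈ Γ ∧ (g '' K ∩ K).Nonempty}.Finite) ∧
  ∃ K : Set X, IsCompact K ∧ ∀ x, ∃ g ∈ Γ, g x ∈ K

end Isometries

/-- `Γ₁` and `Γ₂` are weakly commensurable in `G`: some conjugate `gΓ₁g⁻¹` is commensurable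
with `Γ₂`. -/
def WeaklyCommensurable {G : Type*} [Group G] (Γ₁ Γ₂ : Subgroup G) : Prop :=
  ∃ g : G, Subgroup.Commensurable (Γ₁.map (MulAut.conj g).toMonoidHom) Γ₂

/-! ### Ideal model geometries -/

/-- `X` is a geodesic metric space. -/
def IsGeodesicSpace (X : Type*) [MetricSpace X] : Prop :=
  ∀ x y : X, ∃ γ : ℝ → X, γ 0 = x ∧ γ (dist x y) = y ∧
    ∀ s ∈ Set.Icc 0 (dist x y), ∀ t ∈ Set.Icc 0 (dist x y), dist (γ s) (γ t) = |s - t|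

/-- A decomposition of the metric space `X` as a tree of spaces whose vertex spaces are points or
rank-one symmetric spaces and whose edges are unit intervals. -/
structure IdealTreeOfSpaces (X : Type*) [MetricSpace X] where
  /-- The vertices of the underlying tree. -/
  V : Type*
  /-- The underlying tree. -/
  tree : SimpleGraph V
  isTree : tree.IsTree
  /-- The vertex spaces. -/
  space : V → Set X
  space_spec : ∀ v, (∃ x, space v = {x}) ∨ IsRankOneSymmetricSpace (space v)
  /-- The unit interval of an oriented edge, parametrized from its initial vertex. -/
  edge : tree.Dart → unitInterval → X
  edge_isometry : ∀ d, Isometry (edge d)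
  edge_symm : ∀ d t, edge d.symm t = edge d (unitInterval.symm t)
  edge_zero_mem : ∀ d, edge d 0 ∈ space d.fst
  cover : ∀ x, (∃ v, x ∈ space v) ∨ ∃ d, x ∈ Set.range (edge d)
  /-- There are no identifications but those of the ends of the intervals with points of the
  vertex spaces. -/
  space_disjoint : ∀ v w, v ≠ w → Disjoint (space v) (space w)
  edge_notMem : ∀ d t, 0 < t → t < 1 → ∀ v, edge d t ∉ space v
  edge_disjoint : ∀ d t d' t', 0 < t → t < 1 → edge d t = edge d' t' → d.edge = d'.edge
  /-- The metric is that of the gluing: the distance of two points is the least length of a chain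
  whose consecutive members lie in a common vertex space or a common edge. -/
  exists_chain : ∀ x y, ∃ (n : ℕ) (z : ℕ → X), z 0 = x ∧ z n = y ∧
    (∀ i < n, (∃ v, z i ∈ space v ∧ z (i + 1) ∈ space v) ∨
      ∃ d, z i ∈ Set.range (edge d) ∧ z (i + 1) ∈ Set.range (edge d)) ∧
    ∑ i ∈ Finset.range n, dist (z i) (z (i + 1)) = dist x y

/-- `X` is an ideal model geometry: a proper geodesic metric space that is the universal cover of
an ideal graph of spaces `Z`. The universal cover is the tree of spaces `D`, and `π` is the group of
deck transformations: it acts freely, properly and cocompactly by isometries and preserves the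
decomposition, so that `Z = π \ X` is a finite graph of spaces whose vertex spaces are points or
closed manifolds covered by rank-one symmetric spaces and whose edges are unit intervals. -/
def IsIdealModelGeometry.{u} (X : Type u) [MetricSpace X] : Prop :=
  ProperSpace X ∧ IsGeodesicSpace X ∧
  ∃ (D : IdealTreeOfSpaces.{u, u} X) (π : Subgroup (X ≃ᵢ X)),
    ActsGeometrically π ∧
    (∀ g ∈ π, ∀ x, g x = x → g = 1) ∧
    ∀ g ∈ π, ∀ v, ∃ w, g '' D.space v = D.space w

-- This is a Leighton-type argument. The isometry group acts on a combinatorial tree, and two groups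
-- acting freely on its edges are compared by matching finitely many local states.
--
-- Geometry. Points interior to an edge have two-point small spheres; points of a symmetric vertex
-- space do not. If every point is linear, X is a line. Otherwise, the vertex spaces are exactly the
-- points at integral distance from the set of nonlinear points (`mem_space_iff_infDist`). Hence
-- every isometry preserves the decomposition (`isInvariant`) and acts on the tree-like graph
-- `Vert`, whose vertices are the vertex spaces and the attaching points of edges. Conversely,
-- bijective local data that agree along the edges of this graph glue to an isometry
-- (`exists_isometry_glue`).
--
-- Finiteness. A symmetric vertex space contains a coarsely dense set of attaching points, and
-- distances to finitely many of these determine a point (`exists_finite_resolving`). In a ball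
-- model, the distance functions become elements of a finite-dimensional function space, and
-- coarsely dense sets accumulate at enough ideal points. So an isometry on the star of a vertex is
-- determined by finitely many images, and modulo a cocompact group only finitely many restrictions
-- to a star remain (`finite_agreeQuotient`).
--
-- Matching. Residual finiteness provides finite-index subgroups moving every point by more than 1,
-- so neither fixes or inverts an edge. A state at u is an isometry restricted to the star of u,
-- modulo the second group, together with an index that makes the number of states the same at all
-- vertices. Fibres over restrictions to an edge have constant size, so states at its two ends can
-- be matched bijectively and equivariantly under the first group (`exists_equivariant_matching`). A
-- compatible family of states, spread from one vertex, is determined by its value there. Hence a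
-- finite-index subgroup Δ of the first group preserves it. Correcting the family by elements of the
-- second group glues it to an isometry g with g Δ g⁻¹ inside that group
-- (`IsTreeLike.exists_conj_le`). Cocompactness then makes g Δ g⁻¹ of finite index there.

universe u

/-! ### Sections over trees -/

/-- A graph (given by its adjacency relation) with a base point is tree-like if compatible choices
can be propagated from the base point over the whole graph, and if it is connected. -/
structure IsTreeLike {U : Type u} (Adj : U → U → Prop) (u₀ : U) : Prop where
  exists_section : ∀ (St : U → Type u) (R : ∀ u w, St u → St w → Prop),
    (∀ u w s t, Adj u w → R u w s t → R w u t s) →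
    (∀ u w, Adj u w → ∀ s, ∃ t, R u w s t) →
    ∀ s₀ : St u₀, ∃ σ : ∀ u, St u, σ u₀ = s₀ ∧ ∀ u w, Adj u w → R u w (σ u) (σ w)
  induction : ∀ p : U → Prop, p u₀ → (∀ u w, Adj u w → p u → p w) → ∀ u, p u

/-- Transport of a state along a walk. -/
def SimpleGraph.Walk.transport {V : Type*} {T : SimpleGraph V} {St : V → Type*}
    (c : ∀ u w, T.Adj u w → St u → St w) : ∀ {u w : V}, T.Walk u w → St u → St w
  | _, _, .nil, s => s
  | _, _, .cons h p, s => transport c p (c _ _ h s)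

theorem SimpleGraph.Walk.transport_concat {V : Type*} {T : SimpleGraph V} {St : V → Type*}
    (c : ∀ u w, T.Adj u w → St u → St w) {u v w : V} (p : T.Walk u v) (h : T.Adj v w) (s : St u) :
    (p.concat h).transport c s = c _ _ h (p.transport c s) := by
  induction p with
  | nil => rfl
  | cons h' p ih => exact ih h _

/-- States are transported along the unique paths from the base point. Of the paths to two adjacent
vertices, one extends the other by the joining edge; symmetry of the relation handles the two
orientations. -/
theorem SimpleGraph.IsTree.isTreeLike {V : Type u} {T : SimpleGraph V} (hT : T.IsTree) (v₀ : V) :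
    IsTreeLike T.Adj v₀ where
  exists_section St R hsymm hext s₀ := by
    choose c hc using hext
    choose path hpath _ using fun v => hT.existsUnique_path v₀ v
    refine ⟨fun v => (path v).transport c s₀, ?_, ?_⟩
    · have : path v₀ = .nil :=
        (hT.existsUnique_path v₀ v₀).unique (hpath v₀) SimpleGraph.Walk.IsPath.nil
      simp only [this]
      rfl
    · have key : ∀ u w, T.Adj u w → u ∈ (path w).support →
          R u w ((path u).transport c s₀) ((path w).transport c s₀) := by
        intro u w huw hu
        rw [hT.isAcyclic.path_concat (hpath u) (hpath w) huw hu,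
          SimpleGraph.Walk.transport_concat]
        exact hc _ _ _ _
      intro u w huw
      by_cases hu : u ∈ (path w).support
      · exact key u w huw hu
      · exact hsymm _ _ _ _ huw.symm (key w u huw.symm
          (hT.isAcyclic.mem_support_of_ne_mem_support_of_adj_of_isPath (hpath u) (hpath w) huw hu))
  induction p h0 hstep u := by
    obtain ⟨w⟩ := hT.connected v₀ u
    induction w with
    | nil => exact h0
    | cons h q ih => exact ih (hstep _ _ h h0)

/-! ### Cosets modulo agreement on a set -/

section Agree

variable {G U : Type u} [Group G] [MulAction G U]

/-- Two elements of `G` are equivalent if, up to left translation by `Γ`, they agree on `B`. -/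
def agreeSetoid (Γ : Subgroup G) (B : Set U) : Setoid G where
  r h k := ∃ c ∈ Γ, ∀ x ∈ B, k • x = c • h • x
  iseqv :=
    { refl := fun h => ⟨1, Γ.one_mem, fun x _ => by simp⟩
      symm := by
        rintro h k ⟨c, hc, H⟩
        exact ⟨c⁻¹, Γ.inv_mem hc, fun x hx => by rw [H x hx, inv_smul_smul]⟩
      trans := by
        rintro h k l ⟨c, hc, H⟩ ⟨d, hd, H'⟩
        exact ⟨d * c, Γ.mul_mem hd hc, fun x hx => by rw [H' x hx, H x hx, mul_smul]⟩ }

/-- The quotient of `G` by agreement on `B` up to left translation by `Γ`. -/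
abbrev AgreeQuotient (Γ : Subgroup G) (B : Set U) : Type u := Quotient (agreeSetoid Γ B)

theorem AgreeQuotient.mk_eq {Γ : Subgroup G} {B : Set U} {h k : G} :
    (Quotient.mk (agreeSetoid Γ B) h = Quotient.mk (agreeSetoid Γ B) k) ↔
      ∃ c ∈ Γ, ∀ x ∈ B, k • x = c • h • x :=
  Quotient.eq

/-- Restriction of agreement to a smaller set. -/
def AgreeQuotient.restrict {Γ : Subgroup G} {B C : Set U} (hCB : C ⊆ B) :
    AgreeQuotient Γ B → AgreeQuotient Γ C :=
  Quotient.map' id fun _ _ ⟨c, hc, H⟩ => ⟨c, hc, fun x hx => H x (hCB hx)⟩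

theorem AgreeQuotient.restrict_mk {Γ : Subgroup G} {B C : Set U} (hCB : C ⊆ B) (h : G) :
    AgreeQuotient.restrict hCB (Quotient.mk (agreeSetoid Γ B) h) =
      Quotient.mk (agreeSetoid Γ C) h := rfl

/-- If `Γ` acts freely on the translates of `C ⊆ B`, the fibres of the restriction map are all
in bijection with one set. -/
theorem AgreeQuotient.exists_equiv_prod {Γ : Subgroup G} {B C : Set U} (hCB : C ⊆ B)
    (hfree : ∀ c ∈ Γ, ∀ h : G, (∀ x ∈ C, c • h • x = h • x) → c = 1) :
    ∃ (M : Type u) (e : AgreeQuotient Γ B ≃ AgreeQuotient Γ C × M),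
      ∀ q, (e q).1 = AgreeQuotient.restrict hCB q := by
  classical
  -- The fibre over the class of h consists of the classes of h e with e fixing C pointwise.
  -- Freeness makes two of them equal only when they differ by an element fixing B, so every fibre
  -- is a copy of E/K, independently of h.
  let E := fixingSubgroup G C
  let K : Subgroup E := (fixingSubgroup G B).subgroupOf E
  have hfib : ∀ r : AgreeQuotient Γ C,
      Nonempty ({q : AgreeQuotient Γ B // AgreeQuotient.restrict hCB q = r} ≃ E ⧸ K) := by
    intro r
    induction r using Quotient.inductionOn with
    | _ h =>
    have hmem : ∀ e : E, AgreeQuotient.restrict hCB (Quotient.mk (agreeSetoid Γ B) (h * e)) =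
        Quotient.mk (agreeSetoid Γ C) h := by
      intro e
      rw [AgreeQuotient.restrict_mk, AgreeQuotient.mk_eq]
      refine ⟨1, Γ.one_mem, fun x hx => ?_⟩
      have := (mem_fixingSubgroup_iff G).1 e.2 x hx
      rw [one_smul, mul_smul, this]
    let f : E ⧸ K → {q : AgreeQuotient Γ B // AgreeQuotient.restrict hCB q =
        Quotient.mk (agreeSetoid Γ C) h} :=
      Quotient.lift (fun e : E => ⟨Quotient.mk (agreeSetoid Γ B) (h * e), hmem e⟩) (by
        intro e e' hee
        have hee := QuotientGroup.leftRel_apply.1 hee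
        rw [Subgroup.mem_subgroupOf, mem_fixingSubgroup_iff] at hee
        refine Subtype.ext (AgreeQuotient.mk_eq.2 ⟨1, Γ.one_mem, fun x hx => ?_⟩)
        have := hee x hx
        simp only [Subgroup.coe_mul, Subgroup.coe_inv, mul_smul] at this
        rw [one_smul, mul_smul, mul_smul, inv_smul_eq_iff.1 this])
    have hf : Function.Bijective f := by
      constructor
      · intro a b
        induction a using Quotient.inductionOn with
        | _ e =>
        induction b using Quotient.inductionOn with
        | _ e' =>
        intro hab
        obtain ⟨c, hc, H⟩ := AgreeQuotient.mk_eq.1 (congrArg Subtype.val hab)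
        have hc1 : c = 1 := by
          refine hfree c hc h fun x hx => ?_
          have := H x (hCB hx)
          rw [mul_smul, mul_smul, (mem_fixingSubgroup_iff G).1 e.2 x hx,
            (mem_fixingSubgroup_iff G).1 e'.2 x hx] at this
          exact this.symm
        subst hc1
        refine Quotient.sound (QuotientGroup.leftRel_apply.2 ?_)
        rw [Subgroup.mem_subgroupOf, mem_fixingSubgroup_iff]
        intro x hx
        have := H x hx
        rw [one_smul, mul_smul, mul_smul, smul_left_cancel_iff] at this
        simp only [Subgroup.coe_mul, Subgroup.coe_inv, mul_smul]
        rw [inv_smul_eq_iff]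
        exact this
      · rintro ⟨q, hq⟩
        induction q using Quotient.inductionOn with
        | _ k =>
        rw [AgreeQuotient.restrict_mk, eq_comm, AgreeQuotient.mk_eq] at hq
        obtain ⟨c, hc, H⟩ := hq
        have he : h⁻¹ * c⁻¹ * k ∈ E := by
          rw [mem_fixingSubgroup_iff]
          intro x hx
          rw [mul_smul, H x hx, mul_smul, inv_smul_smul, inv_smul_smul]
        refine ⟨Quotient.mk _ ⟨_, he⟩, Subtype.ext (AgreeQuotient.mk_eq.2 ⟨c, hc, fun x _ => ?_⟩)⟩
        simp [mul_smul]
    exact ⟨(Equiv.ofBijective f hf).symm⟩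
  let φ := fun r => (hfib r).some
  refine ⟨E ⧸ K, (Equiv.sigmaFiberEquiv (AgreeQuotient.restrict hCB)).symm.trans
    ((Equiv.sigmaCongrRight φ).trans (Equiv.sigmaEquivProd _ _)), fun q => rfl⟩

/-- Both sides are products with the common nonempty factor of classes on C. Cancelling its
cardinality leaves complementary factors of equal size, and any bijection of those works fibrewise.
-/
theorem AgreeQuotient.exists_equiv_over {Γ : Subgroup G} {B B' C : Set U} (hCB : C ⊆ B)
    (hCB' : C ⊆ B') (hfree : ∀ c ∈ Γ, ∀ h : G, (∀ x ∈ C, c • h • x = h • x) → c = 1)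
    [Finite (AgreeQuotient Γ B)] [Finite (AgreeQuotient Γ B')] (b b' : ℕ)
    (hb : Nat.card (AgreeQuotient Γ B) * b = Nat.card (AgreeQuotient Γ B') * b') :
    ∃ β : AgreeQuotient Γ B × Fin b ≃ AgreeQuotient Γ B' × Fin b', ∀ p,
      AgreeQuotient.restrict hCB' (β p).1 = AgreeQuotient.restrict hCB p.1 := by
  obtain ⟨M, e, he⟩ := AgreeQuotient.exists_equiv_prod hCB hfree
  obtain ⟨M', e', he'⟩ := AgreeQuotient.exists_equiv_prod hCB' hfree
  let q₀ : AgreeQuotient Γ C := Quotient.mk _ 1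
  have : Finite (AgreeQuotient Γ C × M) := Finite.of_equiv _ e
  have : Finite (AgreeQuotient Γ C × M') := Finite.of_equiv _ e'
  have : Finite M := Finite.of_injective (fun m => (q₀, m)) (Prod.mk_right_injective q₀)
  have : Finite M' := Finite.of_injective (fun m => (q₀, m)) (Prod.mk_right_injective q₀)
  have : Finite (AgreeQuotient Γ C) := Finite.of_surjective (AgreeQuotient.restrict hCB)
    fun q => Quotient.inductionOn q fun h => ⟨Quotient.mk _ h, rfl⟩
  have : Nonempty (AgreeQuotient Γ C) := ⟨q₀⟩
  have hcard : Nat.card (M × Fin b) = Nat.card (M' × Fin b') := by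
    rw [Nat.card_congr e, Nat.card_congr e', Nat.card_prod, Nat.card_prod, mul_assoc, mul_assoc]
      at hb
    rw [Nat.card_prod, Nat.card_prod, Nat.card_fin, Nat.card_fin]
    exact Nat.eq_of_mul_eq_mul_left Nat.card_pos hb
  let ε : M × Fin b ≃ M' × Fin b' := (Finite.card_eq.1 hcard).some
  refine ⟨(e.prodCongr (Equiv.refl _)).trans ((Equiv.prodAssoc _ _ _).trans
    (((Equiv.refl _).prodCongr ε).trans ((Equiv.prodAssoc _ _ _).symm.trans
      (e'.symm.prodCongr (Equiv.refl _))))), fun p => ?_⟩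
  rw [← he, ← he']
  simp

theorem AgreeQuotient.card_image_smul (Γ : Subgroup G) (B B' : Set U) (g : G)
    (hB : ∀ x, g • x ∈ B' ↔ x ∈ B) :
    Nat.card (AgreeQuotient Γ B') = Nat.card (AgreeQuotient Γ B) := by
  refine Nat.card_congr (Quotient.congr (Equiv.mulRight g) fun h k => ?_)
  constructor
  · rintro ⟨c, hc, H⟩
    refine ⟨c, hc, fun x hx => ?_⟩
    simpa [mul_smul] using H (g • x) ((hB x).2 hx)
  · rintro ⟨c, hc, H⟩
    refine ⟨c, hc, fun x hx => ?_⟩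
    have := H (g⁻¹ • x) ((hB _).1 (by simpa using hx))
    simpa [mul_smul] using this

end Agree

/-! ### A Leighton theorem for groups acting on tree-like graphs -/

section TreeLattice

variable {G U : Type u} [Group G] [MulAction G U]

/-- The closed ball of radius one around a vertex. -/
def starBall (Adj : U → U → Prop) (u : U) : Set U := insert u {w | Adj u w}

theorem pair_subset_starBall {Adj : U → U → Prop} {u w : U} (h : Adj u w) :
    ({u, w} : Set U) ⊆ starBall Adj u := by
  rintro x (rfl | rfl)
  · exact Or.inl rfl
  · exact Or.inr h

theorem smul_mem_starBall_iff {Adj : U → U → Prop} (hAdj : ∀ (g : G) u w, Adj (g • u) (g • w) ↔ Adj u w)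
    (g : G) (u x : U) : g • x ∈ starBall Adj (g • u) ↔ x ∈ starBall Adj u := by
  simp [starBall, hAdj]

/-- A set of representatives of the undirected edges modulo `Γ`, when `Γ` acts freely on them. -/
theorem exists_edge_representatives {Adj : U → U → Prop} (hirr : ∀ u, ¬ Adj u u) (Γ : Subgroup G)
    (hΓ : ∀ γ ∈ Γ, ∀ u w, Adj u w →
      (γ • u = u ∧ γ • w = w) ∨ (γ • u = w ∧ γ • w = u) → γ = 1) :
    ∃ Rep : Set (U × U), (∀ r ∈ Rep, Adj r.1 r.2) ∧
      (∀ u w, Adj u w → ∃ γ ∈ Γ, ∃ r ∈ Rep,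
        (u = γ • r.1 ∧ w = γ • r.2) ∨ (u = γ • r.2 ∧ w = γ • r.1)) ∧
      (∀ γ ∈ Γ, ∀ γ' ∈ Γ, ∀ r ∈ Rep, ∀ r' ∈ Rep, γ • r.1 = γ' • r'.1 → γ • r.2 = γ' • r'.2 →
        γ = γ' ∧ r = r') ∧
      (∀ γ ∈ Γ, ∀ γ' ∈ Γ, ∀ r ∈ Rep, ∀ r' ∈ Rep, γ • r.1 = γ' • r'.2 → γ • r.2 = γ' • r'.1 →
        False) := by
  let S : Setoid {p : U × U // Adj p.1 p.2} :=
    { r := fun p q => ∃ γ ∈ Γ, (q.1.1 = γ • p.1.1 ∧ q.1.2 = γ • p.1.2) ∨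
        (q.1.1 = γ • p.1.2 ∧ q.1.2 = γ • p.1.1)
      iseqv :=
        { refl := fun p => ⟨1, Γ.one_mem, by simp⟩
          symm := by
            rintro p q ⟨γ, hγ, ⟨h1, h2⟩ | ⟨h1, h2⟩⟩
            · exact ⟨γ⁻¹, Γ.inv_mem hγ, Or.inl (by simp [h1, h2])⟩
            · exact ⟨γ⁻¹, Γ.inv_mem hγ, Or.inr (by simp [h1, h2])⟩
          trans := by
            rintro p q r ⟨γ, hγ, ⟨h1, h2⟩ | ⟨h1, h2⟩⟩ ⟨γ', hγ', ⟨h3, h4⟩ | ⟨h3, h4⟩⟩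
            · exact ⟨γ' * γ, Γ.mul_mem hγ' hγ, Or.inl (by simp [h1, h2, h3, h4, mul_smul])⟩
            · exact ⟨γ' * γ, Γ.mul_mem hγ' hγ, Or.inr (by simp [h1, h2, h3, h4, mul_smul])⟩
            · exact ⟨γ' * γ, Γ.mul_mem hγ' hγ, Or.inr (by simp [h1, h2, h3, h4, mul_smul])⟩
            · exact ⟨γ' * γ, Γ.mul_mem hγ' hγ, Or.inl (by simp [h1, h2, h3, h4, mul_smul])⟩ } }
  have hrep : ∀ p : Quotient S, ∀ q : Quotient S, S.r p.out q.out → p = q := by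
    intro p q h
    have := Quotient.sound h
    rwa [Quotient.out_eq, Quotient.out_eq] at this
  refine ⟨Set.range fun q : Quotient S => q.out.1, ?_, ?_, ?_, ?_⟩
  · rintro _ ⟨q, rfl⟩
    exact q.out.2
  · intro u w huw
    obtain ⟨γ, hγ, h⟩ := Quotient.mk_out (s := S) ⟨(u, w), huw⟩
    exact ⟨γ, hγ, _, ⟨_, rfl⟩, h⟩
  · rintro γ hγ γ' hγ' _ ⟨p, rfl⟩ _ ⟨q, rfl⟩ h1 h2
    have hpq : p = q := hrep p q ⟨γ'⁻¹ * γ, Γ.mul_mem (Γ.inv_mem hγ') hγ,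
      Or.inl (by simp only [mul_smul]; rw [h1, h2, inv_smul_smul, inv_smul_smul]; exact ⟨rfl, rfl⟩)⟩
    subst hpq
    have h3 := hΓ (γ'⁻¹ * γ) (Γ.mul_mem (Γ.inv_mem hγ') hγ) _ _ p.out.2 (Or.inl
      (by simp only [mul_smul]; rw [h1, h2, inv_smul_smul, inv_smul_smul]; exact ⟨rfl, rfl⟩))
    exact ⟨(inv_mul_eq_one.1 h3).symm, rfl⟩
  · rintro γ hγ γ' hγ' _ ⟨p, rfl⟩ _ ⟨q, rfl⟩ h1 h2
    have hpq : p = q := hrep p q ⟨γ'⁻¹ * γ, Γ.mul_mem (Γ.inv_mem hγ') hγ,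
      Or.inr (by simp only [mul_smul]; rw [h1, h2, inv_smul_smul, inv_smul_smul]; exact ⟨rfl, rfl⟩)⟩
    subst hpq
    have h3 := hΓ (γ'⁻¹ * γ) (Γ.mul_mem (Γ.inv_mem hγ') hγ) _ _ p.out.2 (Or.inr
      (by simp only [mul_smul]; rw [h1, h2, inv_smul_smul, inv_smul_smul]; exact ⟨rfl, rfl⟩))
    obtain rfl := inv_mul_eq_one.1 h3
    -- An edge carried to its reverse would be inverted by an element of `Γ`; that element is
    -- trivial, so the two ends coincide.
    refine hirr p.out.1.1 ?_
    have h4 := smul_left_cancel _ h1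
    have := p.out.2
    rwa [← h4] at this

/-- A `Γ`-equivariant relation between states at adjacent vertices which is a bijection of classes
over each edge. A state at `u` is an element of `G`, up to agreement on the star of `u`, with an
index below `b u`. -/
theorem exists_equivariant_matching {Adj : U → U → Prop} (hsymm : ∀ u w, Adj u w → Adj w u)
    (hirr : ∀ u, ¬ Adj u u) (hAdj : ∀ (g : G) u w, Adj (g • u) (g • w) ↔ Adj u w)
    (Γ Γ' : Subgroup G)
    (hΓ : ∀ γ ∈ Γ, ∀ u w, Adj u w →
      (γ • u = u ∧ γ • w = w) ∨ (γ • u = w ∧ γ • w = u) → γ = 1)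
    (hΓ' : ∀ γ ∈ Γ', ∀ u w, Adj u w → γ • u = u → γ • w = w → γ = 1)
    (hfin : ∀ u, Finite (AgreeQuotient Γ' (starBall Adj u)))
    (b : U → ℕ) (s : ℕ) (hb : ∀ u, Nat.card (AgreeQuotient Γ' (starBall Adj u)) * b u = s)
    (hbinv : ∀ (g : G) u, b (g • u) = b u) :
    ∃ R : U → U → G × ℕ → G × ℕ → Prop,
      (∀ u w x y, R u w x y → R w u y x) ∧
      (∀ u w x, Adj u w → x.2 < b u → ∃ y, y.2 < b w ∧ R u w x y) ∧
      (∀ u w x y x' y', R u w x y → R u w x' y' → x.2 = x'.2 →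
        (∃ c ∈ Γ', ∀ z ∈ starBall Adj u, x'.1 • z = c • x.1 • z) →
        y.2 = y'.2 ∧ ∃ c ∈ Γ', ∀ z ∈ starBall Adj w, y'.1 • z = c • y.1 • z) ∧
      (∀ u w x y, R u w x y → ∃ c ∈ Γ', y.1 • u = c • x.1 • u ∧ y.1 • w = c • x.1 • w) ∧
      (∀ γ ∈ Γ, ∀ u w x y, R u w x y → R (γ • u) (γ • w) (x.1 * γ⁻¹, x.2) (y.1 * γ⁻¹, y.2)) := by
  obtain ⟨Rep, hRepAdj, hRepEx, hRepUniq, hRepNe⟩ :=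
    exists_edge_representatives hirr Γ hΓ
  -- The matching is chosen freely on one representative of each edge orbit. It exists because both
  -- ends have s states, and it preserves the restriction to the edge.
  have hβ : ∀ r : Rep, ∃ β : AgreeQuotient Γ' (starBall Adj r.1.1) × Fin (b r.1.1) ≃
      AgreeQuotient Γ' (starBall Adj r.1.2) × Fin (b r.1.2), ∀ p,
      AgreeQuotient.restrict (C := {r.1.1, r.1.2})
        (Set.pair_comm r.1.1 r.1.2 ▸ pair_subset_starBall (hsymm _ _ (hRepAdj _ r.2))) (β p).1 =
      AgreeQuotient.restrict (pair_subset_starBall (hRepAdj _ r.2)) p.1 := by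
    intro r
    refine AgreeQuotient.exists_equiv_over _ _ ?_ _ _ (by rw [hb, hb])
    intro c hc h H
    exact hΓ' c hc (h • r.1.1) (h • r.1.2) ((hAdj _ _ _).2 (hRepAdj _ r.2)) (H _ (by simp))
      (H _ (by simp))
  choose β hβ using hβ
  let lab : ∀ u : U, AgreeQuotient Γ' (starBall Adj u) × Fin (b u) → G → ℕ → Prop :=
    fun u p h i => p.1 = Quotient.mk _ h ∧ p.2.val = i
  have lab_unique : ∀ u p p' γ h i h' i', lab u p (h * γ) i → lab u p' (h' * γ) i' → i = i' →
      (∃ c ∈ Γ', ∀ z ∈ starBall Adj (γ • u), h' • z = c • h • z) → p = p' := by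
    rintro u p p' γ h i h' i' ⟨h1, h2⟩ ⟨h3, h4⟩ hi ⟨c, hc, H⟩
    refine Prod.ext ?_ (Fin.ext (by rw [h2, h4, hi]))
    rw [h1, h3, AgreeQuotient.mk_eq]
    refine ⟨c, hc, fun x hx => ?_⟩
    rw [mul_smul, mul_smul]
    exact H _ ((smul_mem_starBall_iff hAdj γ u x).2 hx)
  have lab_eq : ∀ u p γ h i h' i', lab u p (h * γ) i → lab u p (h' * γ) i' →
      i = i' ∧ ∃ c ∈ Γ', ∀ z ∈ starBall Adj (γ • u), h' • z = c • h • z := by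
    rintro u p γ h i h' i' ⟨h1, h2⟩ ⟨h3, h4⟩
    refine ⟨h2.symm.trans h4, ?_⟩
    obtain ⟨c, hc, H⟩ := AgreeQuotient.mk_eq.1 (h1.symm.trans h3)
    refine ⟨c, hc, fun z hz => ?_⟩
    have := H (γ⁻¹ • z) ((smul_mem_starBall_iff hAdj γ u _).1 (by simpa using hz))
    simpa [mul_smul] using this
  -- The matching on a representative is carried to its `Γ`-translates, in both orientations. A
  -- state h at a translate by γ is read at the representative as h γ. Uniqueness of γ and of the
  -- representative keeps the relation functional on classes.
  refine ⟨fun u w x y => ∃ γ ∈ Γ, ∃ r : Rep, ∃ p,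
    (u = γ • r.1.1 ∧ w = γ • r.1.2 ∧ lab _ p (x.1 * γ) x.2 ∧ lab _ (β r p) (y.1 * γ) y.2) ∨
    (u = γ • r.1.2 ∧ w = γ • r.1.1 ∧ lab _ (β r p) (x.1 * γ) x.2 ∧ lab _ p (y.1 * γ) y.2),
    ?_, ?_, ?_, ?_, ?_⟩
  · rintro u w x y ⟨γ, hγ, r, p, ⟨h1, h2, h3, h4⟩ | ⟨h1, h2, h3, h4⟩⟩
    · exact ⟨γ, hγ, r, p, Or.inr ⟨h2, h1, h4, h3⟩⟩
    · exact ⟨γ, hγ, r, p, Or.inl ⟨h2, h1, h4, h3⟩⟩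
  · rintro u w ⟨h, i⟩ huw hi
    obtain ⟨γ, hγ, r, hr, ⟨rfl, rfl⟩ | ⟨rfl, rfl⟩⟩ := hRepEx u w huw
    · rw [hbinv] at hi
      let p : AgreeQuotient Γ' (starBall Adj r.1) × Fin (b r.1) := (Quotient.mk _ (h * γ), ⟨i, hi⟩)
      obtain ⟨k, hk⟩ := Quotient.exists_rep (β ⟨r, hr⟩ p).1
      refine ⟨(k * γ⁻¹, (β ⟨r, hr⟩ p).2.val), by rw [hbinv]; exact (β ⟨r, hr⟩ p).2.2,
        γ, hγ, ⟨r, hr⟩, p, Or.inl ⟨rfl, rfl, ⟨rfl, rfl⟩, ?_, rfl⟩⟩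
      rw [inv_mul_cancel_right]
      exact hk.symm
    · rw [hbinv] at hi
      let p' : AgreeQuotient Γ' (starBall Adj r.2) × Fin (b r.2) := (Quotient.mk _ (h * γ), ⟨i, hi⟩)
      obtain ⟨p, hp⟩ := (β ⟨r, hr⟩).surjective p'
      obtain ⟨k, hk⟩ := Quotient.exists_rep p.1
      refine ⟨(k * γ⁻¹, p.2.val), by rw [hbinv]; exact p.2.2,
        γ, hγ, ⟨r, hr⟩, p, Or.inr ⟨rfl, rfl, ?_, ?_, rfl⟩⟩
      · rw [hp]
        exact ⟨rfl, rfl⟩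
      · rw [inv_mul_cancel_right]
        exact hk.symm
  · rintro u w x y x' y' ⟨γ, hγ, r, p, ⟨h1, h2, h3, h4⟩ | ⟨h1, h2, h3, h4⟩⟩
      ⟨γ', hγ', r', p', ⟨h1', h2', h3', h4'⟩ | ⟨h1', h2', h3', h4'⟩⟩ hx hxx
    · obtain ⟨rfl, hr⟩ := hRepUniq γ hγ γ' hγ' r r.2 r' r'.2 (h1.symm.trans h1') (h2.symm.trans h2')
      obtain rfl : r = r' := Subtype.ext hr
      subst h1 h2
      obtain rfl := lab_unique _ p p' γ _ _ _ _ h3 h3' hx hxx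
      exact lab_eq _ _ γ _ _ _ _ h4 h4'
    · exact (hRepNe γ hγ γ' hγ' r r.2 r' r'.2 (h1.symm.trans h1') (h2.symm.trans h2')).elim
    · exact (hRepNe γ hγ γ' hγ' r r.2 r' r'.2 (h2.symm.trans h2') (h1.symm.trans h1')).elim
    · obtain ⟨rfl, hr⟩ := hRepUniq γ hγ γ' hγ' r r.2 r' r'.2 (h2.symm.trans h2') (h1.symm.trans h1')
      obtain rfl : r = r' := Subtype.ext hr
      subst h1 h2
      have := (β r).injective (lab_unique _ (β r p) (β r p') γ _ _ _ _ h3 h3' hx hxx)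
      subst this
      exact lab_eq _ _ γ _ _ _ _ h4 h4'
  · have aux : ∀ (γ : G) (r : Rep) p h k i j, lab _ p (h * γ) i → lab _ (β r p) (k * γ) j →
        ∃ c ∈ Γ', k • γ • r.1.1 = c • h • γ • r.1.1 ∧ k • γ • r.1.2 = c • h • γ • r.1.2 := by
      rintro γ r p h k i j ⟨h1, -⟩ ⟨h2, -⟩
      have := hβ r p
      rw [h1, h2, AgreeQuotient.restrict_mk, AgreeQuotient.restrict_mk, eq_comm,
        AgreeQuotient.mk_eq] at this
      obtain ⟨c, hc, H⟩ := this
      refine ⟨c, hc, ?_, ?_⟩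
      · simpa [mul_smul] using H r.1.1 (by simp)
      · simpa [mul_smul] using H r.1.2 (by simp)
    rintro u w x y ⟨γ, hγ, r, p, ⟨rfl, rfl, h3, h4⟩ | ⟨rfl, rfl, h3, h4⟩⟩
    · exact aux γ r p _ _ _ _ h3 h4
    · obtain ⟨c, hc, H1, H2⟩ := aux γ r p _ _ _ _ h4 h3
      exact ⟨c⁻¹, Γ'.inv_mem hc, by rw [H2, inv_smul_smul], by rw [H1, inv_smul_smul]⟩
  · rintro δ hδ u w x y ⟨γ, hγ, r, p, ⟨rfl, rfl, h3, h4⟩ | ⟨rfl, rfl, h3, h4⟩⟩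
    · exact ⟨δ * γ, Γ.mul_mem hδ hγ, r, p, Or.inl ⟨(mul_smul _ _ _).symm, (mul_smul _ _ _).symm,
        by simpa [mul_assoc] using h3, by simpa [mul_assoc] using h4⟩⟩
    · exact ⟨δ * γ, Γ.mul_mem hδ hγ, r, p, Or.inr ⟨(mul_smul _ _ _).symm, (mul_smul _ _ _).symm,
        by simpa [mul_assoc] using h3, by simpa [mul_assoc] using h4⟩⟩

/-- A map of a tree-like graph to itself that agrees near each vertex with an automorphism is
bijective. -/
theorem IsTreeLike.bijective_of_locally {Adj : U → U → Prop} {u₀ : U} (hT : IsTreeLike Adj u₀)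
    (hsymm : ∀ u w, Adj u w → Adj w u) (hAdj : ∀ (g : G) u w, Adj (g • u) (g • w) ↔ Adj u w)
    (h : U → G) (hh : ∀ u w, Adj u w → h u • u = h w • u ∧ h u • w = h w • w) :
    Function.Bijective fun u => h u • u := by
  have hconn : ∀ (p : U → Prop) (a : U), p a → (∀ u w, Adj u w → p u → p w) → ∀ u, p u := by
    intro p a ha hp
    have h0 : p u₀ := by
      have := hT.induction (fun u => p u → p u₀) (fun h => h)
        (fun u w huw ih hw => ih (hp _ _ (hsymm _ _ huw) hw)) a
      exact this ha
    exact hT.induction p h0 hp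
  have hadj : ∀ u w, Adj u w → Adj (h u • u) (h w • w) := by
    intro u w huw
    rw [← (hh u w huw).2]
    exact (hAdj _ _ _).2 huw
  have hlift : ∀ u w', Adj (h u • u) w' → Adj u ((h u)⁻¹ • w') ∧
      h ((h u)⁻¹ • w') • (h u)⁻¹ • w' = w' := by
    intro u w' huw
    have h1 : Adj u ((h u)⁻¹ • w') := by
      rw [← hAdj (h u), smul_inv_smul]
      exact huw
    exact ⟨h1, by rw [← (hh _ _ h1).2, smul_inv_smul]⟩
  -- The image is nonempty and, since neighbours lift, closed under passing to neighbours.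
  have hsurj : Function.Surjective fun u => h u • u := by
    refine hconn (fun w => ∃ u, h u • u = w) (h u₀ • u₀) ⟨u₀, rfl⟩ ?_
    rintro _ w hw ⟨u, rfl⟩
    exact ⟨_, (hlift u w hw).2⟩
  refine ⟨?_, hsurj⟩
  obtain ⟨a₀, ha₀⟩ := hsurj u₀
  -- Lifting neighbours from a base point gives a right inverse of the map. It is onto, by
  -- connectedness and local injectivity, so the map is injective.
  obtain ⟨ψ, -, hψ⟩ := hT.exists_section (fun w => {u : U // h u • u = w})
    (fun _ _ s t => Adj s.1 t.1) (fun _ _ s t _ hst => hsymm _ _ hst)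
    (by
      rintro _ w huw ⟨u, rfl⟩
      exact ⟨⟨_, (hlift u w huw).2⟩, (hlift u w huw).1⟩) ⟨a₀, ha₀⟩
  have hψs : ∀ u, ∃ w, (ψ w).1 = u := by
    refine hconn _ (ψ u₀).1 ⟨u₀, rfl⟩ ?_
    rintro _ u' hu' ⟨w, rfl⟩
    refine ⟨h u' • u', ?_⟩
    have h1 : Adj w (h u' • u') := by
      have := hadj _ _ hu'
      rwa [(ψ w).2] at this
    have h2 := hψ _ _ h1
    have h3 : h (ψ w).1 • (ψ (h u' • u')).1 = h (ψ w).1 • u' := by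
      rw [(hh _ _ h2).2, (hh _ _ hu').2, (ψ (h u' • u')).2]
    exact smul_left_cancel _ h3
  intro u u' huu
  obtain ⟨w, rfl⟩ := hψs u
  obtain ⟨w', rfl⟩ := hψs u'
  have : w = w' := by
    have := huu
    simp only at this
    rwa [(ψ w).2, (ψ w').2] at this
  rw [this]

/-- Let `G` act on a tree-like graph so that every bijection which agrees with elements of `G` near
each vertex comes from `G`. Then two subgroups which act freely on edges and with suitable
finiteness conditions are commensurable up to conjugation. -/
theorem IsTreeLike.exists_conj_le {Adj : U → U → Prop} {u₀ : U} (hT : IsTreeLike Adj u₀)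
    (hsymm : ∀ u w, Adj u w → Adj w u)
    (hirr : ∀ u, ¬ Adj u u) (hAdj : ∀ (g : G) u w, Adj (g • u) (g • w) ↔ Adj u w)
    (Γ Γ' : Subgroup G)
    (hΓ : ∀ γ ∈ Γ, ∀ u w, Adj u w →
      (γ • u = u ∧ γ • w = w) ∨ (γ • u = w ∧ γ • w = u) → γ = 1)
    (hΓ' : ∀ γ ∈ Γ', ∀ u w, Adj u w → γ • u = u → γ • w = w → γ = 1)
    (hfin : ∀ u, Finite (AgreeQuotient Γ' (starBall Adj u)))
    (horb : ∃ F : Set U, F.Finite ∧ ∀ u, ∃ g : G, g • u ∈ F)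
    (hglue : ∀ h : U → G, (∀ u w, Adj u w → h u • u = h w • u ∧ h u • w = h w • w) →
      Function.Bijective (fun u => h u • u) → ∃ g : G, ∀ u, g • u = h u • u)
    (hfaith : ∀ g : G, (∀ u : U, g • u = u) → g = 1) :
    ∃ g : G, ∃ Δ ≤ Γ, Δ.relIndex Γ ≠ 0 ∧ ∀ δ ∈ Δ, g * δ * g⁻¹ ∈ Γ' := by
  classical
  have hcardinv : ∀ (g : G) u, Nat.card (AgreeQuotient Γ' (starBall Adj (g • u))) =
      Nat.card (AgreeQuotient Γ' (starBall Adj u)) := fun g u =>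
    AgreeQuotient.card_image_smul Γ' _ _ g (smul_mem_starBall_iff hAdj g u)
  have hcardpos : ∀ u, 0 < Nat.card (AgreeQuotient Γ' (starBall Adj u)) := fun u =>
    haveI : Nonempty (AgreeQuotient Γ' (starBall Adj u)) := ⟨Quotient.mk _ 1⟩
    Nat.card_pos
  -- The product of the class counts over finitely many orbit representatives is a common multiple
  -- of all of them. The multiplicity b then gives each vertex exactly s states.
  obtain ⟨s, hs, hdvd⟩ : ∃ s : ℕ, 0 < s ∧
      ∀ u, Nat.card (AgreeQuotient Γ' (starBall Adj u)) ∣ s := by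
    obtain ⟨F, hF, hFu⟩ := horb
    refine ⟨∏ u ∈ hF.toFinset, Nat.card (AgreeQuotient Γ' (starBall Adj u)),
      Finset.prod_pos fun u _ => hcardpos u, fun u => ?_⟩
    obtain ⟨g, hg⟩ := hFu u
    rw [← hcardinv g u]
    exact Finset.dvd_prod_of_mem _ (hF.mem_toFinset.2 hg)
  let b : U → ℕ := fun u => s / Nat.card (AgreeQuotient Γ' (starBall Adj u))
  have hb : ∀ u, Nat.card (AgreeQuotient Γ' (starBall Adj u)) * b u = s := fun u =>
    Nat.mul_div_cancel' (hdvd u)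
  have hbinv : ∀ (g : G) u, b (g • u) = b u := fun g u => by simp only [b, hcardinv]
  have hbpos : ∀ u, 0 < b u := fun u => Nat.pos_of_mul_pos_left (hb u ▸ hs)
  obtain ⟨R, hRsymm, hRext, hRfun, hRedge, hRequiv⟩ := exists_equivariant_matching hsymm hirr hAdj
    Γ Γ' hΓ hΓ' hfin b s hb hbinv
  obtain ⟨σ, hσlt, hσ⟩ : ∃ σ : U → G × ℕ, (∀ u, (σ u).2 < b u) ∧
      ∀ u w, Adj u w → R u w (σ u) (σ w) := by
    obtain ⟨σ, -, hσ⟩ := hT.exists_section (fun u => {x : G × ℕ // x.2 < b u})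
      (fun u w x y => R u w x.1 y.1) (fun u w x y _ h => hRsymm _ _ _ _ h)
      (fun u w huw x => by
        obtain ⟨y, hy, hxy⟩ := hRext u w x.1 huw x.2
        exact ⟨⟨y, hy⟩, hxy⟩) ⟨(1, 0), hbpos u₀⟩
    exact ⟨fun u => (σ u).1, fun u => (σ u).2, hσ⟩
  let rel : U → G × ℕ → G × ℕ → Prop := fun u x y => x.2 = y.2 ∧
    ∃ c ∈ Γ', ∀ z ∈ starBall Adj u, y.1 • z = c • x.1 • z
  have rel_symm : ∀ u x y, rel u x y → rel u y x := by
    rintro u x y ⟨h1, c, hc, H⟩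
    exact ⟨h1.symm, c⁻¹, Γ'.inv_mem hc, fun z hz => by rw [H z hz, inv_smul_smul]⟩
  have rel_trans : ∀ u x y z, rel u x y → rel u y z → rel u x z := by
    rintro u x y z ⟨h1, c, hc, H⟩ ⟨h2, d, hd, H'⟩
    exact ⟨h1.trans h2, d * c, Γ'.mul_mem hd hc, fun t ht => by rw [H' t ht, H t ht, mul_smul]⟩
  have rel_smul : ∀ (γ : G) u x y, rel u x y → rel (γ • u) (x.1 * γ⁻¹, x.2) (y.1 * γ⁻¹, y.2) := by
    rintro γ u x y ⟨h1, c, hc, H⟩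
    refine ⟨h1, c, hc, fun z hz => ?_⟩
    have := H (γ⁻¹ • z) ((smul_mem_starBall_iff hAdj γ u _).1 (by simpa using hz))
    simpa [mul_smul] using this
  -- The translate of the family σ by γ.
  let τ : G → U → G × ℕ := fun γ u =>
    ((σ (γ⁻¹ • u)).1 * γ⁻¹, (σ (γ⁻¹ • u)).2)
  have τ_mul : ∀ γ δ u, τ (γ * δ) (γ • u) = ((τ δ u).1 * γ⁻¹, (τ δ u).2) := by
    intro γ δ u
    simp [τ, mul_smul, mul_assoc]
  have τ_one : ∀ u, τ 1 u = (σ u) := by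
    intro u
    simp [τ]
  have hτR : ∀ γ ∈ Γ, ∀ u w, Adj u w → R u w (τ γ u) (τ γ w) := by
    intro γ hγ u w huw
    have := hRequiv γ hγ _ _ _ _ (hσ (γ⁻¹ • u) (γ⁻¹ • w) ((hAdj _ _ _).2 huw))
    rwa [smul_inv_smul, smul_inv_smul] at this
  have hτlt : ∀ γ u, (τ γ u).2 < b u := by
    intro γ u
    have := hσlt (γ⁻¹ • u)
    rwa [hbinv] at this
  -- Translates of σ are again compatible with the matching, which is functional on classes;
  -- agreement at the base vertex therefore propagates.
  have hτall : ∀ γ ∈ Γ, ∀ δ ∈ Γ, rel u₀ (τ γ u₀) (τ δ u₀) → ∀ u, rel u (τ γ u) (τ δ u) := by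
    intro γ hγ δ hδ h0
    refine hT.induction _ h0 fun u w huw h => ?_
    exact hRfun u w _ _ _ _ (hτR γ hγ u w huw) (hτR δ hδ u w huw) h.1 h.2
  have τ_shift : ∀ ε γ δ, (∀ u, rel u (τ γ u) (τ δ u)) → ∀ u, rel u (τ (ε * γ) u) (τ (ε * δ) u) := by
    intro ε γ δ h u
    have := rel_smul ε _ _ _ (h (ε⁻¹ • u))
    rwa [← τ_mul, ← τ_mul, smul_inv_smul] at this
  -- The stabilizer in `Γ` of the family of classes of σ. Its cosets are told apart by the state at
  -- the base vertex, of which there are finitely many.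
  let Δ : Subgroup G :=
    { carrier := {γ | γ ∈ Γ ∧ ∀ u, rel u (τ 1 u) (τ γ u)}
      one_mem' := ⟨Γ.one_mem, fun u => ⟨rfl, 1, Γ'.one_mem, by simp⟩⟩
      mul_mem' := by
        rintro γ δ ⟨hγ, h1⟩ ⟨hδ, h2⟩
        refine ⟨Γ.mul_mem hγ hδ, fun u => rel_trans _ _ _ _ (h1 u) ?_⟩
        have := τ_shift γ 1 δ h2 u
        rwa [mul_one] at this
      inv_mem' := by
        rintro γ ⟨hγ, h1⟩
        refine ⟨Γ.inv_mem hγ, fun u => rel_symm _ _ _ ?_⟩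
        have := τ_shift γ⁻¹ 1 γ h1 u
        rwa [mul_one, inv_mul_cancel] at this }
  have hΔfin : Δ.relIndex Γ ≠ 0 := by
    have := hfin u₀
    let f : Γ → AgreeQuotient Γ' (starBall Adj u₀) × Fin (b u₀) :=
      fun γ => (Quotient.mk _ (τ γ u₀).1, ⟨(τ γ u₀).2, hτlt γ u₀⟩)
    have hf : ∀ γ δ : Γ, f γ = f δ → (γ⁻¹ * δ : Γ) ∈ Δ.subgroupOf Γ := by
      intro γ δ h
      have h1 := AgreeQuotient.mk_eq.1 (congrArg Prod.fst h)
      have h2 : (τ γ u₀).2 = (τ δ u₀).2 := congrArg (fun p => p.2.val) h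
      rw [Subgroup.mem_subgroupOf]
      refine ⟨(γ⁻¹ * δ).2, fun u => ?_⟩
      have := τ_shift (γ : G)⁻¹ γ δ (hτall γ γ.2 δ δ.2 ⟨h2, h1⟩) u
      rwa [inv_mul_cancel] at this
    have : Finite (Γ ⧸ Δ.subgroupOf Γ) := by
      refine Finite.of_injective (fun q => f (Quotient.out q)) fun p q hpq => ?_
      have := hf _ _ hpq
      rw [← QuotientGroup.out_eq' p, ← QuotientGroup.out_eq' q]
      exact QuotientGroup.eq.2 this
    exact Subgroup.index_ne_zero_of_finite
  -- Neighbouring states agree on the common edge only up to `Γ'`. The corrections c, propagated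
  -- over the tree, make them agree exactly.
  obtain ⟨c, -, hc⟩ := hT.exists_section (fun _ => Γ')
    (fun u w x y => x.1 • (σ u).1 • u = y.1 • (σ w).1 • u ∧
      x.1 • (σ u).1 • w = y.1 • (σ w).1 • w)
    (fun u w x y _ h => ⟨h.2.symm, h.1.symm⟩)
    (fun u w huw x => by
      obtain ⟨e, he, h1, h2⟩ := hRedge _ _ _ _ (hσ u w huw)
      refine ⟨x * ⟨e, he⟩⁻¹, ?_, ?_⟩
      · rw [h1]; simp [mul_smul]
      · rw [h2]; simp [mul_smul]) 1
  let k : U → G := fun u => (c u).1 * (σ u).1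
  have hk : ∀ u w, Adj u w → k u • u = k w • u ∧ k u • w = k w • w := by
    intro u w huw
    simpa only [k, mul_smul] using hc u w huw
  obtain ⟨g, hg⟩ := hglue k hk (hT.bijective_of_locally hsymm hAdj k hk)
  have hgball : ∀ u, ∀ z ∈ starBall Adj u, g • z = k u • z := by
    rintro u z (rfl | hz)
    · exact hg z
    · rw [hg, (hk u z hz).2]
  refine ⟨g, Δ, fun γ hγ => hγ.1, hΔfin, fun δ hδ => ?_⟩
  suffices h : ∀ δ ∈ Δ, g * δ⁻¹ * g⁻¹ ∈ Γ' by simpa using h δ⁻¹ (Δ.inv_mem hδ)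
  intro δ hδ
  have hκ : ∀ u, ∃ κ ∈ Γ', ∀ z ∈ starBall Adj u, g • δ⁻¹ • z = κ • g • z := by
    intro u
    obtain ⟨-, e, he, H⟩ := hδ.2 u
    refine ⟨(c (δ⁻¹ • u)).1 * e * (c u).1⁻¹,
      Γ'.mul_mem (Γ'.mul_mem (c _).2 he) (Γ'.inv_mem (c u).2), fun z hz => ?_⟩
    have h1 := H z hz
    rw [τ_one] at h1
    rw [hgball (δ⁻¹ • u) (δ⁻¹ • z) ((smul_mem_starBall_iff hAdj _ _ _).2 hz), hgball u z hz]
    simp only [k, mul_smul, inv_smul_smul]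
    rw [← h1]
    simp [τ, mul_smul]
  choose κ hκΓ hκ using hκ
  -- The elements of `Γ'` found at the two ends of an edge act alike on its image under g, so
  -- freeness on edges identifies them.
  have hconst : ∀ u, κ u = κ u₀ := by
    refine hT.induction _ rfl fun u w huw h => ?_
    rw [← h]
    have h1 : g • δ⁻¹ • u = κ w • g • u := hκ w u (Or.inr (hsymm _ _ huw))
    have h2 : g • δ⁻¹ • w = κ w • g • w := hκ w w (Or.inl rfl)
    have h3 : g • δ⁻¹ • u = κ u • g • u := hκ u u (Or.inl rfl)
    have h4 : g • δ⁻¹ • w = κ u • g • w := hκ u w (Or.inr huw)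
    have := hΓ' ((κ w)⁻¹ * κ u) (Γ'.mul_mem (Γ'.inv_mem (hκΓ w)) (hκΓ u)) (g • u) (g • w)
      ((hAdj _ _ _).2 huw) (by rw [mul_smul, ← h3, h1, inv_smul_smul])
      (by rw [mul_smul, ← h4, h2, inv_smul_smul])
    exact inv_mul_eq_one.1 this
  have hfin' : (κ u₀)⁻¹ * (g * δ⁻¹ * g⁻¹) = 1 := by
    refine hfaith _ fun u => ?_
    have h1 := hκ (g⁻¹ • u) (g⁻¹ • u) (Or.inl rfl)
    rw [hconst, smul_inv_smul] at h1
    rw [mul_smul, mul_smul, mul_smul, h1, inv_smul_smul]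
  rw [← inv_mul_eq_one.1 hfin']
  exact hκΓ u₀

end TreeLattice

open scoped RealInnerProductSpace
open Topology

/-! ### Geometry of the rank-one symmetric spaces -/

/-- A finite-dimensional space of functions is separated by finitely many of the evaluations that
separate it. -/
theorem exists_finite_evaluations {α : Type*} (W : Submodule ℝ (α → ℝ)) [FiniteDimensional ℝ W]
    (A : Set α) : ∃ F : Set α, F.Finite ∧ F ⊆ A ∧
      ∀ w ∈ W, (∀ y ∈ F, w y = 0) → ∀ y ∈ A, w y = 0 := by
  induction hn : Module.finrank ℝ W using Nat.strong_induction_on generalizing W with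
  | _ n ih =>
  by_cases h : ∀ w ∈ W, ∀ y ∈ A, w y = 0
  · exact ⟨∅, Set.finite_empty, Set.empty_subset _, fun w hw _ => h w hw⟩
  · push Not at h
    obtain ⟨w₀, hw₀, a, ha, hwa⟩ := h
    -- Requiring vanishing at a lowers the dimension, because the chosen function does not vanish
    -- there.
    let W' : Submodule ℝ (α → ℝ) := W ⊓ LinearMap.ker (LinearMap.proj a : (α → ℝ) →ₗ[ℝ] ℝ)
    have hlt : W' < W := by
      refine lt_of_le_of_ne inf_le_left fun h => hwa ?_
      rw [← h] at hw₀
      exact hw₀.2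
    have hfin : FiniteDimensional ℝ W' := Submodule.finiteDimensional_of_le hlt.le
    obtain ⟨F, hF, hFA, H⟩ := ih _ (hn ▸ Submodule.finrank_lt_finrank_of_lt hlt) W' rfl
    refine ⟨insert a F, hF.insert a, Set.insert_subset ha hFA, fun w hw hwF => ?_⟩
    exact H w ⟨hw, hwF a (Set.mem_insert _ _)⟩ fun y hy => hwF y (Set.mem_insert_of_mem _ hy)

/-- The properties of the quartic part `q` of the pairing of a projective ball model that are used
below. -/
structure IsBallForm {E : Type*} [NormedAddCommGroup E] [InnerProductSpace ℝ E]
    (q : E → E → ℝ) : Prop where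
  continuous : Continuous fun p : E × E => q p.1 p.2
  neg_right : ∀ x y, q x (-y) = q x y
  finiteDimensional : ∃ W : Submodule ℝ (E → ℝ), FiniteDimensional ℝ W ∧ ∀ x, q x ∈ W
  span : ∃ Ξ : Set E, Submodule.span ℝ Ξ = ⊤ ∧
    ∀ ξ ∈ Ξ, ‖ξ‖ = 1 ∧ ∀ (t : ℝ) a, (t * ⟪a, ξ⟫) ^ 2 ≤ q (t • ξ) a
  orthonormal : ∃ u v : E, ‖u‖ = 1 ∧ ‖v‖ = 1 ∧ ⟪u, v⟫ = 0

/-- A metric space with a projective ball model given by the form `q`. -/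
structure BallModel {E : Type*} [NormedAddCommGroup E] [InnerProductSpace ℝ E]
    (q : E → E → ℝ) (S : Type*) [MetricSpace S] where
  c : ℝ
  f : S → E
  c_pos : 0 < c
  injective : Function.Injective f
  range_eq : Set.range f = Metric.ball 0 1
  cosh_sq : ∀ s t, Real.cosh (dist s t / c) ^ 2 =
    (1 - 2 * ⟪f s, f t⟫ + q (f s) (f t)) / ((1 - ‖f s‖ ^ 2) * (1 - ‖f t‖ ^ 2))

namespace BallModel

variable {E : Type*} [NormedAddCommGroup E] [InnerProductSpace ℝ E] {q : E → E → ℝ}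
  {S : Type*} [MetricSpace S]

theorem norm_lt (m : BallModel q S) (s : S) : ‖m.f s‖ < 1 := by
  have : m.f s ∈ Metric.ball (0 : E) 1 := m.range_eq ▸ Set.mem_range_self s
  simpa using this

theorem one_sub_pos (m : BallModel q S) (s : S) : 0 < 1 - ‖m.f s‖ ^ 2 := by
  have h1 := m.norm_lt s
  have h0 := norm_nonneg (m.f s)
  nlinarith

theorem exists_eq (m : BallModel q S) {x : E} (hx : ‖x‖ < 1) : ∃ s, m.f s = x := by
  have : x ∈ Set.range m.f := by rw [m.range_eq]; simpa using hx
  exact this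

/-- The point with given coordinates in the ball. -/
noncomputable def point (m : BallModel q S) (x : Metric.ball (0 : E) 1) : S :=
  (m.exists_eq (mem_ball_zero_iff.1 x.2)).choose

theorem f_point (m : BallModel q S) (x : Metric.ball (0 : E) 1) : m.f (m.point x) = x :=
  (m.exists_eq (mem_ball_zero_iff.1 x.2)).choose_spec

theorem point_surjective (m : BallModel q S) : Function.Surjective m.point := fun s =>
  ⟨⟨m.f s, by simpa using m.norm_lt s⟩, m.injective (m.f_point _)⟩

theorem pairing_eq (m : BallModel q S) (s t : S) : 1 - 2 * ⟪m.f s, m.f t⟫ + q (m.f s) (m.f t) =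
    Real.cosh (dist s t / m.c) ^ 2 * ((1 - ‖m.f s‖ ^ 2) * (1 - ‖m.f t‖ ^ 2)) := by
  rw [m.cosh_sq, div_mul_cancel₀]
  exact (mul_pos (m.one_sub_pos s) (m.one_sub_pos t)).ne'

/-- The expression Φ for cosh² is continuous in the coordinates and equals 1 on the diagonal. Since
x ≤ sinh x for x ≥ 0, the distance is at most c √(Φ - 1), which tends to 0. -/
theorem continuous_point (m : BallModel q S) (hq : IsBallForm q) : Continuous m.point := by
  rw [continuous_iff_continuousAt]
  intro z₀
  rw [ContinuousAt, tendsto_iff_dist_tendsto_zero]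
  let Φ : Metric.ball (0 : E) 1 → ℝ := fun z =>
    (1 - 2 * ⟪(z : E), (z₀ : E)⟫ + q z z₀) / ((1 - ‖(z : E)‖ ^ 2) * (1 - ‖(z₀ : E)‖ ^ 2))
  have hΦ : ∀ z, Real.cosh (dist (m.point z) (m.point z₀) / m.c) ^ 2 = Φ z := by
    intro z
    rw [m.cosh_sq, m.f_point, m.f_point]
  have hpos : ∀ z : Metric.ball (0 : E) 1, 0 < 1 - ‖(z : E)‖ ^ 2 := by
    intro z
    have := m.one_sub_pos (m.point z)
    rwa [m.f_point] at this
  have hΦ0 : Φ z₀ = 1 := by rw [← hΦ]; simp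
  have hcont : Continuous Φ := by
    refine Continuous.div ?_ ?_ fun z => (mul_pos (hpos z) (hpos z₀)).ne'
    · have h1 : Continuous fun z : Metric.ball (0 : E) 1 => q z z₀ :=
        hq.continuous.comp (continuous_subtype_val.prodMk continuous_const)
      refine Continuous.add ?_ h1
      fun_prop
    · fun_prop
  have h1 : Filter.Tendsto (fun z => m.c * Real.sqrt (Φ z - 1)) (𝓝 z₀) (𝓝 0) := by
    have : Continuous fun z => m.c * Real.sqrt (Φ z - 1) := by fun_prop
    have h := this.tendsto z₀
    simpa [hΦ0] using h
  refine squeeze_zero (fun _ => dist_nonneg) (fun z => ?_) h1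
  have hd : 0 ≤ dist (m.point z) (m.point z₀) / m.c := div_nonneg dist_nonneg m.c_pos.le
  have h2 : dist (m.point z) (m.point z₀) / m.c ≤ Real.sqrt (Φ z - 1) := by
    rw [← hΦ z, Real.cosh_sq]
    refine Real.le_sqrt_of_sq_le ?_
    have := Real.self_le_sinh_iff.2 hd
    nlinarith
  rwa [div_le_iff₀' m.c_pos] at h2

theorem preconnectedSpace (m : BallModel q S) (hq : IsBallForm q) : PreconnectedSpace S := by
  have : PreconnectedSpace (Metric.ball (0 : E) 1) :=
    isPreconnected_iff_preconnectedSpace.1 (convex_ball (0 : E) 1).isPreconnected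
  exact m.point_surjective.denseRange.preconnectedSpace (m.continuous_point hq)

/-- Moving from a point in a given direction realizes all small distances. -/
theorem exists_dist_eq (m : BallModel q S) (hq : IsBallForm q) (s : S) (v : E) (hv : ‖v‖ = 1) :
    ∃ ε₀ > 0, ∀ ε, 0 < ε → ε < ε₀ → ∃ t, ∃ τ > (0 : ℝ), m.f t = m.f s + τ • v ∧ dist s t = ε := by
  -- Half the gap to the unit sphere keeps the whole segment inside the ball; the intermediate value
  -- theorem along it gives the distances.
  set δ := (1 - ‖m.f s‖) / 2 with hδ
  have hδpos : 0 < δ := by have := m.norm_lt s; rw [hδ]; linarith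
  have hmem : ∀ τ ∈ Set.Icc 0 δ, m.f s + τ • v ∈ Metric.ball (0 : E) 1 := by
    intro τ hτ
    rw [mem_ball_zero_iff]
    calc ‖m.f s + τ • v‖ ≤ ‖m.f s‖ + ‖τ • v‖ := norm_add_le _ _
      _ = ‖m.f s‖ + τ := by rw [norm_smul, hv, mul_one, Real.norm_of_nonneg hτ.1]
      _ < 1 := by have := hτ.2; linarith
  let path : Set.Icc 0 δ → S := fun τ => m.point ⟨m.f s + (τ : ℝ) • v, hmem τ τ.2⟩
  have hpath : Continuous path := (m.continuous_point hq).comp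
    (Continuous.subtype_mk (by fun_prop) _)
  have hf : ∀ τ, m.f (path τ) = m.f s + (τ : ℝ) • v := fun τ => m.f_point _
  have h0 : path ⟨0, le_rfl, hδpos.le⟩ = s := m.injective (by rw [hf]; simp)
  let g : ℝ → ℝ := fun τ => dist s (path (Set.projIcc 0 δ hδpos.le τ))
  have hg : Continuous g := continuous_const.dist (hpath.comp continuous_projIcc)
  have hg0 : g 0 = 0 := by
    simp only [g]
    rw [Set.projIcc_left, h0, dist_self]
  have hgδ : 0 < g δ := by
    simp only [g]
    rw [Set.projIcc_right, dist_pos]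
    intro h
    have := congrArg m.f h
    rw [hf] at this
    have hv0 : δ • v = 0 := by simpa using this
    rcases smul_eq_zero.1 hv0 with h | h
    · exact hδpos.ne' h
    · rw [h, norm_zero] at hv
      exact zero_ne_one hv
  refine ⟨g δ, hgδ, fun ε hε hεg => ?_⟩
  obtain ⟨τ, hτ, hτε⟩ := intermediate_value_Icc hδpos.le hg.continuousOn
    (show ε ∈ Set.Icc (g 0) (g δ) by rw [hg0]; exact ⟨hε.le, hεg.le⟩)
  refine ⟨path ⟨τ, hτ⟩, τ, ?_, hf _, ?_⟩
  · refine lt_of_le_of_ne hτ.1 fun h => ?_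
    rw [← h, hg0] at hτε
    exact hε.ne hτε
  · simp only [g] at hτε
    rwa [Set.projIcc_of_mem hδpos.le hτ] at hτε

/-- Moving along u, an orthogonal v, and -u gives points whose u-coordinates are respectively larger
than, equal to and smaller than that of s. This separates symmetric spaces from intervals, whose
small spheres have two points. -/
theorem exists_three_dist_eq (m : BallModel q S) (hq : IsBallForm q) (s : S) : ∃ ε₀ > 0, ∀ ε, 0 < ε → ε < ε₀ →
    ∃ t₁ t₂ t₃ : S, t₁ ≠ t₂ ∧ t₁ ≠ t₃ ∧ t₂ ≠ t₃ ∧ dist s t₁ = ε ∧ dist s t₂ = ε ∧ dist s t₃ = ε := by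
  obtain ⟨u, v, hu, hv, huv⟩ := hq.orthonormal
  obtain ⟨ε₁, hε₁, H₁⟩ := m.exists_dist_eq hq s u hu
  obtain ⟨ε₂, hε₂, H₂⟩ := m.exists_dist_eq hq s v hv
  obtain ⟨ε₃, hε₃, H₃⟩ := m.exists_dist_eq hq s (-u) (by rwa [norm_neg])
  refine ⟨min ε₁ (min ε₂ ε₃), by positivity, fun ε hε hlt => ?_⟩
  obtain ⟨h1, h23⟩ := lt_min_iff.1 hlt
  obtain ⟨h2, h3⟩ := lt_min_iff.1 h23
  obtain ⟨t₁, τ₁, hτ₁, hf₁, hd₁⟩ := H₁ ε hε h1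
  obtain ⟨t₂, τ₂, hτ₂, hf₂, hd₂⟩ := H₂ ε hε h2
  obtain ⟨t₃, τ₃, hτ₃, hf₃, hd₃⟩ := H₃ ε hε h3
  have huu : ⟪u, u⟫ = 1 := by rw [real_inner_self_eq_norm_sq, hu]; norm_num
  have hi₁ : ⟪u, m.f t₁⟫ = ⟪u, m.f s⟫ + τ₁ := by
    rw [hf₁, inner_add_right, inner_smul_right, huu, mul_one]
  have hi₂ : ⟪u, m.f t₂⟫ = ⟪u, m.f s⟫ := by
    rw [hf₂, inner_add_right, inner_smul_right, huv, mul_zero, add_zero]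
  have hi₃ : ⟪u, m.f t₃⟫ = ⟪u, m.f s⟫ - τ₃ := by
    rw [hf₃, inner_add_right, inner_smul_right, inner_neg_right, huu]
    ring
  refine ⟨t₁, t₂, t₃, ?_, ?_, ?_, hd₁, hd₂, hd₃⟩
  · rintro rfl
    linarith
  · rintro rfl
    linarith
  · rintro rfl
    linarith

/-- Coarsely dense subsets accumulate at ideal points. -/
theorem mem_closure_of_coarselyDense (m : BallModel q S) {A : Set S} {D : ℝ} (hA : ∀ s, ∃ a ∈ A, dist s a ≤ D) {ξ : E}
    (hξ : ‖ξ‖ = 1) (hqξ : ∀ (t : ℝ) a, (t * ⟪a, ξ⟫) ^ 2 ≤ q (t • ξ) a) :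
    ξ ∈ closure (m.f '' A) := by
  rw [Metric.mem_closure_iff]
  intro ε hε
  set C := Real.cosh (D / m.c) ^ 2 with hC
  have hC1 : 1 ≤ C := by
    have := Real.one_le_cosh (D / m.c)
    rw [hC]
    nlinarith
  set δ := min (1 / 2) (ε ^ 2 / 4) with hδ
  have hδ0 : 0 < δ := by positivity
  have hδ1 : δ ≤ 1 / 2 := min_le_left _ _
  have hδ2 : δ ≤ ε ^ 2 / 4 := min_le_right _ _
  -- The point s = tξ with 1 - t² = η is so close to ξ that a point a within D of it satisfies (1 -
  -- t⟪a, ξ⟫)² ≤ Cη = δ². Then ⟪a, ξ⟫ ≥ 1 - δ, hence ‖ξ - a‖² < 2δ ≤ ε²/2.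
  set η := δ ^ 2 / C with hη
  have hη0 : 0 < η := by positivity
  have hη1 : η < 1 := by
    rw [hη, div_lt_one (by positivity)]
    nlinarith
  set t := Real.sqrt (1 - η) with ht
  have ht2 : t ^ 2 = 1 - η := Real.sq_sqrt (by linarith)
  have ht0 : 0 < t := Real.sqrt_pos.2 (by linarith)
  have ht1 : t < 1 := by nlinarith
  obtain ⟨s, hs⟩ := m.exists_eq (x := t • ξ)
    (by rw [norm_smul, hξ, mul_one, Real.norm_of_nonneg ht0.le]; exact ht1)
  obtain ⟨a, ha, hsa⟩ := hA s
  refine ⟨m.f a, Set.mem_image_of_mem _ ha, ?_⟩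
  set r := ⟪m.f a, ξ⟫ with hr
  have ha1 := m.norm_lt a
  have ha0 := norm_nonneg (m.f a)
  have hcosh : Real.cosh (dist s a / m.c) ^ 2 ≤ C := by
    have : Real.cosh (dist s a / m.c) ≤ Real.cosh (D / m.c) := by
      rw [Real.cosh_le_cosh, abs_of_nonneg (div_nonneg dist_nonneg m.c_pos.le),
        abs_of_nonneg (div_nonneg (dist_nonneg.trans hsa) m.c_pos.le)]
      exact div_le_div_of_nonneg_right hsa m.c_pos.le
    exact pow_le_pow_left₀ (Real.cosh_pos _).le this 2
  have hpair := m.pairing_eq s a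
  have hnormt : ‖m.f s‖ ^ 2 = 1 - η := by
    rw [hs, norm_smul, hξ, mul_one, Real.norm_of_nonneg ht0.le, ht2]
  rw [hnormt] at hpair
  have hin : ⟪m.f s, m.f a⟫ = t * r := by
    rw [hs, real_inner_smul_left, real_inner_comm]
  rw [hin] at hpair
  have hqs : (t * r) ^ 2 ≤ q (m.f s) (m.f a) := by rw [hs]; exact hqξ t (m.f a)
  have hbound : (1 - t * r) ^ 2 ≤ δ ^ 2 := by
    have h1 : Real.cosh (dist s a / m.c) ^ 2 * ((1 - (1 - η)) * (1 - ‖m.f a‖ ^ 2)) ≤ C * η := by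
      refine mul_le_mul hcosh ?_ ?_ (by positivity)
      · nlinarith
      · have := m.one_sub_pos a
        nlinarith
    have h2 : C * η = δ ^ 2 := by rw [hη]; field_simp
    nlinarith
  have h3 : 1 - t * r ≤ δ := (abs_le.1 (abs_le_of_sq_le_sq hbound hδ0.le)).2
  have hr0 : 0 < r := by
    by_contra h
    push Not at h
    have := mul_nonpos_of_nonneg_of_nonpos ht0.le h
    linarith
  have hr1 : 1 - δ ≤ r := by
    have := mul_le_mul_of_nonneg_right ht1.le hr0.le
    linarith
  have hnorm : ‖ξ - m.f a‖ ^ 2 < ε ^ 2 := by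
    rw [norm_sub_sq_real, hξ, real_inner_comm, ← hr]
    have h4 : ‖m.f a‖ ^ 2 < 1 := by nlinarith
    have h5 : 0 < ε ^ 2 := by positivity
    linarith
  rw [dist_eq_norm]
  exact lt_of_pow_lt_pow_left₀ 2 hε.le hnorm

/-- Finitely many points of a coarsely dense set have the property that the distances to them
determine a point. -/
theorem exists_finite_resolving (m : BallModel q S) [FiniteDimensional ℝ E] (hq : IsBallForm q) {A : Set S} {D : ℝ}
    (hA : ∀ s, ∃ a ∈ A, dist s a ≤ D) :
    ∃ F : Set S, F.Finite ∧ F ⊆ A ∧ ∀ s t, (∀ a ∈ F, dist s a = dist t a) → s = t := by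
  obtain ⟨W, hW, hqW⟩ := hq.finiteDimensional
  obtain ⟨Ξ, hΞspan, hΞ⟩ := hq.span
  let one : E → ℝ := fun _ => 1
  let L : E →ₗ[ℝ] (E → ℝ) :=
    { toFun := fun x y => ⟪x, y⟫
      map_add' := fun x y => by ext z; exact inner_add_left _ _ _
      map_smul' := fun r x => by ext z; exact real_inner_smul_left _ _ _ }
  let W' : Submodule ℝ (E → ℝ) := W ⊔ LinearMap.range L ⊔ Submodule.span ℝ {one}
  have hone : one ∈ W' := Submodule.mem_sup_right (Submodule.mem_span_singleton_self _)
  have hL : ∀ x, L x ∈ W' := fun x =>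
    Submodule.mem_sup_left (Submodule.mem_sup_right (LinearMap.mem_range_self _ _))
  have hqW' : ∀ x, q x ∈ W' := fun x => Submodule.mem_sup_left (Submodule.mem_sup_left (hqW x))
  obtain ⟨F', hF', hF'A, HF⟩ := exists_finite_evaluations W' (m.f '' A)
  refine ⟨m.f ⁻¹' F', hF'.preimage m.injective.injOn, ?_, ?_⟩
  · intro s hs
    obtain ⟨a, ha, hsa⟩ := hF'A hs
    exact m.injective hsa ▸ ha
  intro s t hst
  -- Normalized so that its value at the coordinates of a is cosh² of the rescaled distance times a
  -- factor depending on a alone. Equal distances to `F` thus make U s - U t vanish on the finite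
  -- test set, hence on all of A and on its closure.
  let U : S → E → ℝ := fun s => (1 - ‖m.f s‖ ^ 2)⁻¹ • (one - (2 : ℝ) • L (m.f s) + q (m.f s))
  have hU : ∀ s y, U s y = (1 - ‖m.f s‖ ^ 2)⁻¹ * (1 - 2 * ⟪m.f s, y⟫ + q (m.f s) y) :=
    fun _ _ => rfl
  have hUW : U s - U t ∈ W' := by
    refine Submodule.sub_mem _ ?_ ?_ <;>
    exact Submodule.smul_mem _ _ (Submodule.add_mem _ (Submodule.sub_mem _ hone
      (Submodule.smul_mem _ _ (hL _))) (hqW' _))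
  have hUf : ∀ s a, U s (m.f a) = Real.cosh (dist s a / m.c) ^ 2 * (1 - ‖m.f a‖ ^ 2) := by
    intro s a
    rw [hU, m.pairing_eq]
    have := (m.one_sub_pos s).ne'
    field_simp
  have hvan := HF _ hUW (by
    intro y hy
    obtain ⟨a, ha, rfl⟩ := hF'A hy
    rw [Pi.sub_apply, hUf, hUf, hst a hy, sub_self])
  have hcont : Continuous (U s - U t) := by
    have hUc : ∀ s, Continuous (U s) := by
      intro s
      have h1 : Continuous (q (m.f s)) := hq.continuous.comp (continuous_const.prodMk continuous_id)
      have : U s = fun y => (1 - ‖m.f s‖ ^ 2)⁻¹ * (1 - 2 * ⟪m.f s, y⟫ + q (m.f s) y) :=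
        funext (hU s)
      rw [this]
      fun_prop
    exact (hUc s).sub (hUc t)
  have hclosed : closure (m.f '' A) ⊆ {y | (U s - U t) y = 0} :=
    closure_minimal hvan (isClosed_singleton.preimage hcont)
  let x' := (1 - ‖m.f s‖ ^ 2)⁻¹ • m.f s
  let y' := (1 - ‖m.f t‖ ^ 2)⁻¹ • m.f t
  -- Both ξ and -ξ are limits of A. Subtracting the two equations cancels the constant and the even
  -- term q, leaving the linear part.
  have hxi : ∀ ξ ∈ Ξ, ⟪x', ξ⟫ = ⟪y', ξ⟫ := by
    intro ξ hξ
    obtain ⟨hξ1, hξq⟩ := hΞ ξ hξ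
    have h1 := hclosed (m.mem_closure_of_coarselyDense hA hξ1 hξq)
    have h2 := hclosed (m.mem_closure_of_coarselyDense hA (ξ := -ξ) (by rwa [norm_neg])
      (fun t a => by
        have := hξq (-t) a
        rw [inner_neg_right, smul_neg, ← neg_smul]
        nlinarith))
    simp only [Set.mem_ofPred_eq, Pi.sub_apply, hU, hq.neg_right, inner_neg_right] at h1 h2
    simp only [x', y', real_inner_smul_left]
    linarith
  have hxy : x' = y' := by
    have h0 : ∀ z, ⟪x' - y', z⟫ = 0 := by
      intro z
      have hz : z ∈ Submodule.span ℝ Ξ := hΞspan ▸ Submodule.mem_top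
      induction hz using Submodule.span_induction with
      | mem z hz => rw [inner_sub_left, hxi z hz, sub_self]
      | zero => rw [inner_zero_right]
      | add a b _ _ ha hb => rw [inner_add_right, ha, hb, add_zero]
      | smul r a _ ha => rw [inner_smul_right, ha, mul_zero]
    exact sub_eq_zero.1 (inner_self_eq_zero.1 (h0 (x' - y')))
  have hs0 := m.one_sub_pos s
  have ht0 := m.one_sub_pos t
  -- The map r ↦ r / (1 - r²) is injective on [0, 1).
  have hnorm : ‖m.f s‖ = ‖m.f t‖ := by
    have h1 : (1 - ‖m.f s‖ ^ 2)⁻¹ * ‖m.f s‖ = (1 - ‖m.f t‖ ^ 2)⁻¹ * ‖m.f t‖ := by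
      have := congrArg norm hxy
      simp only [x', y', norm_smul] at this
      rwa [Real.norm_of_nonneg (inv_pos.2 hs0).le, Real.norm_of_nonneg (inv_pos.2 ht0).le] at this
    have h2 : ‖m.f s‖ * (1 - ‖m.f t‖ ^ 2) = ‖m.f t‖ * (1 - ‖m.f s‖ ^ 2) := by
      field_simp at h1
      linarith
    have h3 : (‖m.f s‖ - ‖m.f t‖) * (1 + ‖m.f s‖ * ‖m.f t‖) = 0 := by ring_nf at h2 ⊢; linarith
    rcases mul_eq_zero.1 h3 with h | h
    · linarith
    · have := mul_nonneg (norm_nonneg (m.f s)) (norm_nonneg (m.f t))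
      linarith
  apply m.injective
  have h4 := hxy
  simp only [x', y', hnorm] at h4
  exact smul_right_injective E (inv_pos.2 ht0).ne' h4

end BallModel

/-! ### Ball models over the reals, complexes, quaternions and octonions -/

section Models

variable {F' : Type} [NormedAddCommGroup F'] [InnerProductSpace ℝ F']

/-- The quartic part of the pairing of two vectors over a real algebra. -/
def quarticForm (mul : F' →ₗ[ℝ] F' →ₗ[ℝ] F') (st : F' →ₗ[ℝ] F') (ρ : F' →ₗ[ℝ] ℝ) {n : ℕ}
    (x y : PiLp 2 fun _ : Fin n => F') : ℝ :=
  ∑ i, ∑ j, ρ (mul (mul (x i) (st (x j))) (mul (y j) (st (y i))))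

/-- The only identity needed from the algebra is `hcomp`, so associativity plays no role. The test
directions are unit vectors in a single coordinate: there the form is t²‖aᵢ‖², and Cauchy–Schwarz
gives the lower bound. -/
theorem isBallForm_quarticForm [FiniteDimensional ℝ F'] [Nontrivial F']
    (mul : F' →ₗ[ℝ] F' →ₗ[ℝ] F') (st : F' →ₗ[ℝ] F') (ρ : F' →ₗ[ℝ] ℝ)
    (hcomp : ∀ x y, ρ (mul (mul x (st x)) (mul y (st y))) = ‖x‖ ^ 2 * ‖y‖ ^ 2)
    {n : ℕ} (hn : 2 ≤ n) : IsBallForm (quarticForm mul st ρ (n := n)) where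
  continuous := by
    let mulC : F' →L[ℝ] F' →L[ℝ] F' :=
      LinearMap.toContinuousLinearMap (LinearMap.toContinuousLinearMap.toLinearMap ∘ₗ mul)
    let stC : F' →L[ℝ] F' := LinearMap.toContinuousLinearMap st
    let ρC : F' →L[ℝ] ℝ := LinearMap.toContinuousLinearMap ρ
    change Continuous fun p : (PiLp 2 fun _ : Fin n => F') × (PiLp 2 fun _ : Fin n => F') =>
      ∑ i, ∑ j, ρC (mulC (mulC (p.1 i) (stC (p.1 j))) (mulC (p.2 j) (stC (p.2 i))))
    fun_prop
  neg_right x y := by simp [quarticForm]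
  finiteDimensional := by
    let Λ : (Fin n → Fin n → F') →ₗ[ℝ] ((PiLp 2 fun _ : Fin n => F') → ℝ) :=
      { toFun := fun M y => ∑ i, ∑ j, ρ (mul (M i j) (mul (y j) (st (y i))))
        map_add' := fun M N => by ext y; simp [Finset.sum_add_distrib]
        map_smul' := fun r M => by ext y; simp [Finset.mul_sum] }
    exact ⟨LinearMap.range Λ, inferInstance, fun x => ⟨fun i j => mul (x i) (st (x j)), rfl⟩⟩
  span := by
    classical
    refine ⟨{ξ | ∃ i : Fin n, ∃ e : F', ‖e‖ = 1 ∧ ξ = PiLp.single 2 i e}, ?_, ?_⟩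
    · rw [eq_top_iff]
      rintro x -
      have hx : x = ∑ i, PiLp.single 2 i (x i) := by
        ext j
        simp [Finset.sum_apply]
      rw [hx]
      refine Submodule.sum_mem _ fun i _ => ?_
      generalize x i = y
      by_cases h0 : y = 0
      · have : (PiLp.single 2 i y : PiLp 2 fun _ : Fin n => F') = 0 := by
          ext j
          simp [h0]
        rw [this]
        exact Submodule.zero_mem _
      · have : (PiLp.single 2 i y : PiLp 2 fun _ : Fin n => F') =
            ‖y‖ • PiLp.single 2 i (‖y‖⁻¹ • y) := by
          ext j
          by_cases hj : j = i
          · subst hj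
            simp [smul_smul, h0]
          · simp [hj]
        rw [this]
        refine Submodule.smul_mem _ _ (Submodule.subset_span ⟨i, _, ?_, rfl⟩)
        rw [norm_smul, norm_inv, norm_norm, inv_mul_cancel₀ (norm_ne_zero_iff.2 h0)]
    · rintro _ ⟨i, e, he, rfl⟩
      refine ⟨by simp [he], fun t a => ?_⟩
      have h1 : quarticForm mul st ρ (t • PiLp.single 2 i e) a = t ^ 2 * ‖a i‖ ^ 2 := by
        unfold quarticForm
        rw [Finset.sum_eq_single i, Finset.sum_eq_single i]
        · simp only [PiLp.smul_apply, PiLp.single_apply, if_true]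
          rw [hcomp, norm_smul, he, mul_one, Real.norm_eq_abs, sq_abs]
        · intro j _ hj
          simp [hj]
        · simp
        · intro j _ hj
          refine Finset.sum_eq_zero fun k _ => ?_
          simp [PiLp.single_apply, hj]
        · simp
      rw [h1, mul_pow]
      refine mul_le_mul_of_nonneg_left ?_ (sq_nonneg t)
      have h2 : ⟪a, PiLp.single 2 i e⟫ = ⟪a i, e⟫ := by
        rw [PiLp.inner_apply, Finset.sum_eq_single i]
        · simp
        · intro j _ hj
          simp [hj]
        · simp
      rw [h2, ← sq_abs]
      refine pow_le_pow_left₀ (abs_nonneg _) ?_ 2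
      simpa [he] using abs_real_inner_le_norm (a i) e
  orthonormal := by
    classical
    obtain ⟨e₀, he₀⟩ := exists_ne (0 : F')
    let e := ‖e₀‖⁻¹ • e₀
    have he : ‖e‖ = 1 := by
      rw [norm_smul, norm_inv, norm_norm, inv_mul_cancel₀ (norm_ne_zero_iff.2 he₀)]
    refine ⟨PiLp.single 2 ⟨0, by omega⟩ e, PiLp.single 2 ⟨1, by omega⟩ e, by simp [he], by simp [he],
      ?_⟩
    rw [PiLp.inner_apply]
    refine Finset.sum_eq_zero fun i _ => ?_
    by_cases hi : i = ⟨0, by omega⟩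
    · subst hi
      simp
    · simp [hi]

theorem IsHyperbolicSpaceOver.nonempty_ballModel {F : Type*} [Mul F] [Star F] {re : F → ℝ}
    (φ : F ≃ F')
    (mul : F' →ₗ[ℝ] F' →ₗ[ℝ] F') (st : F' →ₗ[ℝ] F') (ρ : F' →ₗ[ℝ] ℝ)
    (hmul : ∀ a b, φ (a * b) = mul (φ a) (φ b)) (hst : ∀ a, φ (star a) = st (φ a))
    (hre : ∀ a, re a = ρ (φ a))
    (hnorm : ∀ x, ρ (mul x (st x)) = ‖x‖ ^ 2) (hin : ∀ x y, ρ (mul (st y) x) = ⟪x, y⟫)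
    {n : ℕ} {S : Type*} [MetricSpace S] (h : IsHyperbolicSpaceOver re n S) :
    Nonempty (BallModel (quarticForm mul st ρ (n := n)) S) := by
  obtain ⟨c, f, hc, hf, hrange, hcosh⟩ := h
  let Φ : (Fin n → F) ≃ PiLp 2 fun _ : Fin n => F' :=
    (Equiv.piCongrRight fun _ => φ).trans (WithLp.equiv 2 _).symm
  have hΦ : ∀ x i, Φ x i = φ (x i) := fun _ _ => rfl
  have hN : ∀ x, normSqOver re x = ‖Φ x‖ ^ 2 := by
    intro x
    rw [PiLp.norm_sq_eq_of_L2]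
    simp [normSqOver, hre, hmul, hst, hnorm, hΦ]
  have hP : ∀ x y, pairingSqOver re x y =
      1 - 2 * ⟪Φ x, Φ y⟫ + quarticForm mul st ρ (Φ x) (Φ y) := by
    intro x y
    rw [PiLp.inner_apply]
    simp [pairingSqOver, quarticForm, hre, hmul, hst, hin, hΦ]
  refine ⟨⟨c, fun s => Φ (f s), hc, Φ.injective.comp hf, ?_, fun s t => ?_⟩⟩
  · ext z
    obtain ⟨x, rfl⟩ := Φ.surjective z
    have h1 : Φ x ∈ Set.range (fun s => Φ (f s)) ↔ x ∈ Set.range f := by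
      simp [Set.mem_range]
    rw [h1, hrange, mem_ball_zero_iff, Set.mem_ofPred_eq, hN]
    constructor
    · intro h
      nlinarith [norm_nonneg (Φ x)]
    · intro h
      nlinarith [norm_nonneg (Φ x)]
  · rw [hcosh, hP, hN, hN]

end Models

/-- Quaternionic conjugation as a real linear map. -/
noncomputable def Quaternion.conjLinear : Quaternion ℝ →ₗ[ℝ] Quaternion ℝ where
  toFun a := star a
  map_add' a b := star_add a b
  map_smul' r a := by simp

/-- The real part of a quaternion as a linear map. -/
noncomputable def Quaternion.reLinear : Quaternion ℝ →ₗ[ℝ] ℝ where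
  toFun a := a.re
  map_add' _ _ := rfl
  map_smul' _ _ := rfl

/-- The multiplication of the octonions as a bilinear map. -/
noncomputable def Octonion.mulLinear : WithLp 2 (Quaternion ℝ × Quaternion ℝ) →ₗ[ℝ]
    WithLp 2 (Quaternion ℝ × Quaternion ℝ) →ₗ[ℝ] WithLp 2 (Quaternion ℝ × Quaternion ℝ) :=
  LinearMap.mk₂ ℝ (fun p q => WithLp.toLp 2
      (p.fst * q.fst - star q.snd * p.snd, q.snd * p.fst + p.snd * star q.fst))
    (fun p p' q => by
      refine (WithLp.equiv 2 _).injective (Prod.ext ?_ ?_) <;>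
      simp [add_mul, mul_add] <;> abel)
    (fun r p q => by
      refine (WithLp.equiv 2 _).injective (Prod.ext ?_ ?_) <;>
      simp [smul_sub, smul_add])
    (fun p q q' => by
      refine (WithLp.equiv 2 _).injective (Prod.ext ?_ ?_) <;>
      simp [add_mul, mul_add] <;> abel)
    (fun r p q => by
      refine (WithLp.equiv 2 _).injective (Prod.ext ?_ ?_) <;>
      simp [smul_sub, smul_add])

/-- Octonionic conjugation as a linear map. -/
noncomputable def Octonion.conjLinear : WithLp 2 (Quaternion ℝ × Quaternion ℝ) →ₗ[ℝ]
    WithLp 2 (Quaternion ℝ × Quaternion ℝ) where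
  toFun p := WithLp.toLp 2 (star p.fst, -p.snd)
  map_add' p q := by
    refine (WithLp.equiv 2 _).injective (Prod.ext ?_ ?_)
    · simp
    · simp; abel
  map_smul' r p := by
    refine (WithLp.equiv 2 _).injective (Prod.ext ?_ ?_) <;> simp

/-- The real part of an octonion as a linear map. -/
noncomputable def Octonion.reLinear : WithLp 2 (Quaternion ℝ × Quaternion ℝ) →ₗ[ℝ] ℝ where
  toFun p := p.fst.re
  map_add' _ _ := rfl
  map_smul' _ _ := rfl

/-- Octonions as pairs of quaternions. -/
def Octonion.equivProd : Octonion ≃ WithLp 2 (Quaternion ℝ × Quaternion ℝ) where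
  toFun p := WithLp.toLp 2 (p.fst, p.snd)
  invFun p := ⟨p.fst, p.snd⟩
  left_inv _ := rfl
  right_inv _ := rfl

/-- Being real, p p̄ multiplies another such element as a scalar, which yields the norm identity for
octonions. -/
theorem Octonion.mulLinear_conjLinear (p : WithLp 2 (Quaternion ℝ × Quaternion ℝ)) :
    Octonion.mulLinear p (Octonion.conjLinear p) =
      WithLp.toLp 2 (((‖p‖ ^ 2 : ℝ) : Quaternion ℝ), 0) := by
  refine (WithLp.equiv 2 _).injective (Prod.ext ?_ ?_)
  · simp only [Octonion.mulLinear, Octonion.conjLinear, LinearMap.mk₂_apply, LinearMap.coe_mk,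
      AddHom.coe_mk, WithLp.prod_norm_sq_eq_of_L2]
    simp [Quaternion.self_mul_star, Quaternion.star_mul_self, Quaternion.normSq_eq_norm_mul_self,
      sq]
  · simp [Octonion.mulLinear, Octonion.conjLinear, LinearMap.mk₂_apply]

/-- Every rank-one symmetric space has a projective ball model. -/
theorem IsRankOneSymmetricSpace.exists_ballModel {S : Type*} [MetricSpace S]
    (h : IsRankOneSymmetricSpace S) :
    ∃ (E : Type) (_ : NormedAddCommGroup E) (_ : InnerProductSpace ℝ E) (q : E → E → ℝ),
      FiniteDimensional ℝ E ∧ IsBallForm q ∧ Nonempty (BallModel q S) := by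
  have hquat : ∀ x y : Quaternion ℝ, (star y * x).re = ⟪x, y⟫ := by
    intro x y
    rw [Quaternion.inner_def]
    simp
    ring
  have hquatn : ∀ x : Quaternion ℝ, (x * star x).re = ‖x‖ ^ 2 := by
    intro x
    rw [Quaternion.self_mul_star, Quaternion.normSq_eq_norm_mul_self, sq]
    simp
  obtain ⟨n, hn, h⟩ | ⟨n, hn, h⟩ | ⟨n, hn, h⟩ | h := h
  · refine ⟨_, _, _, _, inferInstance, ?_, h.nonempty_ballModel (Equiv.refl ℝ) (LinearMap.mul ℝ ℝ)
      LinearMap.id LinearMap.id (fun _ _ => rfl) (fun _ => rfl) (fun _ => rfl) (fun x => ?_)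
      (fun x y => ?_)⟩
    · exact isBallForm_quarticForm _ _ _ (fun x y => by simp [sq]) hn
    · simp [sq]
    · simp [mul_comm]
  · refine ⟨_, _, _, _, inferInstance, ?_, h.nonempty_ballModel (Equiv.refl ℂ) (LinearMap.mul ℝ ℂ)
      Complex.conjAe.toLinearMap Complex.reLm (fun _ _ => rfl) (fun _ => rfl) (fun _ => rfl)
      (fun x => ?_) (fun x y => ?_)⟩
    · refine isBallForm_quarticForm _ _ _ (fun x y => ?_) hn
      simp [Complex.mul_conj, ← Complex.normSq_eq_norm_sq, -Complex.mul_re]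
      rw [← Complex.ofReal_mul, Complex.ofReal_re]
    · simp [Complex.mul_conj, ← Complex.normSq_eq_norm_sq, -Complex.mul_re]
    · simp [Complex.inner]
  · refine ⟨_, _, _, _, inferInstance, ?_, h.nonempty_ballModel (Equiv.refl (Quaternion ℝ))
      (LinearMap.mul ℝ (Quaternion ℝ)) Quaternion.conjLinear Quaternion.reLinear
      (fun _ _ => rfl) (fun _ => rfl) (fun _ => rfl) hquatn hquat⟩
    refine isBallForm_quarticForm _ _ _ (fun x y => ?_) hn
    change ((x * star x) * (y * star y)).re = _
    rw [Quaternion.self_mul_star, Quaternion.self_mul_star, ← Quaternion.coe_mul,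
      Quaternion.re_coe, Quaternion.normSq_eq_norm_mul_self, Quaternion.normSq_eq_norm_mul_self,
      sq, sq]
  · refine ⟨_, _, _, _, inferInstance, ?_, h.nonempty_ballModel Octonion.equivProd
      Octonion.mulLinear Octonion.conjLinear Octonion.reLinear
      (fun _ _ => rfl) (fun _ => rfl) (fun _ => rfl) (fun x => ?_) (fun x y => ?_)⟩
    · refine isBallForm_quarticForm _ _ _ (fun x y => ?_) le_rfl
      rw [Octonion.mulLinear_conjLinear, Octonion.mulLinear_conjLinear]
      change (((‖x‖ ^ 2 : ℝ) : Quaternion ℝ) * ((‖y‖ ^ 2 : ℝ) : Quaternion ℝ) -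
        star (0 : Quaternion ℝ) * 0).re = _
      rw [mul_zero, sub_zero, ← Quaternion.coe_mul, Quaternion.re_coe]
    · rw [Octonion.mulLinear_conjLinear]
      rfl
    · rw [WithLp.prod_inner_apply]
      change (star y.fst * x.fst - star x.snd * (-y.snd)).re = _
      rw [← hquat, ← hquat]
      simp
      ring

theorem IsRankOneSymmetricSpace.nonempty {S : Type*} [MetricSpace S]
    (h : IsRankOneSymmetricSpace S) : Nonempty S := by
  obtain ⟨E, _, _, q, _, _, ⟨m⟩⟩ := h.exists_ballModel
  exact ⟨(m.exists_eq (x := 0) (by simp)).choose⟩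

theorem IsRankOneSymmetricSpace.preconnectedSpace {S : Type*} [MetricSpace S]
    (h : IsRankOneSymmetricSpace S) : PreconnectedSpace S := by
  obtain ⟨E, _, _, q, _, hq, ⟨m⟩⟩ := h.exists_ballModel
  exact m.preconnectedSpace hq

theorem IsRankOneSymmetricSpace.exists_three_dist_eq {S : Type*} [MetricSpace S]
    (h : IsRankOneSymmetricSpace S) (s : S) : ∃ ε₀ > 0, ∀ ε, 0 < ε → ε < ε₀ →
    ∃ t₁ t₂ t₃ : S, t₁ ≠ t₂ ∧ t₁ ≠ t₃ ∧ t₂ ≠ t₃ ∧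
      dist s t₁ = ε ∧ dist s t₂ = ε ∧ dist s t₃ = ε := by
  obtain ⟨E, _, _, q, _, hq, ⟨m⟩⟩ := h.exists_ballModel
  exact m.exists_three_dist_eq hq s

theorem IsRankOneSymmetricSpace.exists_finite_resolving {S : Type*} [MetricSpace S]
    (h : IsRankOneSymmetricSpace S) {A : Set S} {D : ℝ} (hA : ∀ s, ∃ a ∈ A, dist s a ≤ D) :
    ∃ F : Set S, F.Finite ∧ F ⊆ A ∧ ∀ s t, (∀ a ∈ F, dist s a = dist t a) → s = t := by
  obtain ⟨E, _, _, q, _, hq, ⟨m⟩⟩ := h.exists_ballModel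
  exact m.exists_finite_resolving hq hA

/-! ### Metric geometry of a tree of spaces -/

namespace IdealTreeOfSpaces

variable {X : Type u} [MetricSpace X] (D : IdealTreeOfSpaces.{u, u} X)

theorem edge_one_eq (d : D.tree.Dart) : D.edge d 1 = D.edge d.symm 0 := by
  rw [D.edge_symm, unitInterval.symm_zero]

theorem edge_one_mem (d : D.tree.Dart) : D.edge d 1 ∈ D.space d.snd := by
  rw [D.edge_one_eq]
  exact D.edge_zero_mem d.symm

theorem eq_of_mem_space {v w : D.V} {x : X} (hv : x ∈ D.space v) (hw : x ∈ D.space w) : v = w := by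
  by_contra h
  exact Set.disjoint_left.1 (D.space_disjoint v w h) hv hw

theorem space_nonempty (v : D.V) : (D.space v).Nonempty := by
  obtain ⟨x, hx⟩ | h := D.space_spec v
  · exact ⟨x, by rw [hx]; rfl⟩
  · obtain ⟨x⟩ := h.nonempty
    exact ⟨x.1, x.2⟩

theorem space_injective : Function.Injective D.space := by
  intro v w h
  obtain ⟨x, hx⟩ := D.space_nonempty v
  exact D.eq_of_mem_space hx (h ▸ hx)

theorem edge_mem_space {d : D.tree.Dart} {t : unitInterval} {v : D.V} (h : D.edge d t ∈ D.space v) :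
    (t = 0 ∧ v = d.fst) ∨ (t = 1 ∧ v = d.snd) := by
  rcases eq_or_ne t 0 with rfl | h0
  · exact Or.inl ⟨rfl, D.eq_of_mem_space h (D.edge_zero_mem d)⟩
  rcases eq_or_ne t 1 with rfl | h1
  · exact Or.inr ⟨rfl, D.eq_of_mem_space h (D.edge_one_mem d)⟩
  · exact (D.edge_notMem d t (unitInterval.pos_iff_ne_zero.2 h0)
      (unitInterval.lt_one_iff_ne_one.2 h1) v h).elim

theorem edge_eq_edge {d d' : D.tree.Dart} {t t' : unitInterval} (h0 : 0 < t) (h1 : t < 1)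
    (h : D.edge d t = D.edge d' t') : (d' = d ∧ t' = t) ∨ (d' = d.symm ∧ t' = unitInterval.symm t) := by
  have := D.edge_disjoint d t d' t' h0 h1 h
  rcases (SimpleGraph.dart_edge_eq_iff d d').1 this with rfl | rfl
  · exact Or.inl ⟨rfl, ((D.edge_isometry d).injective h).symm⟩
  · right
    rw [D.edge_symm] at h
    refine ⟨(SimpleGraph.Dart.symm_symm _).symm, ?_⟩
    exact (D.edge_isometry d').injective h.symm

/-- Functions on the vertex spaces and the edges that agree at the ends of the edges glue. -/
theorem exists_glue {Y : Type*} (fv : D.V → X → Y) (fd : D.tree.Dart → unitInterval → Y)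
    (h0 : ∀ d, fd d 0 = fv d.fst (D.edge d 0))
    (hs : ∀ d t, fd d.symm t = fd d (unitInterval.symm t)) :
    ∃ f : X → Y, (∀ v, ∀ x ∈ D.space v, f x = fv v x) ∧ ∀ d t, f (D.edge d t) = fd d t := by
  have key : ∀ x, ∃ y, (∀ v, x ∈ D.space v → y = fv v x) ∧ ∀ d t, D.edge d t = x → y = fd d t := by
    intro x
    by_cases hx : ∃ v, x ∈ D.space v
    · obtain ⟨v, hv⟩ := hx
      refine ⟨fv v x, fun w hw => by rw [D.eq_of_mem_space hv hw], ?_⟩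
      rintro d t rfl
      rcases D.edge_mem_space hv with ⟨rfl, rfl⟩ | ⟨rfl, rfl⟩
      · exact (h0 d).symm
      · have := h0 d.symm
        rw [hs, unitInterval.symm_zero, ← D.edge_one_eq] at this
        exact this.symm
    · obtain ⟨d, t, rfl⟩ := (D.cover x).resolve_left hx
      have ht0 : 0 < t := unitInterval.pos_iff_ne_zero.2 (by
        rintro rfl
        exact hx ⟨_, D.edge_zero_mem d⟩)
      have ht1 : t < 1 := unitInterval.lt_one_iff_ne_one.2 (by
        rintro rfl
        exact hx ⟨_, D.edge_one_mem d⟩)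
      refine ⟨fd d t, fun v hv => (hx ⟨v, hv⟩).elim, fun d' t' h => ?_⟩
      rcases D.edge_eq_edge ht0 ht1 h.symm with ⟨rfl, rfl⟩ | ⟨rfl, rfl⟩
      · rfl
      · rw [hs, unitInterval.symm_symm]
  choose f hf1 hf2 using key
  exact ⟨f, fun v x hx => hf1 x v hx, fun d t => hf2 _ d t rfl⟩

/-- A map that does not increase distances on the vertex spaces and on the edges does not increase
distances. -/
theorem dist_le_of_pieces {Y : Type*} [PseudoMetricSpace Y] (f : X → Y)
    (hv : ∀ v, ∀ x ∈ D.space v, ∀ y ∈ D.space v, dist (f x) (f y) ≤ dist x y)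
    (hd : ∀ d s t, dist (f (D.edge d s)) (f (D.edge d t)) ≤ dist s t) (x y : X) :
    dist (f x) (f y) ≤ dist x y := by
  obtain ⟨n, z, rfl, rfl, hz, hsum⟩ := D.exists_chain x y
  rw [← hsum]
  refine (dist_le_range_sum_dist (fun i => f (z i)) n).trans (Finset.sum_le_sum fun i hi => ?_)
  rcases hz i (Finset.mem_range.1 hi) with ⟨v, h1, h2⟩ | ⟨d, ⟨s, h1⟩, ⟨t, h2⟩⟩
  · exact hv v _ h1 _ h2
  · rw [← h1, ← h2, (D.edge_isometry d).dist_eq]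
    exact hd d s t

/-- Extension to `X` of a function on the vertices. -/
theorem exists_extension (Φ : D.V → ℝ) (fd : D.tree.Dart → unitInterval → ℝ)
    (h0 : ∀ d, fd d 0 = Φ d.fst) (hs : ∀ d t, fd d.symm t = fd d (unitInterval.symm t))
    (hlip : ∀ d s t, |fd d s - fd d t| ≤ |(s : ℝ) - t|) :
    ∃ f : X → ℝ, (∀ v, ∀ x ∈ D.space v, f x = Φ v) ∧ (∀ d t, f (D.edge d t) = fd d t) ∧
      ∀ x y, |f x - f y| ≤ dist x y := by
  obtain ⟨f, hf1, hf2⟩ := D.exists_glue (fun v _ => Φ v) fd h0 hs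
  refine ⟨f, hf1, hf2, D.dist_le_of_pieces f ?_ ?_⟩
  · intro v x hx y hy
    rw [hf1 v x hx, hf1 v y hy, dist_self]
    exact dist_nonneg
  · intro d s t
    rw [hf2, hf2]
    exact hlip d s t

/-- Linear extension to `X` of a function on the vertices that varies by at most one along
edges. -/
theorem exists_linear_extension (Φ : D.V → ℝ) (hΦ : ∀ d : D.tree.Dart, |Φ d.snd - Φ d.fst| ≤ 1) :
    ∃ f : X → ℝ, (∀ v, ∀ x ∈ D.space v, f x = Φ v) ∧
      (∀ d (t : unitInterval), f (D.edge d t) = (1 - (t : ℝ)) * Φ d.fst + t * Φ d.snd) ∧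
      ∀ x y, |f x - f y| ≤ dist x y := by
  refine D.exists_extension Φ (fun d t => (1 - (t : ℝ)) * Φ d.fst + t * Φ d.snd)
    (fun d => by simp) (fun d t => by simp; ring) (fun d s t => ?_)
  have : (1 - (s : ℝ)) * Φ d.fst + s * Φ d.snd - ((1 - (t : ℝ)) * Φ d.fst + t * Φ d.snd) =
    (s - t) * (Φ d.snd - Φ d.fst) := by ring
  rw [this, abs_mul]
  exact mul_le_of_le_one_right (abs_nonneg _) (hΦ d)

/-- Lower bounds on the gluing metric come from 1-Lipschitz functions; this one separates a vertex
space from everything beyond its adjoining edges. -/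
theorem exists_vertex_bump (v : D.V) : ∃ f : X → ℝ, (∀ x ∈ D.space v, f x = 1) ∧
    (∀ w ≠ v, ∀ x ∈ D.space w, f x = 0) ∧
    (∀ d : D.tree.Dart, d.fst ≠ v → d.snd ≠ v → ∀ t, f (D.edge d t) = 0) ∧
    ∀ x y, |f x - f y| ≤ dist x y := by
  classical
  obtain ⟨f, hf1, hf2, hf⟩ := D.exists_linear_extension (fun u => if u = v then 1 else 0)
    (fun d => by split_ifs <;> norm_num)
  refine ⟨f, fun x hx => by simp [hf1 v x hx], fun w hw x hx => by simp [hf1 w x hx, hw],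
    fun d h1 h2 t => by simp [hf2, h1, h2], hf⟩

theorem one_le_dist {v w : D.V} (hvw : v ≠ w) {x y : X} (hx : x ∈ D.space v) (hy : y ∈ D.space w) :
    1 ≤ dist x y := by
  obtain ⟨f, hf1, hf2, -, hf⟩ := D.exists_vertex_bump v
  have := hf x y
  rw [hf1 x hx, hf2 w hvw.symm y hy] at this
  simpa using this

theorem one_le_dist_edge {v : D.V} {x : X} (hx : x ∈ D.space v) {d : D.tree.Dart} (h1 : d.fst ≠ v)
    (h2 : d.snd ≠ v) (t : unitInterval) : 1 ≤ dist x (D.edge d t) := by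
  obtain ⟨f, hf1, -, hf2, hf⟩ := D.exists_vertex_bump v
  have := hf x (D.edge d t)
  rw [hf1 x hx, hf2 d h1 h2] at this
  simpa using this

/-- The open interval of an edge. -/
def openEdge (d : D.tree.Dart) : Set X := D.edge d '' Set.Ioo 0 1

theorem exists_bump (d : D.tree.Dart) : ∃ f : X → ℝ,
    (∀ t : unitInterval, f (D.edge d t) = min (t : ℝ) (1 - t)) ∧ (∀ x ∉ D.openEdge d, f x = 0) ∧
      ∀ x y, |f x - f y| ≤ dist x y := by
  classical
  obtain ⟨f, hf1, hf2, hf⟩ := D.exists_extension (fun _ => 0)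
    (fun d' t => if d'.edge = d.edge then min (t : ℝ) (1 - t) else 0)
    (fun d' => by simp)
    (fun d' t => by simp [min_comm])
    (fun d' s t => by
      split_ifs
      · refine (abs_min_sub_min_le_max _ _ _ _).trans (max_le le_rfl ?_)
        rw [abs_sub_comm]
        ring_nf
        exact le_rfl
      · simp)
  refine ⟨f, fun t => by simp [hf2], fun x hx => ?_, hf⟩
  rcases D.cover x with ⟨v, hv⟩ | ⟨d', t, rfl⟩
  · exact hf1 v x hv
  · rw [hf2]
    split_ifs with h
    · have key : ∀ t, D.edge d t ∉ D.openEdge d → min (t : ℝ) (1 - t) = 0 := by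
        intro t ht
        rcases eq_or_ne t 0 with rfl | h0
        · simp
        rcases eq_or_ne t 1 with rfl | h1
        · simp
        exact (ht ⟨t, ⟨unitInterval.pos_iff_ne_zero.2 h0,
          unitInterval.lt_one_iff_ne_one.2 h1⟩, rfl⟩).elim
      rcases (SimpleGraph.dart_edge_eq_iff d' d).1 h with rfl | rfl
      · exact key t hx
      · have := key (unitInterval.symm t) (by rwa [← D.edge_symm])
        rw [unitInterval.coe_symm_eq] at this
        rw [min_comm]
        simpa using this
    · rfl

theorem min_le_dist {d : D.tree.Dart} (t : unitInterval) {y : X} (hy : y ∉ D.openEdge d) :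
    min (t : ℝ) (1 - t) ≤ dist (D.edge d t) y := by
  obtain ⟨f, h1, h2, h3⟩ := D.exists_bump d
  have := h3 (D.edge d t) y
  rw [h1, h2 y hy, sub_zero] at this
  exact (le_abs_self _).trans this

theorem isOpen_openEdge (d : D.tree.Dart) : IsOpen (D.openEdge d) := by
  obtain ⟨f, h1, h2, h3⟩ := D.exists_bump d
  have hc : Continuous f := (LipschitzWith.of_dist_le_mul (K := 1)
    (fun x y => by simpa [Real.dist_eq] using h3 x y)).continuous
  have : D.openEdge d = {x | 0 < f x} := by
    ext x
    constructor
    · rintro ⟨t, ⟨ht0, ht1⟩, rfl⟩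
      change 0 < f _
      rw [h1]
      exact lt_min ht0 (sub_pos.2 ht1)
    · intro hx
      by_contra h
      exact hx.ne' (h2 x h)
  rw [this]
  exact isOpen_lt continuous_const hc

theorem edge_eq_of_mem_openEdge {d d' : D.tree.Dart} {x : X} (h : x ∈ D.openEdge d)
    (h' : x ∈ D.openEdge d') : d.edge = d'.edge := by
  obtain ⟨t, ⟨h0, h1⟩, rfl⟩ := h
  obtain ⟨t', -, ht⟩ := h'
  exact D.edge_disjoint d t d' t' h0 h1 ht.symm

theorem notMem_space_of_mem_openEdge {d : D.tree.Dart} {x : X} (h : x ∈ D.openEdge d) (v : D.V) :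
    x ∉ D.space v := by
  obtain ⟨t, ⟨h0, h1⟩, rfl⟩ := h
  exact D.edge_notMem d t h0 h1 v

theorem exists_mem_openEdge {x : X} (h : ∀ v, x ∉ D.space v) : ∃ d, x ∈ D.openEdge d := by
  obtain ⟨d, t, rfl⟩ := (D.cover x).resolve_left (fun ⟨v, hv⟩ => h v hv)
  refine ⟨d, t, ⟨unitInterval.pos_iff_ne_zero.2 ?_, unitInterval.lt_one_iff_ne_one.2 ?_⟩, rfl⟩
  · rintro rfl
    exact h _ (D.edge_zero_mem d)
  · rintro rfl
    exact h _ (D.edge_one_mem d)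

theorem openEdge_symm (d : D.tree.Dart) : D.openEdge d.symm = D.openEdge d := by
  have : ∀ d, D.openEdge d.symm ⊆ D.openEdge d := by
    rintro d _ ⟨t, ⟨h0, h1⟩, rfl⟩
    refine ⟨unitInterval.symm t, ⟨?_, ?_⟩, (D.edge_symm d t).symm⟩
    · rw [unitInterval.pos_iff_ne_zero, ne_eq, unitInterval.symm_eq_zero]
      exact h1.ne
    · rw [unitInterval.lt_one_iff_ne_one, ne_eq, unitInterval.symm_eq_one]
      exact h0.ne'
  refine (this d).antisymm ?_
  have := this d.symm
  rwa [SimpleGraph.Dart.symm_symm] at this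

end IdealTreeOfSpaces

/-! ### Local finiteness and linear points -/

/-- Each of finitely many balls of radius ε/2 covering the compact ball contains at most one member
of the separated family. -/
theorem finite_setOf_mem_closedBall {X : Type*} [MetricSpace X] [ProperSpace X] {ι : Type*}
    (p : ι → X) {ε : ℝ} (hε : 0 < ε) (hp : ∀ i j, i ≠ j → ε ≤ dist (p i) (p j)) (x : X) (R : ℝ) :
    {i | p i ∈ Metric.closedBall x R}.Finite := by
  obtain ⟨t, -, ht, hcov⟩ := (isCompact_closedBall x R).finite_cover_balls (half_pos hε)
  have h : ∀ i, ∃ y, p i ∈ Metric.closedBall x R → y ∈ t ∧ dist (p i) y < ε / 2 := by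
    intro i
    by_cases hi : p i ∈ Metric.closedBall x R
    · obtain ⟨y, hy, hd⟩ := Set.mem_iUnion₂.1 (hcov hi)
      exact ⟨y, fun _ => ⟨hy, hd⟩⟩
    · exact ⟨p i, fun h => (hi h).elim⟩
  choose c hc using h
  refine Set.Finite.of_finite_image (f := c) (ht.subset ?_) ?_
  · rintro _ ⟨i, hi, rfl⟩
    exact (hc i hi).1
  · intro i hi j hj hij
    by_contra hne
    have h1 := (hc i hi).2
    have h2 := (hc j hj).2
    have h3 := hp i j hne
    have h4 := dist_triangle_right (p i) (p j) (c i)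
    rw [← hij] at h2
    linarith

/-- A point near which the space is an open interval, in the sense that all small spheres consist
of two points. -/
def IsLinearPoint {X : Type*} [MetricSpace X] (x : X) : Prop :=
  ∃ ε₀ > 0, ∀ ε, 0 < ε → ε < ε₀ → (Metric.sphere x ε).ncard = 2

theorem IsLinearPoint.map {X : Type*} [MetricSpace X] {x : X} (h : IsLinearPoint x) (g : X ≃ᵢ X) :
    IsLinearPoint (g x) := by
  obtain ⟨ε₀, h0, h⟩ := h
  refine ⟨ε₀, h0, fun ε hε hlt => ?_⟩
  rw [← g.image_sphere, Set.ncard_image_of_injective _ g.injective]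
  exact h ε hε hlt

theorem isLinearPoint_apply_iff {X : Type*} [MetricSpace X] {x : X} (g : X ≃ᵢ X) :
    IsLinearPoint (g x) ↔ IsLinearPoint x :=
  ⟨fun h => by simpa using h.map g.symm, fun h => h.map g⟩

namespace IdealTreeOfSpaces

variable {X : Type u} [MetricSpace X] (D : IdealTreeOfSpaces.{u, u} X)

theorem finite_vertices [ProperSpace X] (x : X) (R : ℝ) :
    {v | (D.space v ∩ Metric.closedBall x R).Nonempty}.Finite := by
  classical
  let p : D.V → X := fun v => if h : (D.space v ∩ Metric.closedBall x R).Nonempty then h.some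
    else (D.space_nonempty v).some
  have hp : ∀ v, p v ∈ D.space v := by
    intro v
    simp only [p]
    split_ifs with h
    · exact h.some_mem.1
    · exact (D.space_nonempty v).some_mem
  refine (finite_setOf_mem_closedBall p one_pos (fun v w h => D.one_le_dist h (hp v) (hp w))
    x R).subset fun v hv => ?_
  have hv' : (D.space v ∩ Metric.closedBall x R).Nonempty := hv
  change p v ∈ Metric.closedBall x R
  simp only [p, dif_pos hv']
  exact hv'.some_mem.2

theorem finite_darts [ProperSpace X] (x : X) (R : ℝ) :
    {d | D.edge d 0 ∈ Metric.closedBall x R}.Finite := by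
  -- An asymmetric parameter, so that an edge and its reverse mark different points, 1/3 apart.
  let t : unitInterval := ⟨1 / 3, by norm_num, by norm_num⟩
  have ht0 : 0 < t := Subtype.mk_lt_mk.2 (by norm_num)
  have ht1 : t < 1 := Subtype.mk_lt_mk.2 (by norm_num)
  refine (finite_setOf_mem_closedBall (fun d => D.edge d t) (ε := 1 / 3) (by norm_num) ?_
    x (R + 1)).subset ?_
  · intro d d' hdd
    by_cases h : D.edge d' t ∈ D.openEdge d
    · obtain ⟨s, hs, hst⟩ := h
      rcases D.edge_eq_edge ht0 ht1 hst.symm with ⟨h, -⟩ | ⟨rfl, rfl⟩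
      · exact (hdd h).elim
      · rw [← hst, (D.edge_isometry _).dist_eq, Subtype.dist_eq, Real.dist_eq]
        simp [t]
        norm_num
    · refine le_trans ?_ (D.min_le_dist t h)
      simp [t]
      norm_num
  · intro d hd
    have hd : dist (D.edge d 0) x ≤ R := hd
    change dist (D.edge d t) x ≤ R + 1
    have h1 := dist_triangle (D.edge d t) (D.edge d 0) x
    have h2 : dist t 0 ≤ 1 := by
      rw [Subtype.dist_eq, Real.dist_eq]
      simp [t]
      norm_num
    rw [(D.edge_isometry d).dist_eq] at h1
    linarith

theorem isLinearPoint_of_mem_openEdge {d : D.tree.Dart} {x : X} (hx : x ∈ D.openEdge d) :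
    IsLinearPoint x := by
  obtain ⟨t, ⟨h0, h1⟩, rfl⟩ := hx
  have h0' : (0 : ℝ) < t := h0
  have h1' : (t : ℝ) < 1 := h1
  refine ⟨min (t : ℝ) (1 - t), lt_min h0' (sub_pos.2 h1'), fun ε hε hlt => ?_⟩
  obtain ⟨h2, h3⟩ := lt_min_iff.1 hlt
  let a : unitInterval := ⟨t - ε, by linarith, by linarith⟩
  let b : unitInterval := ⟨t + ε, by linarith, by linarith⟩
  have hab : a ≠ b := fun h => by
    have := congrArg Subtype.val h
    simp only [a, b] at this
    linarith
  have : Metric.sphere (D.edge d t) ε = {D.edge d a, D.edge d b} := by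
    ext y
    rw [Metric.mem_sphere, dist_comm]
    constructor
    · intro hy
      have hmem : y ∈ D.openEdge d := by
        by_contra h
        have := D.min_le_dist t h
        linarith
      obtain ⟨s, hs, rfl⟩ := hmem
      rw [(D.edge_isometry d).dist_eq, Subtype.dist_eq, Real.dist_eq] at hy
      rcases (abs_eq hε.le).1 hy with h | h
      · left
        congr 1
        exact Subtype.ext (by simp only [a]; linarith)
      · right
        rw [Set.mem_singleton_iff]
        congr 1
        exact Subtype.ext (by simp only [b]; linarith)
    · rintro (rfl | rfl)
      · rw [(D.edge_isometry d).dist_eq, Subtype.dist_eq, Real.dist_eq]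
        simp [a, abs_of_pos hε]
      · rw [(D.edge_isometry d).dist_eq, Subtype.dist_eq, Real.dist_eq]
        simp [b, abs_of_pos hε]
  rw [this, Set.ncard_pair ((D.edge_isometry d).injective.ne hab)]

theorem not_isLinearPoint_of_symmetric {v : D.V} (hv : IsRankOneSymmetricSpace (D.space v)) {x : X}
    (hx : x ∈ D.space v) : ¬ IsLinearPoint x := by
  rintro ⟨ε₀, h0, h⟩
  obtain ⟨ε₁, h1, h'⟩ := hv.exists_three_dist_eq ⟨x, hx⟩
  have hm : 0 < min ε₀ ε₁ := lt_min h0 h1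
  have hlt := half_lt_self hm
  obtain ⟨a, b, c, hab, hac, hbc, ha, hb, hc⟩ := h' _ (half_pos hm) (hlt.trans_le (min_le_right _ _))
  obtain ⟨y, z, -, hyz⟩ := Set.ncard_eq_two.1
    (h _ (half_pos hm) (hlt.trans_le (min_le_left _ _)))
  have key : ∀ s : D.space v, dist (⟨x, hx⟩ : D.space v) s = min ε₀ ε₁ / 2 → s.1 = y ∨ s.1 = z := by
    intro s hs
    have : s.1 ∈ Metric.sphere x (min ε₀ ε₁ / 2) := by
      rw [Metric.mem_sphere, dist_comm]
      exact hs
    rw [hyz] at this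
    exact this
  rcases key a ha with h1 | h1 <;> rcases key b hb with h2 | h2 <;> rcases key c hc with h3 | h3
  · exact hab (Subtype.ext (h1.trans h2.symm))
  · exact hab (Subtype.ext (h1.trans h2.symm))
  · exact hac (Subtype.ext (h1.trans h3.symm))
  · exact hbc (Subtype.ext (h2.trans h3.symm))
  · exact hbc (Subtype.ext (h2.trans h3.symm))
  · exact hac (Subtype.ext (h1.trans h3.symm))
  · exact hab (Subtype.ext (h1.trans h2.symm))
  · exact hab (Subtype.ext (h1.trans h2.symm))

/-- A point vertex that is a linear point has exactly two neighbours. -/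
theorem exists_two_neighbors {v : D.V} {x : X} (hv : D.space v = {x}) (hx : IsLinearPoint x) :
    ∃ a b, a ≠ b ∧ D.tree.Adj v a ∧ D.tree.Adj v b ∧ ∀ w, D.tree.Adj v w → w = a ∨ w = b := by
  obtain ⟨ε₀, h0, h⟩ := hx
  have hm : 0 < min ε₀ 1 := lt_min h0 one_pos
  set ε := min ε₀ 1 / 2 with hε
  have hε0 : 0 < ε := half_pos hm
  have hε1 : ε < 1 := (half_lt_self hm).trans_le (min_le_right _ _)
  have hcard := h ε hε0 ((half_lt_self hm).trans_le (min_le_left _ _))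
  obtain ⟨y, z, hyz, hS⟩ := Set.ncard_eq_two.1 hcard
  let t : unitInterval := ⟨ε, hε0.le, hε1.le⟩
  have ht0 : 0 < t := hε0
  have ht1 : t < 1 := hε1
  have hxv : x ∈ D.space v := by rw [hv]; rfl
  have hd0 : ∀ d : D.tree.Dart, d.fst = v → D.edge d 0 = x := by
    rintro d rfl
    have := D.edge_zero_mem d
    rwa [hv] at this
  have hmem : ∀ d : D.tree.Dart, d.fst = v → D.edge d t ∈ Metric.sphere x ε := by
    intro d hd
    rw [Metric.mem_sphere, ← hd0 d hd, (D.edge_isometry d).dist_eq, Subtype.dist_eq, Real.dist_eq]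
    simp [t, abs_of_pos hε0]
  -- Since ε < 1, the sphere about a point vertex meets each outgoing edge once and nothing else, so
  -- its points count the neighbours.
  have hex : ∀ y ∈ Metric.sphere x ε, ∃ d : D.tree.Dart, d.fst = v ∧ D.edge d t = y := by
    intro y hy
    rw [Metric.mem_sphere, dist_comm] at hy
    have hns : ∀ w, y ∉ D.space w := by
      intro w hw
      by_cases hvw : v = w
      · subst hvw
        rw [hv] at hw
        rw [Set.mem_singleton_iff.1 hw, dist_self] at hy
        exact hε0.ne hy
      · have := D.one_le_dist hvw hxv hw
        linarith
    obtain ⟨d, s, hs, rfl⟩ := D.exists_mem_openEdge hns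
    have key : ∀ d : D.tree.Dart, ∀ s : unitInterval, d.fst = v → dist x (D.edge d s) = ε → s = t := by
      intro d s hd hds
      rw [← hd0 d hd, (D.edge_isometry d).dist_eq, Subtype.dist_eq, Real.dist_eq] at hds
      have h3 : (s : ℝ) = ε := by simpa [abs_of_nonneg s.2.1] using hds
      exact Subtype.ext h3
    by_cases h1 : d.fst = v
    · exact ⟨d, h1, by rw [key d s h1 hy]⟩
    by_cases h2 : d.snd = v
    · have h3 : D.edge d s = D.edge d.symm (unitInterval.symm s) := by
        rw [D.edge_symm, unitInterval.symm_symm]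
      rw [h3] at hy ⊢
      exact ⟨d.symm, h2, by rw [key d.symm _ h2 hy]⟩
    · have := D.one_le_dist_edge hxv h1 h2 s
      linarith
  obtain ⟨d₁, h1, e1⟩ := hex y (by rw [hS]; exact Or.inl rfl)
  obtain ⟨d₂, h2, e2⟩ := hex z (by rw [hS]; exact Or.inr rfl)
  have hinj : ∀ d d' : D.tree.Dart, d.fst = v → d'.fst = v → D.edge d t = D.edge d' t → d = d' := by
    intro d d' hd hd' h
    rcases D.edge_eq_edge ht0 ht1 h with ⟨h, -⟩ | ⟨rfl, -⟩
    · exact h.symm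
    · have h4 := d.adj
      rw [hd, show d.snd = v from hd'] at h4
      exact (D.tree.irrefl h4).elim
  refine ⟨d₁.snd, d₂.snd, fun h => hyz ?_, h1 ▸ d₁.adj, h2 ▸ d₂.adj, fun w hw => ?_⟩
  · rw [← e1, ← e2]
    congr 1
    exact SimpleGraph.Dart.ext _ _ (Prod.ext (h1.trans h2.symm) h)
  · have := hmem ⟨(v, w), hw⟩ rfl
    rw [hS] at this
    rcases this with h | h
    · left
      rw [← hinj ⟨(v, w), hw⟩ d₁ rfl h1 (h.trans e1.symm)]
    · right
      rw [← hinj ⟨(v, w), hw⟩ d₂ rfl h2 (h.trans e2.symm)]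

end IdealTreeOfSpaces

/-! ### Trees of valence two and the line -/

/-- In a tree all of whose vertices have exactly two neighbours, the vertices can be numbered by
the integers. -/
theorem SimpleGraph.IsTree.exists_numbering {V : Type u} {T : SimpleGraph V} (hT : T.IsTree)
    (h2 : ∀ v, ∃ a b, a ≠ b ∧ T.Adj v a ∧ T.Adj v b ∧ ∀ w, T.Adj v w → w = a ∨ w = b) :
    ∃ p : ℤ ≃ V, ∀ v w, T.Adj v w ↔ (p.symm w = p.symm v + 1 ∨ p.symm v = p.symm w + 1) := by
  obtain ⟨v₀⟩ := hT.connected.nonempty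
  have other : ∀ v r, T.Adj v r → ∃ l, T.Adj v l ∧ l ≠ r ∧ ∀ w, T.Adj v w → w ≠ r → w = l := by
    intro v r hr
    obtain ⟨a, b, hab, ha, hb, h⟩ := h2 v
    rcases h r hr with rfl | rfl
    · exact ⟨b, hb, hab.symm, fun w hw hne => (h w hw).resolve_left hne⟩
    · exact ⟨a, ha, hab, fun w hw hne => (h w hw).resolve_right hne⟩
  obtain ⟨r₀, -, -, hr₀, -⟩ := h2 v₀
  -- A state is a number together with a neighbour declared to be the next vertex. Passing to the
  -- next vertex adds 1, passing to the other neighbour subtracts 1, and the direction stays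
  -- coherent.
  obtain ⟨σ, hσ0, hσ⟩ := (hT.isTreeLike v₀).exists_section
    (fun v => {s : ℤ × V // T.Adj v s.2})
    (fun v w s t => (w = s.1.2 ∧ t.1.1 = s.1.1 + 1 ∧ t.1.2 ≠ v) ∨
      (w ≠ s.1.2 ∧ t.1.1 = s.1.1 - 1 ∧ t.1.2 = v))
    (by
      rintro v w s t - (⟨h1, h2, h3⟩ | ⟨h1, h2, h3⟩)
      · exact Or.inr ⟨h3.symm, by omega, h1.symm⟩
      · exact Or.inl ⟨h3.symm, by omega, h1.symm⟩)
    (by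
      intro v w hvw s
      by_cases h : w = s.1.2
      · obtain ⟨l, hl, hne, -⟩ := other w v hvw.symm
        exact ⟨⟨(s.1.1 + 1, l), hl⟩, Or.inl ⟨h, rfl, hne⟩⟩
      · exact ⟨⟨(s.1.1 - 1, v), hvw.symm⟩, Or.inr ⟨h, rfl, rfl⟩⟩)
    ⟨(0, r₀), hr₀⟩
  let n : V → ℤ := fun v => (σ v).1.1
  let r : V → V := fun v => (σ v).1.2
  have hr : ∀ v, T.Adj v (r v) := fun v => (σ v).2
  have hR : ∀ v w, T.Adj v w → (w = r v ∧ n w = n v + 1 ∧ r w ≠ v) ∨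
    (w ≠ r v ∧ n w = n v - 1 ∧ r w = v) := hσ
  choose l hl hlne hluniq using fun v => other v (r v) (hr v)
  have hrl : ∀ v, r (l v) = v := fun v =>
    ((hR v (l v) (hl v)).resolve_left fun h => hlne v h.1).2.2
  have hnr : ∀ v, n (r v) = n v + 1 := fun v =>
    ((hR v (r v) (hr v)).resolve_right fun h => h.1 rfl).2.1
  have hlr : ∀ v, l (r v) = v := fun v =>
    (hluniq (r v) v (hr v).symm fun h =>
      ((hR v (r v) (hr v)).resolve_right fun h => h.1 rfl).2.2 h.symm).symm
  let nxt : Equiv.Perm V := ⟨r, l, hlr, hrl⟩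
  have hnn : ∀ v, n (nxt v) = n v + 1 := hnr
  have hnpow : ∀ k : ℤ, n ((nxt ^ k) v₀) = k := by
    intro k
    induction k using Int.induction_on with
    | zero => simp [n, hσ0]
    | succ k ih => rw [zpow_add_one, (Commute.zpow_left (Commute.refl nxt) _).eq,
        Equiv.Perm.mul_apply, hnn, ih]
    | pred k ih =>
      have h1 : n (nxt ((nxt ^ (-(k : ℤ) - 1)) v₀)) = -k := by
        rw [← Equiv.Perm.mul_apply, ← zpow_one_add]
        convert ih using 4
        ring
      rw [hnn] at h1
      omega
  have hsurj : ∀ v, (nxt ^ n v) v₀ = v := by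
    have h : ∀ v, ∃ k : ℤ, (nxt ^ k) v₀ = v := by
      refine (hT.isTreeLike v₀).induction _ ⟨0, by simp⟩ ?_
      rintro u w huw ⟨k, rfl⟩
      by_cases hw : w = r ((nxt ^ k) v₀)
      · refine ⟨1 + k, ?_⟩
        rw [zpow_one_add, Equiv.Perm.mul_apply, hw]
        rfl
      · refine ⟨-1 + k, ?_⟩
        rw [zpow_add, zpow_neg_one, Equiv.Perm.mul_apply, hluniq _ w huw hw]
        rfl
    intro v
    obtain ⟨k, rfl⟩ := h v
    rw [hnpow]
  refine ⟨⟨fun k => (nxt ^ k) v₀, n, hnpow, hsurj⟩, fun v w => ?_⟩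
  change _ ↔ n w = n v + 1 ∨ n v = n w + 1
  have hinj : ∀ v w, n v = n w → v = w := by
    intro v w h
    rw [← hsurj v, ← hsurj w, h]
  constructor
  · intro h
    rcases hR v w h with ⟨-, h, -⟩ | ⟨-, h, -⟩
    · exact Or.inl h
    · exact Or.inr (by omega)
  · rintro (h | h)
    · rw [hinj w (r v) (by rw [h, hnr])]
      exact hr v
    · rw [hinj v (r w) (by rw [h, hnr])]
      exact (hr w).symm

namespace IdealTreeOfSpaces

variable {X : Type u} [MetricSpace X]

/-- If all points are linear, the space is a line. -/
theorem nonempty_isometryEquiv_real (D : IdealTreeOfSpaces.{u, u} X) (h : ∀ x : X, IsLinearPoint x) : Nonempty (X ≃ᵢ ℝ) := by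
  have hpt : ∀ v, ∃ x, D.space v = {x} := fun v => (D.space_spec v).resolve_right fun hv => by
    obtain ⟨x, hx⟩ := D.space_nonempty v
    exact D.not_isLinearPoint_of_symmetric hv hx (h x)
  choose pt hpt using hpt
  have hpt' : ∀ v x, x ∈ D.space v → x = pt v := fun v x hx => by rwa [hpt v] at hx
  obtain ⟨p, hp⟩ := D.isTree.exists_numbering fun v => D.exists_two_neighbors (hpt v) (h _)
  obtain ⟨F, hF1, hF2, hF⟩ := D.exists_linear_extension (fun v => (p.symm v : ℝ)) (fun d => by
    rcases (hp _ _).1 d.adj with h | h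
    · simp [h]
    · simp [h])
  let e : ℤ → D.tree.Dart := fun k => ⟨(p k, p (k + 1)), (hp _ _).2 (Or.inl (by simp))⟩
  have he0 : ∀ k, D.edge (e k) 0 = pt (p k) := fun k => hpt' _ _ (D.edge_zero_mem (e k))
  have he1 : ∀ k, D.edge (e k) 1 = pt (p (k + 1)) := fun k => hpt' _ _ (D.edge_one_mem (e k))
  have hFe : ∀ k (t : unitInterval), F (D.edge (e k) t) = k + t := by
    intro k t
    rw [hF2]
    simp only [e, Equiv.symm_apply_apply]
    push_cast
    ring
  have hcov' : ∀ x, ∃ k, ∃ t : unitInterval, D.edge (e k) t = x := by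
    intro x
    rcases D.cover x with ⟨v, hv⟩ | ⟨d, t, rfl⟩
    · exact ⟨p.symm v, 0, by rw [he0, hpt' v x hv, Equiv.apply_symm_apply]⟩
    · rcases (hp _ _).1 d.adj with h | h
      · refine ⟨p.symm d.fst, t, ?_⟩
        congr 1
        refine SimpleGraph.Dart.ext _ _ (Prod.ext (by simp [e]) ?_)
        simp [e, ← h]
      · refine ⟨p.symm d.snd, unitInterval.symm t, ?_⟩
        have : e (p.symm d.snd) = d.symm :=
          SimpleGraph.Dart.ext _ _ (Prod.ext (by simp [e]) (by simp [e, ← h]))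
        rw [this, D.edge_symm, unitInterval.symm_symm]
  have hcov : ∀ x, ∃ k, ∃ t : unitInterval, t < 1 ∧ D.edge (e k) t = x := by
    intro x
    obtain ⟨k, t, rfl⟩ := hcov' x
    rcases eq_or_ne t 1 with rfl | ht
    · exact ⟨k + 1, 0, zero_lt_one, by rw [he0, he1]⟩
    · exact ⟨k, t, unitInterval.lt_one_iff_ne_one.2 ht, rfl⟩
  have hvert : ∀ (k : ℤ) (j : ℕ), dist (pt (p k)) (pt (p (k + j))) ≤ j := by
    intro k j
    induction j with
    | zero => simp
    | succ j ih =>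
      have h1 := dist_triangle (pt (p k)) (pt (p (k + j))) (pt (p (k + j + 1)))
      have h2 : dist (pt (p (k + j))) (pt (p (k + j + 1))) = 1 := by
        rw [← he0, ← he1, (D.edge_isometry _).dist_eq, Subtype.dist_eq, Real.dist_eq]
        simp
      push_cast
      rw [← add_assoc]
      linarith
  -- The function is already 1-Lipschitz; the reverse estimate follows the chain of edges between
  -- the two points.
  have hle : ∀ x y, F x ≤ F y → dist x y ≤ F y - F x := by
    intro x y hxy
    obtain ⟨k, s, hs, rfl⟩ := hcov x
    obtain ⟨l, t, ht, rfl⟩ := hcov y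
    rw [hFe, hFe] at hxy ⊢
    have hs' : (s : ℝ) < 1 := hs
    have ht' : (t : ℝ) < 1 := ht
    have hs0 := s.2.1
    have ht0 := t.2.1
    have hkl : k ≤ l := by
      have : (k : ℝ) < l + 1 := by linarith
      exact Int.lt_add_one_iff.1 (by exact_mod_cast this)
    rcases hkl.eq_or_lt with rfl | hlt
    · rw [(D.edge_isometry _).dist_eq, Subtype.dist_eq, Real.dist_eq, abs_sub_comm,
        abs_of_nonneg (by linarith)]
      linarith
    · obtain ⟨j, rfl⟩ : ∃ j : ℕ, l = k + 1 + j := ⟨(l - (k + 1)).toNat, by omega⟩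
      have h1 : dist (D.edge (e k) s) (pt (p (k + 1))) = 1 - s := by
        rw [← he1, (D.edge_isometry _).dist_eq, Subtype.dist_eq, Real.dist_eq, abs_sub_comm]
        exact abs_of_nonneg (by simpa using hs'.le)
      have h2 : dist (pt (p (k + 1 + j))) (D.edge (e (k + 1 + j)) t) = t := by
        rw [← he0, (D.edge_isometry _).dist_eq, Subtype.dist_eq, Real.dist_eq]
        simp [abs_of_nonneg ht0]
      have h3 := dist_triangle4 (D.edge (e k) s) (pt (p (k + 1))) (pt (p (k + 1 + j)))
        (D.edge (e (k + 1 + j)) t)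
      have h4 := hvert (k + 1) j
      push_cast
      linarith
  have hiso : Isometry F := by
    refine Isometry.of_dist_eq fun x y => le_antisymm (hF x y) ?_
    rw [Real.dist_eq]
    rcases le_total (F x) (F y) with hxy | hxy
    · rw [abs_sub_comm]
      exact (hle x y hxy).trans (le_abs_self _)
    · rw [dist_comm]
      exact (hle y x hxy).trans (le_abs_self _)
  have hsurj : Function.Surjective F := by
    intro r
    refine ⟨D.edge (e ⌊r⌋) ⟨Int.fract r, Int.fract_nonneg r, (Int.fract_lt_one r).le⟩, ?_⟩
    rw [hFe]
    exact Int.floor_add_fract r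
  exact ⟨⟨Equiv.ofBijective F ⟨hiso.injective, hsurj⟩, hiso⟩⟩

end IdealTreeOfSpaces

/-! ### Isometries preserve the decomposition -/

/-- The graph distance to a nonempty set of vertices. -/
theorem SimpleGraph.Connected.exists_distance_to_set {V : Type*} {T : SimpleGraph V}
    (hT : T.Connected) {A : Set V} (hA : A.Nonempty) :
    ∃ m : V → ℕ, (∀ v, m v = 0 → v ∈ A) ∧ (∀ v ∈ A, m v = 0) ∧
      (∀ v w, T.Adj v w → m v ≤ m w + 1) ∧ ∀ v k, m v = k + 1 → ∃ w, T.Adj v w ∧ m w = k := by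
  classical
  have hex : ∀ v, ∃ k, ∃ w ∈ A, ∃ p : T.Walk v w, p.length = k := by
    intro v
    obtain ⟨w, hw⟩ := hA
    obtain ⟨p⟩ := hT v w
    exact ⟨_, w, hw, p, rfl⟩
  have hstep : ∀ v w, T.Adj v w → Nat.find (hex v) ≤ Nat.find (hex w) + 1 := by
    intro v w hvw
    obtain ⟨a, ha, p, hp⟩ := Nat.find_spec (hex w)
    exact Nat.find_min' (hex v) ⟨a, ha, .cons hvw p, by simp [hp]⟩
  refine ⟨fun v => Nat.find (hex v), fun v hv => ?_, fun v hv => ?_, hstep, fun v k hk => ?_⟩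
  · obtain ⟨a, ha, p, hp⟩ := Nat.find_spec (hex v)
    have hv : Nat.find (hex v) = 0 := hv
    rw [hv] at hp
    exact SimpleGraph.Walk.eq_of_length_eq_zero hp ▸ ha
  · exact (Nat.find_eq_zero _).2 ⟨v, hv, .nil, rfl⟩
  · have hk : Nat.find (hex v) = k + 1 := hk
    obtain ⟨a, ha, p, hp⟩ := Nat.find_spec (hex v)
    cases p with
    | nil =>
      rw [hk] at hp
      simp at hp
    | cons h q =>
      refine ⟨_, h, le_antisymm (Nat.find_min' _ ⟨a, ha, q, ?_⟩) ?_⟩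
      · rw [hk] at hp
        simpa using hp
      · have := hstep _ _ h
        rw [hk] at this
        exact Nat.le_of_succ_le_succ this

theorem unitInterval.isometry_eq {φ : unitInterval → unitInterval} (hφ : Isometry φ) :
    (∀ t, φ t = t) ∨ ∀ t, φ t = unitInterval.symm t := by
  have hd : ∀ s t, |(φ s : ℝ) - φ t| = |(s : ℝ) - t| := fun s t => hφ.dist_eq s t
  have h01 := hd 0 1
  have a0 := (φ 0).2.1
  have a1 := (φ 0).2.2
  have b0 := (φ 1).2.1
  have b1 := (φ 1).2.2
  have h1 : |((0 : unitInterval) : ℝ) - (1 : unitInterval)| = 1 := by simp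
  rw [h1] at h01
  rcases (abs_eq zero_le_one).1 h01 with h | h
  · right
    intro t
    have h2 := hd t 1
    have h3 : (φ 1 : ℝ) = 0 := by linarith
    rw [h3, sub_zero, abs_of_nonneg (φ t).2.1, abs_sub_comm,
      abs_of_nonneg (sub_nonneg.2 (show (t : ℝ) ≤ (1 : unitInterval) from t.2.2))] at h2
    exact Subtype.ext (by rw [h2]; simp)
  · left
    intro t
    have h2 := hd t 0
    have h3 : (φ 0 : ℝ) = 0 := by linarith
    rw [h3, sub_zero, abs_of_nonneg (φ t).2.1] at h2
    exact Subtype.ext (by rw [h2]; simp [abs_of_nonneg t.2.1])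

namespace IdealTreeOfSpaces

variable {X : Type u} [MetricSpace X] (D : IdealTreeOfSpaces.{u, u} X)

/-- The points in the vertex spaces are those at integral distance from the set of points at which
the space is not a line. -/
theorem mem_space_iff_infDist (hN : ∃ x : X, ¬ IsLinearPoint x) (x : X) :
    (∃ v, x ∈ D.space v) ↔ ∃ k : ℕ, Metric.infDist x {y | ¬ IsLinearPoint y} = k := by
  set N : Set X := {y | ¬ IsLinearPoint y} with hNdef
  have hNv : ∀ y ∈ N, ∃ v, y ∈ D.space v := by
    intro y hy
    by_contra h
    push Not at h
    obtain ⟨d, hd⟩ := D.exists_mem_openEdge h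
    exact hy (D.isLinearPoint_of_mem_openEdge hd)
  let A : Set D.V := {v | ∃ y ∈ D.space v, y ∈ N}
  have hAN : ∀ v ∈ A, ∀ y ∈ D.space v, y ∈ N := by
    rintro v ⟨y, hy, hyN⟩ z hz
    rcases D.space_spec v with ⟨w, hw⟩ | hv
    · rw [hw] at hy hz
      rw [Set.mem_singleton_iff.1 hz, ← Set.mem_singleton_iff.1 hy]
      exact hyN
    · exact D.not_isLinearPoint_of_symmetric hv hz
  have hA : A.Nonempty := by
    obtain ⟨y, hy⟩ := hN
    obtain ⟨v, hv⟩ := hNv y hy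
    exact ⟨v, y, hv, hy⟩
  obtain ⟨m, hm0, hmA, hm1, hmk⟩ := D.isTree.connected.exists_distance_to_set hA
  have hm1' : ∀ v w, D.tree.Adj v w → (m v : ℝ) ≤ m w + 1 := fun v w h => by exact_mod_cast hm1 v w h
  -- The candidate for the distance to N: graph distance on vertices, and on an edge the shorter way
  -- out through either end. Being 1-Lipschitz and zero on N, it bounds the distance from below.
  obtain ⟨ρ, hρ1, hρ2, hρ⟩ := D.exists_extension (fun v => (m v : ℝ))
    (fun d t => min (m d.fst + (t : ℝ)) (m d.snd + (1 - t)))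
    (fun d => by simpa using hm1' _ _ d.adj)
    (fun d t => by simp [min_comm])
    (fun d s t => by
      refine (abs_min_sub_min_le_max _ _ _ _).trans (max_le (by simp) ?_)
      rw [abs_sub_comm]
      refine le_of_eq (congrArg _ ?_)
      ring)
  have hlower : ∀ x, ρ x ≤ Metric.infDist x N := by
    intro x
    rw [Metric.le_infDist (s := N) hN]
    intro y hy
    obtain ⟨v, hv⟩ := hNv y hy
    have h1 := hρ x y
    rw [hρ1 v y hv, hmA v ⟨y, hv, hy⟩, Nat.cast_zero, sub_zero] at h1
    exact (le_abs_self _).trans h1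
  have hupper : ∀ k v, m v = k → ∀ x ∈ D.space v, Metric.infDist x N ≤ k := by
    intro k
    induction k with
    | zero =>
      intro v hv x hx
      rw [Metric.infDist_zero_of_mem (hAN v (hm0 v hv) x hx), Nat.cast_zero]
    | succ k ih =>
      intro v hv x hx
      obtain ⟨w, hvw, hw⟩ := hmk v k hv
      let d : D.tree.Dart := ⟨(v, w), hvw⟩
      -- Symmetric vertex spaces belong to A, so outside A a vertex space is a point and no distance
      -- is spent inside it.
      have hsing : D.edge d 0 = x := by
        rcases D.space_spec v with ⟨z, hz⟩ | hsym
        · have h1 : D.edge d 0 ∈ D.space v := D.edge_zero_mem d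
          rw [hz] at h1 hx
          exact h1.trans hx.symm
        · have : v ∈ A := ⟨x, hx, D.not_isLinearPoint_of_symmetric hsym hx⟩
          rw [hmA v this] at hv
          omega
      have h2 := ih w hw (D.edge d 1) (D.edge_one_mem d)
      have h3 := Metric.infDist_le_infDist_add_dist (s := N) (x := x) (y := D.edge d 1)
      rw [← hsing, (D.edge_isometry d).dist_eq] at h3
      have h4 : dist (0 : unitInterval) 1 = 1 := by simp [Subtype.dist_eq]
      rw [h4, hsing] at h3
      push_cast
      linarith
  constructor
  · rintro ⟨v, hv⟩
    refine ⟨m v, le_antisymm (hupper _ v rfl x hv) ?_⟩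
    rw [← hρ1 v x hv]
    exact hlower x
  · rintro ⟨k, hk⟩
    by_contra h
    push Not at h
    obtain ⟨d, t, ⟨h0, h1⟩, rfl⟩ := D.exists_mem_openEdge h
    have h0' : (0 : ℝ) < t := h0
    have h1' : (t : ℝ) < 1 := h1
    have hle1 : Metric.infDist (D.edge d t) N ≤ m d.fst + t := by
      have h3 := Metric.infDist_le_infDist_add_dist (s := N) (x := D.edge d t) (y := D.edge d 0)
      have h4 := hupper _ _ rfl (D.edge d 0) (D.edge_zero_mem d)
      rw [(D.edge_isometry d).dist_eq, Subtype.dist_eq, Real.dist_eq] at h3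
      rw [Set.Icc.coe_zero, sub_zero, abs_of_pos h0'] at h3
      linarith
    have hle2 : Metric.infDist (D.edge d t) N ≤ m d.snd + (1 - t) := by
      have h3 := Metric.infDist_le_infDist_add_dist (s := N) (x := D.edge d t) (y := D.edge d 1)
      have h4 := hupper _ _ rfl (D.edge d 1) (D.edge_one_mem d)
      rw [(D.edge_isometry d).dist_eq, Subtype.dist_eq, Real.dist_eq, abs_sub_comm] at h3
      rw [Set.Icc.coe_one, abs_of_pos (sub_pos.2 h1')] at h3
      linarith
    have heq : Metric.infDist (D.edge d t) N = min (m d.fst + (t : ℝ)) (m d.snd + (1 - t)) :=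
      le_antisymm (le_min hle1 hle2) (by rw [← hρ2]; exact hlower _)
    rw [hk] at heq
    -- In the interior of an edge the distance lies strictly between consecutive integers.
    rcases min_choice (m d.fst + (t : ℝ)) (m d.snd + (1 - t)) with h5 | h5
    · rw [h5] at heq
      have h6 : (m d.fst : ℝ) < k := by linarith
      have h7 : (k : ℝ) < m d.fst + 1 := by linarith
      norm_cast at h6 h7
      omega
    · rw [h5] at heq
      have h6 : (m d.snd : ℝ) < k := by linarith
      have h7 : (k : ℝ) < m d.snd + 1 := by linarith
      norm_cast at h6 h7
      omega

theorem mem_space_apply_iff (hN : ∃ x : X, ¬ IsLinearPoint x) (g : X ≃ᵢ X) (x : X) :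
    (∃ v, g x ∈ D.space v) ↔ ∃ v, x ∈ D.space v := by
  have h1 : g '' {y | ¬ IsLinearPoint y} = {y | ¬ IsLinearPoint y} := by
    ext y
    constructor
    · rintro ⟨z, hz, rfl⟩
      exact fun h => hz ((isLinearPoint_apply_iff g).1 h)
    · intro hy
      exact ⟨g.symm y, fun h => hy (by simpa using h.map g), by simp⟩
  rw [D.mem_space_iff_infDist hN, D.mem_space_iff_infDist hN]
  conv_lhs => rw [← h1, Metric.infDist_image g.isometry]

theorem isPreconnected_space (v : D.V) : IsPreconnected (D.space v) := by
  rcases D.space_spec v with ⟨x, hx⟩ | h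
  · rw [hx]
    exact isPreconnected_singleton
  · exact isPreconnected_iff_preconnectedSpace.2 h.preconnectedSpace

/-- Different vertex spaces are at least 1 apart, so on their union the 1-thickenings separate one
from the rest. -/
theorem exists_subset_space {S : Set X} (hS : IsPreconnected S) (hne : S.Nonempty)
    (hsub : ∀ x ∈ S, ∃ v, x ∈ D.space v) : ∃ v, S ⊆ D.space v := by
  obtain ⟨x₀, hx₀⟩ := hne
  obtain ⟨v, hv⟩ := hsub x₀ hx₀
  refine ⟨v, fun x hx => ?_⟩
  obtain ⟨w, hw⟩ := hsub x hx
  by_contra hxv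
  have hwv : w ≠ v := fun h => hxv (h ▸ hw)
  obtain ⟨y, hy, hyu, hyv⟩ := hS (Metric.thickening 1 (D.space v))
    (⋃ w' ∈ {w' | w' ≠ v}, Metric.thickening 1 (D.space w')) Metric.isOpen_thickening
    (isOpen_biUnion fun _ _ => Metric.isOpen_thickening)
    (fun y hy => by
      obtain ⟨w', hw'⟩ := hsub y hy
      by_cases h : w' = v
      · exact Or.inl (Metric.self_subset_thickening one_pos _ (h ▸ hw'))
      · exact Or.inr (Set.mem_biUnion h (Metric.self_subset_thickening one_pos _ hw')))
    ⟨x₀, hx₀, Metric.self_subset_thickening one_pos _ hv⟩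
    ⟨x, hx, Set.mem_biUnion hwv (Metric.self_subset_thickening one_pos _ hw)⟩
  obtain ⟨w', hw'⟩ := hsub y hy
  have key : ∀ u, y ∈ Metric.thickening 1 (D.space u) → w' = u := by
    intro u hu
    obtain ⟨z, hz, hd⟩ := Metric.mem_thickening_iff.1 hu
    by_contra h
    exact not_lt.2 (D.one_le_dist h hw' hz) hd
  obtain ⟨w'', hne, hyw⟩ := Set.mem_iUnion₂.1 hyv
  exact hne ((key w'' hyw).symm.trans (key v hyu))

theorem exists_subset_openEdge {S : Set X} (hS : IsPreconnected S) (hne : S.Nonempty)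
    (hsub : ∀ x ∈ S, ∀ v, x ∉ D.space v) : ∃ d, S ⊆ D.openEdge d := by
  obtain ⟨x₀, hx₀⟩ := hne
  obtain ⟨d, hd⟩ := D.exists_mem_openEdge (hsub x₀ hx₀)
  have hcase : ∀ d', d'.edge = d.edge → D.openEdge d' = D.openEdge d := by
    intro d' h
    rcases (SimpleGraph.dart_edge_eq_iff d' d).1 h with rfl | rfl
    · rfl
    · exact D.openEdge_symm d
  refine ⟨d, fun x hx => ?_⟩
  obtain ⟨d₁, hd₁⟩ := D.exists_mem_openEdge (hsub x hx)
  by_contra hxd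
  have hne : d₁.edge ≠ d.edge := fun h => hxd (hcase d₁ h ▸ hd₁)
  obtain ⟨y, hy, hyu, hyv⟩ := hS (D.openEdge d) (⋃ d' ∈ {d' | d'.edge ≠ d.edge}, D.openEdge d')
    (D.isOpen_openEdge d) (isOpen_biUnion fun d' _ => D.isOpen_openEdge d')
    (fun y hy => by
      obtain ⟨d', hd'⟩ := D.exists_mem_openEdge (hsub y hy)
      by_cases h : d'.edge = d.edge
      · exact Or.inl (hcase d' h ▸ hd')
      · exact Or.inr (Set.mem_biUnion h hd'))
    ⟨x₀, hx₀, hd⟩ ⟨x, hx, Set.mem_biUnion hne hd₁⟩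
  obtain ⟨d', hd', hyd'⟩ := Set.mem_iUnion₂.1 hyv
  exact hd' (D.edge_eq_of_mem_openEdge hyd' hyu)

/-- The decomposition is preserved by all isometries. -/
class IsInvariant : Prop where
  space : ∀ (g : X ≃ᵢ X) v, ∃ w, g '' D.space v = D.space w
  edge : ∀ (g : X ≃ᵢ X) d, ∃ d', ∀ t, g (D.edge d t) = D.edge d' t

/-- Isometries preserve the union of the vertex spaces and its complement. Connectedness sends each
piece into a single piece; closing up an edge leaves an isometry of the unit interval, which is the
identity or the flip. -/
theorem isInvariant (hN : ∃ x : X, ¬ IsLinearPoint x) : D.IsInvariant where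
  space g v := by
    have key : ∀ (g : X ≃ᵢ X) v, ∃ w, g '' D.space v ⊆ D.space w := by
      intro g v
      refine D.exists_subset_space ((D.isPreconnected_space v).image g g.continuous.continuousOn)
        ((D.space_nonempty v).image g) ?_
      rintro _ ⟨x, hx, rfl⟩
      exact (D.mem_space_apply_iff hN g x).2 ⟨v, hx⟩
    obtain ⟨w, hw⟩ := key g v
    obtain ⟨v', hv'⟩ := key g.symm w
    refine ⟨w, hw.antisymm fun y hy => ⟨g.symm y, ?_, by simp⟩⟩
    obtain ⟨x, hx⟩ := D.space_nonempty v
    have h1 : x ∈ D.space v' := hv' ⟨g x, hw ⟨x, hx, rfl⟩, by simp⟩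
    rw [D.eq_of_mem_space hx h1]
    exact hv' ⟨y, hy, rfl⟩
  edge g d := by
    obtain ⟨d', hd'⟩ := D.exists_subset_openEdge (S := g '' D.openEdge d)
      ((isPreconnected_Ioo.image (D.edge d) (D.edge_isometry d).continuous.continuousOn).image g
        g.continuous.continuousOn)
      (by
        let t : unitInterval := ⟨1 / 2, by norm_num, by norm_num⟩
        exact ⟨_, _, ⟨t, ⟨Subtype.mk_lt_mk.2 (by norm_num), Subtype.mk_lt_mk.2 (by norm_num)⟩, rfl⟩,
          rfl⟩)
      (by
        rintro _ ⟨x, hx, rfl⟩ v hv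
        obtain ⟨w, hw⟩ := (D.mem_space_apply_iff hN g x).1 ⟨v, hv⟩
        exact D.notMem_space_of_mem_openEdge hx w hw)
    have hrange : ∀ t, g (D.edge d t) ∈ Set.range (D.edge d') := by
      have hcl : IsClosed {t | g (D.edge d t) ∈ Set.range (D.edge d')} :=
        ((isCompact_range (D.edge_isometry d').continuous).isClosed).preimage
          (g.continuous.comp (D.edge_isometry d).continuous)
      have hsub : Set.Ioo (0 : unitInterval) 1 ⊆ {t | g (D.edge d t) ∈ Set.range (D.edge d')} := by
        intro t ht
        obtain ⟨s, -, hs⟩ := hd' ⟨_, ⟨t, ht, rfl⟩, rfl⟩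
        exact ⟨s, hs⟩
      have := hcl.closure_subset_iff.2 hsub
      rw [closure_Ioo (zero_ne_one)] at this
      intro t
      exact this ⟨t.2.1, t.2.2⟩
    choose φ hφ using hrange
    have hiso : Isometry φ := Isometry.of_dist_eq fun s t => by
      rw [← (D.edge_isometry d').dist_eq, hφ, hφ, g.dist_eq, (D.edge_isometry d).dist_eq]
    rcases unitInterval.isometry_eq hiso with h | h
    · exact ⟨d', fun t => by rw [← hφ, h]⟩
    · exact ⟨d'.symm, fun t => by rw [← hφ, h, D.edge_symm]⟩

end IdealTreeOfSpaces

/-! ### The graph of vertex spaces and attaching points, and gluing of isometries -/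

namespace IdealTreeOfSpaces

variable {X : Type u} [MetricSpace X] {D : IdealTreeOfSpaces.{u, u} X}

variable (D) in
/-- The points at which edges are attached. -/
def attach : Set X := Set.range fun d => D.edge d 0

theorem edge_zero_mem_attach (d : D.tree.Dart) : D.edge d 0 ∈ D.attach := ⟨d, rfl⟩

theorem edge_one_mem_attach (d : D.tree.Dart) : D.edge d 1 ∈ D.attach := ⟨d.symm, (D.edge_one_eq d).symm⟩

theorem exists_space_of_mem_attach {p : X} (hp : p ∈ D.attach) : ∃ v, p ∈ D.space v := by
  obtain ⟨d, rfl⟩ := hp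
  exact ⟨_, D.edge_zero_mem d⟩

theorem dart_ext {d d' : D.tree.Dart} (h0 : D.edge d 0 = D.edge d' 0)
    (h1 : D.edge d 1 = D.edge d' 1) : d = d' :=
  SimpleGraph.Dart.ext _ _ (Prod.ext
    (D.eq_of_mem_space (D.edge_zero_mem d) (h0 ▸ D.edge_zero_mem d'))
    (D.eq_of_mem_space (D.edge_one_mem d) (h1 ▸ D.edge_one_mem d')))

namespace IsInvariant

/-- The vertex whose space is the image of a given vertex space. -/
noncomputable def act (hD : D.IsInvariant) (g : X ≃ᵢ X) (v : D.V) : D.V := (hD.space g v).choose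

theorem image_space (hD : D.IsInvariant) (g : X ≃ᵢ X) (v : D.V) :
    g '' D.space v = D.space (hD.act g v) := (hD.space g v).choose_spec

theorem apply_mem_space (hD : D.IsInvariant) (g : X ≃ᵢ X) {v : D.V} {x : X} (hx : x ∈ D.space v) :
    g x ∈ D.space (hD.act g v) := by
  rw [← hD.image_space]
  exact ⟨x, hx, rfl⟩

theorem act_eq_of_mem (hD : D.IsInvariant) {g : X ≃ᵢ X} {v w : D.V} {x : X} (hx : x ∈ D.space v)
    (hw : g x ∈ D.space w) : hD.act g v = w :=
  D.eq_of_mem_space (hD.apply_mem_space g hx) hw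

theorem apply_mem_attach (hD : D.IsInvariant) (g : X ≃ᵢ X) {p : X} (hp : p ∈ D.attach) :
    g p ∈ D.attach := by
  obtain ⟨d, rfl⟩ := hp
  obtain ⟨d', hd'⟩ := hD.edge g d
  exact ⟨d', (hd' 0).symm⟩

/-- Isometries that agree at the ends of an edge agree on the edge. -/
theorem apply_edge_eq (hD : D.IsInvariant) {g g' : X ≃ᵢ X} {d : D.tree.Dart}
    (h0 : g (D.edge d 0) = g' (D.edge d 0)) (h1 : g (D.edge d 1) = g' (D.edge d 1))
    (t : unitInterval) : g (D.edge d t) = g' (D.edge d t) := by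
  obtain ⟨d₁, hd₁⟩ := hD.edge g d
  obtain ⟨d₂, hd₂⟩ := hD.edge g' d
  rw [hd₁, hd₂] at h0 h1 ⊢
  rw [dart_ext h0 h1]

end IsInvariant

variable (D) in
/-- The vertices of the graph in which each vertex space is joined to the points where edges are
attached to it, and the two ends of each edge are joined. -/
inductive Vert : Type u
  | vertex (v : D.V) : Vert
  | point (p : X) (hp : p ∈ D.attach) : Vert

open Vert

theorem point_congr {p q : X} (h : p = q) (hp : p ∈ D.attach) (hq : q ∈ D.attach) :
    (point p hp : D.Vert) = point q hq := by
  subst h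
  rfl

/-- Adjacency in the graph of vertex spaces and attaching points. -/
def Adj : D.Vert → D.Vert → Prop
  | vertex v, point p _ => p ∈ D.space v
  | point p _, vertex v => p ∈ D.space v
  | point p _, point q _ => ∃ d, D.edge d 0 = p ∧ D.edge d 1 = q
  | vertex _, vertex _ => False

theorem adj_symm (u w : D.Vert) (h : Adj u w) : Adj w u := by
  cases u with
  | vertex v =>
    cases w with
    | vertex v' => exact h
    | point p hp => exact h
  | point p hp =>
    cases w with
    | vertex v' => exact h
    | point q hq =>
      obtain ⟨d, h0, h1⟩ := h
      exact ⟨d.symm, by rw [← D.edge_one_eq, h1], by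
        rw [D.edge_one_eq, SimpleGraph.Dart.symm_symm, h0]⟩

theorem adj_irrefl (u : D.Vert) : ¬ Adj u u := by
  cases u with
  | vertex v => exact fun h => h
  | point p hp =>
    rintro ⟨d, h0, h1⟩
    exact zero_ne_one ((D.edge_isometry d).injective (h0.trans h1.symm))

theorem isTreeLike (D : IdealTreeOfSpaces.{u, u} X) (v₀ : D.V) :
    IsTreeLike (Adj (D := D)) (vertex v₀) where
  exists_section St R hsymm hext s₀ := by
    -- The choices at a vertex and at all its attaching points are bundled into one state, so that
    -- propagation over the original tree suffices.
    let St' : D.V → Type u := fun v =>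
      {s : St (vertex v) × (∀ p (hp : p ∈ D.attach), p ∈ D.space v → St (point p hp)) //
        ∀ p hp hv, R (vertex v) (point p hp) s.1 (s.2 p hp hv)}
    obtain ⟨σ, hσ0, hσ⟩ := (D.isTree.isTreeLike v₀).exists_section St'
      (fun v w s t => ∀ p hp hv q hq hw, (∃ d, D.edge d 0 = p ∧ D.edge d 1 = q) →
        R (point p hp) (point q hq) (s.1.2 p hp hv) (t.1.2 q hq hw))
      (fun v w s t _ h q hq hw p hp hv hd => by
        have hd' : Adj (D := D) (point p hp) (point q hq) := adj_symm (point q hq) (point p hp) hd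
        exact hsymm _ _ _ _ hd' (h p hp hv q hq hw hd'))
      (fun v w hvw s => by
        let d : D.tree.Dart := ⟨(v, w), hvw⟩
        obtain ⟨tq, htq⟩ := hext (point _ (edge_zero_mem_attach d)) (point _ (edge_one_mem_attach d))
          ⟨d, rfl, rfl⟩ (s.1.2 _ _ (D.edge_zero_mem d))
        obtain ⟨tw, htw⟩ := hext (point _ (edge_one_mem_attach d)) (vertex w) (D.edge_one_mem d) tq
        -- Only the far end of d is constrained by the state at v, since d is the only edge from v
        -- to w; every other attaching point is reached through w.
        have key : ∀ q (hq : q ∈ D.attach) (hw : q ∈ D.space w), ∃ t : St (point q hq),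
            R (vertex w) (point q hq) tw t ∧ ∀ p hp hv, (∃ d, D.edge d 0 = p ∧ D.edge d 1 = q) →
              R (point p hp) (point q hq) (s.1.2 p hp hv) t := by
          intro q hq hw
          by_cases h : q = D.edge d 1
          · subst h
            refine ⟨tq, hsymm _ _ _ _ (D.edge_one_mem d) htw, ?_⟩
            rintro p hp hv ⟨d', h0, h1⟩
            have hdd : d' = d := by
              refine SimpleGraph.Dart.ext _ _ (Prod.ext ?_ ?_)
              · exact D.eq_of_mem_space (D.edge_zero_mem d') (h0 ▸ hv)
              · exact D.eq_of_mem_space (D.edge_one_mem d') (h1 ▸ D.edge_one_mem d)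
            subst hdd
            subst h0
            exact htq
          · obtain ⟨t, ht⟩ := hext (vertex w) (point q hq) hw tw
            refine ⟨t, ht, ?_⟩
            rintro p hp hv ⟨d', h0, h1⟩
            refine (h ?_).elim
            rw [← h1]
            congr 1
            refine SimpleGraph.Dart.ext _ _ (Prod.ext ?_ ?_)
            · exact D.eq_of_mem_space (D.edge_zero_mem d') (h0 ▸ hv)
            · exact D.eq_of_mem_space (D.edge_one_mem d') (h1 ▸ hw)
        choose t ht1 ht2 using key
        exact ⟨⟨(tw, t), ht1⟩, fun p hp hv q hq hw hd => ht2 q hq hw p hp hv hd⟩)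
      ⟨(s₀, fun p hp hv => (hext (vertex v₀) (point p hp) hv s₀).choose),
        fun p hp hv => (hext (vertex v₀) (point p hp) hv s₀).choose_spec⟩
    choose vert hvert using fun p (hp : p ∈ D.attach) => exists_space_of_mem_attach hp
    refine ⟨fun u => match u with
      | vertex v => (σ v).1.1
      | point p hp => (σ (vert p hp)).1.2 p hp (hvert p hp), by simp [hσ0], ?_⟩
    have hvp : ∀ v p hp, p ∈ D.space v →
        R (vertex v) (point p hp) (σ v).1.1 ((σ (vert p hp)).1.2 p hp (hvert p hp)) := by
      intro v p hp hv
      obtain rfl := D.eq_of_mem_space hv (hvert p hp)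
      exact (σ _).2 p hp _
    intro u w huw
    cases u with
    | vertex v =>
      cases w with
      | vertex v' => exact huw.elim
      | point p hp => exact hvp v p hp huw
    | point p hp =>
      cases w with
      | vertex v' => exact hsymm _ _ _ _ huw (hvp v' p hp huw)
      | point q hq =>
        obtain ⟨d, h0, h1⟩ := huw
        have e0 : d.fst = vert p hp := D.eq_of_mem_space (D.edge_zero_mem d) (by
          rw [h0]
          exact hvert p hp)
        have e1 : d.snd = vert q hq := D.eq_of_mem_space (D.edge_one_mem d) (by
          rw [h1]
          exact hvert q hq)
        have hadj : D.tree.Adj (vert p hp) (vert q hq) := by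
          rw [← e0, ← e1]
          exact d.adj
        exact hσ _ _ hadj p hp _ q hq _ ⟨d, h0, h1⟩
  induction P h0 hstep := by
    have hv : ∀ v, P (vertex v) := by
      refine (D.isTree.isTreeLike v₀).induction _ h0 fun v w hvw h => ?_
      let d : D.tree.Dart := ⟨(v, w), hvw⟩
      have h1 := hstep (vertex v) (point _ (edge_zero_mem_attach d)) (D.edge_zero_mem d) h
      have h2 := hstep (point _ (edge_zero_mem_attach d)) (point _ (edge_one_mem_attach d))
        ⟨d, rfl, rfl⟩ h1
      exact hstep (point _ (edge_one_mem_attach d)) (vertex w) (D.edge_one_mem d) h2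
    intro u
    cases u with
    | vertex v => exact hv v
    | point p hp =>
      obtain ⟨v, hpv⟩ := exists_space_of_mem_attach hp
      exact hstep (vertex v) (point p hp) hpv (hv v)

variable [hD : D.IsInvariant]

noncomputable instance : MulAction (X ≃ᵢ X) D.Vert where
  smul g u := match u with
    | vertex v => vertex (hD.act g v)
    | point p hp => point (g p) (hD.apply_mem_attach g hp)
  one_smul u := by
    cases u with
    | vertex v =>
      refine congrArg vertex (D.space_injective ?_)
      rw [← hD.image_space]
      exact Set.image_id _
    | point p hp => rfl
  mul_smul g h u := by
    cases u with
    | vertex v =>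
      refine congrArg vertex (D.space_injective ?_)
      rw [← hD.image_space, ← hD.image_space, ← hD.image_space, ← Set.image_comp]
      rfl
    | point p hp => rfl

theorem smul_vertex (g : X ≃ᵢ X) (v : D.V) :
    g • (vertex v : D.Vert) = vertex (hD.act g v) := rfl

theorem smul_point (g : X ≃ᵢ X) {p : X} (hp : p ∈ D.attach) :
    g • (point p hp : D.Vert) = point (g p) (hD.apply_mem_attach g hp) := rfl

theorem adj_smul_iff (g : X ≃ᵢ X) (u w : D.Vert) : Adj (g • u) (g • w) ↔ Adj u w := by
  have key : ∀ (g : X ≃ᵢ X) (u w : D.Vert), Adj u w → Adj (g • u) (g • w) := by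
    intro g u w h
    cases u with
    | vertex v =>
      cases w with
      | vertex v' => exact h
      | point p hp => exact hD.apply_mem_space g h
    | point p hp =>
      cases w with
      | vertex v' => exact hD.apply_mem_space g h
      | point q hq =>
        obtain ⟨d, h0, h1⟩ := h
        obtain ⟨d', hd'⟩ := hD.edge g d
        exact ⟨d', by rw [← hd', h0], by rw [← hd', h1]⟩
  refine ⟨fun h => ?_, key g u w⟩
  have := key g⁻¹ _ _ h
  rwa [inv_smul_smul, inv_smul_smul] at this

/-- The map of `X` glued from isometries that agree on edges. -/
theorem exists_glueMap (h : D.Vert → X ≃ᵢ X)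
    (hh : ∀ u w, Adj u w → h u • u = h w • u ∧ h u • w = h w • w) :
    ∃ f : X → X, (∀ v, ∀ x ∈ D.space v, f x = h (vertex v) x) ∧
      (∀ d t, f (D.edge d t) = h (point _ (edge_zero_mem_attach d)) (D.edge d t)) ∧
      ∀ x y, dist (f x) (f y) ≤ dist x y := by
  obtain ⟨f, hf1, hf2⟩ := D.exists_glue (fun v x => h (vertex v) x)
    (fun d t => h (point _ (edge_zero_mem_attach d)) (D.edge d t))
    (fun d => by
      have := (hh (vertex d.fst) (point _ (edge_zero_mem_attach d)) (D.edge_zero_mem d)).2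
      exact (Vert.point.inj this).symm)
    (fun d t => by
      have h1 := hh (point _ (edge_zero_mem_attach d)) (point _ (edge_zero_mem_attach d.symm))
        ⟨d, rfl, D.edge_one_eq d⟩
      have h2 := Vert.point.inj h1.1
      have h3 := Vert.point.inj h1.2
      have h4 := (congrArg (h (point _ (edge_zero_mem_attach d))) (D.edge_one_eq d)).trans
        (h3.trans (congrArg (h (point _ (edge_zero_mem_attach d.symm))) (D.edge_one_eq d)).symm)
      exact (congrArg _ (D.edge_symm d t)).trans (hD.apply_edge_eq h2 h4 _).symm)
  refine ⟨f, hf1, hf2, D.dist_le_of_pieces f ?_ ?_⟩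
  · intro v x hx y hy
    rw [hf1 v x hx, hf1 v y hy, (h (vertex v)).dist_eq]
  · intro d s t
    rw [hf2, hf2, (h _).dist_eq, (D.edge_isometry d).dist_eq]

theorem glueMap_leftInverse {h k : D.Vert → X ≃ᵢ X} (hk : ∀ u, k (h u • u) = (h u)⁻¹)
    {f f' : X → X} (hf1 : ∀ v, ∀ x ∈ D.space v, f x = h (vertex v) x)
    (hf2 : ∀ d t, f (D.edge d t) = h (point _ (edge_zero_mem_attach d)) (D.edge d t))
    (hf1' : ∀ v, ∀ x ∈ D.space v, f' x = k (vertex v) x)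
    (hf2' : ∀ d t, f' (D.edge d t) = k (point _ (edge_zero_mem_attach d)) (D.edge d t)) (x : X) :
    f' (f x) = x := by
  rcases D.cover x with ⟨v, hv⟩ | ⟨d, t, rfl⟩
  · have h1 := hk (vertex v)
    rw [hf1 v x hv, hf1' _ _ (hD.apply_mem_space (h (vertex v)) hv), ← smul_vertex, h1]
    exact (h (vertex v)).symm_apply_apply x
  · have h1 := hk (point _ (edge_zero_mem_attach d))
    obtain ⟨d', hd'⟩ := hD.edge (h (point _ (edge_zero_mem_attach d))) d
    rw [smul_point, point_congr (hd' 0) _ (edge_zero_mem_attach d')] at h1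
    rw [hf2, hd', hf2', h1, ← hd']
    exact (h _).symm_apply_apply _

/-- The inverse local isometries, indexed through the induced permutation of the graph, also agree
along edges. The two glued maps are mutually inverse and neither increases distances, hence both are
isometries. -/
theorem exists_isometry_glue (h : D.Vert → X ≃ᵢ X)
    (hh : ∀ u w, Adj u w → h u • u = h w • u ∧ h u • w = h w • w)
    (hbij : Function.Bijective fun u => h u • u) : ∃ g : X ≃ᵢ X, ∀ u, g • u = h u • u := by
  let φ : D.Vert ≃ D.Vert := Equiv.ofBijective _ hbij
  have hφ : ∀ u, φ u = h u • u := fun u => rfl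
  let k : D.Vert → X ≃ᵢ X := fun u => (h (φ.symm u))⁻¹
  have hk : ∀ u, k (h u • u) = (h u)⁻¹ := by
    intro u
    simp only [k]
    rw [← hφ, φ.symm_apply_apply]
  have hk' : ∀ u, h (k u • u) = (k u)⁻¹ := by
    intro u
    obtain ⟨a, rfl⟩ := φ.surjective u
    rw [hφ, hk, inv_smul_smul, inv_inv]
  have hkk : ∀ u w, Adj u w → k u • u = k w • u ∧ k u • w = k w • w := by
    intro u w huw
    obtain ⟨a, rfl⟩ := φ.surjective u
    obtain ⟨b, rfl⟩ := φ.surjective w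
    have hab : Adj a b := by
      have h1 : Adj a ((h a)⁻¹ • φ b) := by
        rw [← adj_smul_iff (h a), smul_inv_smul]
        exact huw
      have h2 : φ ((h a)⁻¹ • φ b) = φ b := by
        rw [hφ, ← (hh _ _ h1).2, smul_inv_smul]
      rwa [φ.injective h2] at h1
    rw [hφ, hφ, hk, hk]
    refine ⟨?_, ?_⟩
    · rw [(hh a b hab).1, inv_smul_smul, ← (hh a b hab).1, inv_smul_smul]
    · rw [← (hh a b hab).2, inv_smul_smul, (hh a b hab).2, inv_smul_smul]
  obtain ⟨f, hf1, hf2, hf3⟩ := exists_glueMap h hh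
  obtain ⟨f', hf1', hf2', hf3'⟩ := exists_glueMap k hkk
  have hl : ∀ x, f' (f x) = x := glueMap_leftInverse hk hf1 hf2 hf1' hf2'
  have hr : ∀ x, f (f' x) = x := glueMap_leftInverse hk' hf1' hf2' hf1 hf2
  let g : X ≃ᵢ X := ⟨⟨f, f', hl, hr⟩, Isometry.of_dist_eq fun x y => le_antisymm (hf3 x y) (by
    have := hf3' (f x) (f y)
    rwa [hl, hl] at this)⟩
  have hg : ∀ x, g x = f x := fun x => rfl
  refine ⟨g, fun u => ?_⟩
  cases u with
  | vertex v =>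
    obtain ⟨x, hx⟩ := D.space_nonempty v
    rw [smul_vertex, smul_vertex]
    refine congrArg vertex (hD.act_eq_of_mem hx ?_)
    rw [hg, hf1 v x hx]
    exact hD.apply_mem_space _ hx
  | point p hp =>
    rw [smul_point, smul_point]
    refine point_congr ?_ _ _
    obtain ⟨d, rfl⟩ := hp
    exact hf2 d 0

end IdealTreeOfSpaces

/-! ### Finiteness of the local data -/

namespace IdealTreeOfSpaces

variable {X : Type u} [MetricSpace X] {D : IdealTreeOfSpaces.{u, u} X}

theorem finite_attach_inter [ProperSpace X] (x : X) (R : ℝ) :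
    (D.attach ∩ Metric.closedBall x R).Finite := by
  refine ((D.finite_darts x R).image fun d => D.edge d 0).subset ?_
  rintro _ ⟨⟨d, rfl⟩, h⟩
  exact ⟨d, h, rfl⟩

variable [hD : D.IsInvariant]

open Vert

/-- The attaching points are coarsely dense in the vertex spaces. -/
theorem exists_attach_near [ProperSpace X] {x₀ : X} {R : ℝ}
    (hco : ∀ x, ∃ g : X ≃ᵢ X, dist (g x) x₀ ≤ R) (hdart : ∀ v, ∃ d : D.tree.Dart, d.fst = v) :
    ∃ C : ℝ, ∀ v, ∀ x ∈ D.space v, ∃ p ∈ D.attach, p ∈ D.space v ∧ dist x p ≤ C := by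
  have hp : ∀ v, ∃ p ∈ D.attach, p ∈ D.space v := by
    intro v
    obtain ⟨d, rfl⟩ := hdart v
    exact ⟨_, edge_zero_mem_attach d, D.edge_zero_mem d⟩
  choose p hpa hps using hp
  -- Only finitely many vertex spaces meet the ball that contains a translate of every point, so one
  -- bound serves all.
  obtain ⟨C, hC⟩ := ((D.finite_vertices x₀ R).image fun v => dist x₀ (p v)).bddAbove
  refine ⟨R + C, fun v x hx => ?_⟩
  obtain ⟨g, hg⟩ := hco x
  have hw : hD.act g v ∈ {v | (D.space v ∩ Metric.closedBall x₀ R).Nonempty} :=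
    ⟨g x, hD.apply_mem_space g hx, hg⟩
  have hC' : dist x₀ (p (hD.act g v)) ≤ C := hC ⟨_, hw, rfl⟩
  have hv : hD.act g⁻¹ (hD.act g v) = v :=
    hD.act_eq_of_mem (hD.apply_mem_space g hx) (by
      rw [IsometryEquiv.inv_apply_self]
      exact hx)
  refine ⟨g⁻¹ (p (hD.act g v)), hD.apply_mem_attach _ (hpa _), ?_, ?_⟩
  · have := hD.apply_mem_space g⁻¹ (hps (hD.act g v))
    rwa [hv] at this
  · rw [← g.dist_eq, IsometryEquiv.apply_inv_self]
    exact (dist_triangle _ x₀ _).trans (add_le_add hg hC')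

/-- A vertex space contains finitely many attaching points such that an isometry fixing these fixes
the whole vertex space. -/
theorem exists_finite_fixing_space [ProperSpace X] {x₀ : X} {R : ℝ}
    (hco : ∀ x, ∃ g : X ≃ᵢ X, dist (g x) x₀ ≤ R) (hdart : ∀ v, ∃ d : D.tree.Dart, d.fst = v)
    (v : D.V) : ∃ F : Set X, F.Finite ∧ F.Nonempty ∧ F ⊆ D.attach ∧ F ⊆ D.space v ∧
      ∀ g : X ≃ᵢ X, (∀ a ∈ F, g a = a) → ∀ x ∈ D.space v, g x = x := by
  obtain ⟨C, hC⟩ := exists_attach_near hco hdart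
  obtain ⟨d, hd⟩ := hdart v
  have hp : D.edge d 0 ∈ D.space v := hd ▸ D.edge_zero_mem d
  rcases D.space_spec v with ⟨x, hx⟩ | hs
  · refine ⟨{D.edge d 0}, Set.finite_singleton _, Set.singleton_nonempty _,
      Set.singleton_subset_iff.2 (edge_zero_mem_attach d), Set.singleton_subset_iff.2 hp, ?_⟩
    intro g hg y hy
    rw [hx] at hp hy
    rw [Set.mem_singleton_iff.1 hy, ← Set.mem_singleton_iff.1 hp]
    exact hg _ rfl
  · obtain ⟨F, hF, hFA, hres⟩ := hs.exists_finite_resolving (A := {s | s.1 ∈ D.attach}) (D := C)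
      (fun s => by
        obtain ⟨p, hpa, hps, hd⟩ := hC v s.1 s.2
        exact ⟨⟨p, hps⟩, hpa, hd⟩)
    refine ⟨insert (D.edge d 0) (Subtype.val '' F), (hF.image _).insert _,
      Set.insert_nonempty _ _, Set.insert_subset (edge_zero_mem_attach d) ?_,
      Set.insert_subset hp ?_, ?_⟩
    · rintro _ ⟨s, hs, rfl⟩
      exact hFA hs
    · rintro _ ⟨s, hs, rfl⟩
      exact s.2
    · intro g hg x hx
      -- The extra attaching point forces g to preserve the vertex space; distances to `F` then
      -- determine g on it.
      have hv : hD.act g v = v := hD.act_eq_of_mem hp (by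
        rw [hg _ (Set.mem_insert _ _)]
        exact hp)
      have hgx : g x ∈ D.space v := by
        have := hD.apply_mem_space g hx
        rwa [hv] at this
      have := hres ⟨g x, hgx⟩ ⟨x, hx⟩ (fun a ha => by
        have h1 := hg a (Set.mem_insert_of_mem _ ⟨a, ha, rfl⟩)
        change dist (g x) a = dist x a
        rw [← g.dist_eq x, h1])
      exact congrArg Subtype.val this

theorem eq_one_of_smul_eq [ProperSpace X] {x₀ : X} {R : ℝ}
    (hco : ∀ x, ∃ g : X ≃ᵢ X, dist (g x) x₀ ≤ R) (hdart : ∀ v, ∃ d : D.tree.Dart, d.fst = v)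
    (g : X ≃ᵢ X) (hg : ∀ u : D.Vert, g • u = u) : g = 1 := by
  have ha : ∀ p ∈ D.attach, g p = p := fun p hp => Vert.point.inj (hg (point p hp))
  ext x
  rcases D.cover x with ⟨v, hv⟩ | ⟨d, t, rfl⟩
  · obtain ⟨F, -, -, hF, -, hfix⟩ := exists_finite_fixing_space hco hdart v
    exact hfix g (fun a h => ha a (hF h)) x hv
  · exact hD.apply_edge_eq (g' := 1) (ha _ (edge_zero_mem_attach d)) (ha _ (edge_one_mem_attach d)) t

/-- The action of an isometry on a star is determined by the images of finitely many attaching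
points. -/
theorem exists_finite_determining [ProperSpace X] {x₀ : X} {R : ℝ}
    (hco : ∀ x, ∃ g : X ≃ᵢ X, dist (g x) x₀ ≤ R) (hdart : ∀ v, ∃ d : D.tree.Dart, d.fst = v)
    (u : D.Vert) : ∃ F : Set X, F.Finite ∧ F.Nonempty ∧ F ⊆ D.attach ∧
      ∀ h k : X ≃ᵢ X, (∀ a ∈ F, h a = k a) → ∀ w ∈ starBall Adj u, h • w = k • w := by
  suffices H : ∃ F : Set X, F.Finite ∧ F.Nonempty ∧ F ⊆ D.attach ∧
      ∀ g : X ≃ᵢ X, (∀ a ∈ F, g a = a) → ∀ w ∈ starBall Adj u, g • w = w by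
    obtain ⟨F, h1, h2, h3, H⟩ := H
    refine ⟨F, h1, h2, h3, fun h k hhk w hw => ?_⟩
    have := H (k⁻¹ * h) (fun a ha => by
      rw [IsometryEquiv.mul_apply, hhk a ha, IsometryEquiv.inv_apply_self]) w hw
    rwa [mul_smul, inv_smul_eq_iff] at this
  cases u with
  | vertex v =>
    obtain ⟨F, h1, ⟨a, ha⟩, h3, h4, hfix⟩ := exists_finite_fixing_space hco hdart v
    refine ⟨F, h1, ⟨a, ha⟩, h3, fun g hg w hw => ?_⟩
    rcases hw with rfl | hw
    · exact congrArg vertex (hD.act_eq_of_mem (h4 ha) (by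
        rw [hg a ha]
        exact h4 ha))
    · cases w with
      | vertex v' => exact hw.elim
      | point p hp => exact point_congr (hfix g hg p hw) _ _
  | point p hp =>
    -- The ball of radius 0 selects the finitely many edges attached at p itself.
    refine ⟨insert p ((fun d => D.edge d 1) '' {d | D.edge d 0 ∈ Metric.closedBall p 0}),
      ((D.finite_darts p 0).image _).insert _, Set.insert_nonempty _ _,
      Set.insert_subset hp ?_, fun g hg w hw => ?_⟩
    · rintro _ ⟨d, -, rfl⟩
      exact edge_one_mem_attach d
    · have hgp := hg p (Set.mem_insert _ _)
      rcases hw with rfl | hw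
      · exact point_congr hgp _ _
      · cases w with
        | vertex v =>
          refine congrArg vertex (hD.act_eq_of_mem hw ?_)
          rw [hgp]
          exact hw
        | point q hq =>
          obtain ⟨d, h0, h1⟩ := hw
          refine point_congr (hg q (Set.mem_insert_of_mem _ ⟨d, ?_, h1⟩)) _ _
          simp [h0]

/-- Left translation by `Γ` brings the image of one determining point near x₀. The images of the
others are then attaching points in a fixed ball, which leaves finitely many possibilities. -/
theorem finite_agreeQuotient [ProperSpace X] {x₀ : X} {R : ℝ} {Γ : Subgroup (X ≃ᵢ X)}
    (hco : ∀ x, ∃ g ∈ Γ, dist (g x) x₀ ≤ R) (hdart : ∀ v, ∃ d : D.tree.Dart, d.fst = v)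
    (u : D.Vert) : Finite (AgreeQuotient Γ (starBall Adj u)) := by
  obtain ⟨F, hF, ⟨a₀, ha₀⟩, hFa, hdet⟩ := exists_finite_determining
    (fun x => (hco x).imp fun g h => h.2) hdart u
  obtain ⟨C, hC⟩ := (hF.image fun a => dist a a₀).bddAbove
  choose c hcΓ hc using hco
  have : Finite F := hF
  have hfin := finite_attach_inter (D := D) x₀ (C + R)
  have : Finite (D.attach ∩ Metric.closedBall x₀ (C + R) : Set X) := hfin
  let φ : AgreeQuotient Γ (starBall Adj u) → F → (D.attach ∩ Metric.closedBall x₀ (C + R) : Set X) :=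
    fun q a => ⟨c (q.out a₀) (q.out a), hD.apply_mem_attach _ (hD.apply_mem_attach _ (hFa a.2)), by
      rw [Metric.mem_closedBall]
      refine (dist_triangle _ (c (q.out a₀) (q.out a₀)) _).trans (add_le_add ?_ (hc _))
      rw [(c _).dist_eq, q.out.dist_eq]
      exact hC ⟨a, a.2, rfl⟩⟩
  refine Finite.of_injective φ fun q r hqr => ?_
  rw [← q.out_eq, ← r.out_eq]
  refine AgreeQuotient.mk_eq.2 ⟨(c (r.out a₀))⁻¹ * c (q.out a₀),
    Γ.mul_mem (Γ.inv_mem (hcΓ _)) (hcΓ _), fun w hw => ?_⟩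
  have h := hdet (c (r.out a₀) * r.out) (c (q.out a₀) * q.out)
    (fun a ha => (congrArg Subtype.val (congrFun hqr ⟨a, ha⟩)).symm) w hw
  rw [mul_smul, mul_smul] at h
  rw [mul_smul, ← h, inv_smul_smul]

theorem exists_finite_orbit_representatives [ProperSpace X] {x₀ : X} {R : ℝ}
    (hco : ∀ x, ∃ g : X ≃ᵢ X, dist (g x) x₀ ≤ R) :
    ∃ F : Set D.Vert, F.Finite ∧ ∀ u, ∃ g : X ≃ᵢ X, g • u ∈ F := by
  refine ⟨vertex '' {v | (D.space v ∩ Metric.closedBall x₀ R).Nonempty} ∪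
    (fun d => point _ (edge_zero_mem_attach d)) '' {d | D.edge d 0 ∈ Metric.closedBall x₀ R},
    ((D.finite_vertices x₀ R).image _).union ((D.finite_darts x₀ R).image _), fun u => ?_⟩
  cases u with
  | vertex v =>
    obtain ⟨x, hx⟩ := D.space_nonempty v
    obtain ⟨g, hg⟩ := hco x
    exact ⟨g, Or.inl ⟨_, ⟨g x, hD.apply_mem_space g hx, hg⟩, rfl⟩⟩
  | point p hp =>
    obtain ⟨g, hg⟩ := hco p
    obtain ⟨d, hd⟩ := hD.apply_mem_attach g hp
    refine ⟨g, Or.inr ⟨d, ?_, point_congr hd _ _⟩⟩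
    change D.edge d 0 ∈ Metric.closedBall x₀ R
    rw [show D.edge d 0 = g p from hd]
    exact hg

end IdealTreeOfSpaces

/-! ### Uniform lattices and finite-index subgroups -/

section Lattices

variable {X : Type*} [MetricSpace X] {Γ Δ : Subgroup (X ≃ᵢ X)} {x₀ : X} {R : ℝ}

/-- The cosets represented by isometries moving x₀ less than n form an increasing open cover of the
compact quotient, so one n suffices. This bounds the cost of replacing an isometry by an element of
`Γ`. -/
theorem IsUniformLattice.exists_cocompact (hΓ : IsUniformLattice Γ)
    (hco : ∀ x, ∃ g : X ≃ᵢ X, dist (g x) x₀ ≤ R) :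
    ∃ R' : ℝ, ∀ x, ∃ g ∈ Γ, dist (g x) x₀ ≤ R' := by
  have := hΓ.2
  let V : ℕ → Set ((X ≃ᵢ X) ⧸ Γ) := fun n => QuotientGroup.mk '' {g | dist (g x₀) x₀ < n}
  have hcont : ∀ y : X, Continuous fun g : X ≃ᵢ X => g y := fun y =>
    (continuous_apply y).comp continuous_induced_dom
  have hV : ∀ n, IsOpen (V n) := by
    intro n
    have h1 : IsOpen (⋃ c ∈ Γ, {g : X ≃ᵢ X | dist (g (c x₀)) x₀ < n}) :=
      isOpen_biUnion fun c _ => isOpen_lt ((hcont _).dist continuous_const) continuous_const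
    refine isOpen_coinduced.2 ?_
    convert h1 using 1
    ext g
    simp only [V, Set.mem_preimage, Set.mem_image, Set.mem_ofPred_eq, Set.mem_iUnion, exists_prop]
    constructor
    · rintro ⟨k, hk, hkg⟩
      refine ⟨g⁻¹ * k, QuotientGroup.eq.1 hkg.symm, ?_⟩
      rw [IsometryEquiv.mul_apply, IsometryEquiv.apply_inv_self]
      exact hk
    · rintro ⟨c, hc, hgc⟩
      exact ⟨g * c, hgc, QuotientGroup.mk_mul_of_mem g hc⟩
  obtain ⟨N, hN⟩ := isCompact_univ.elim_directed_cover V hV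
    (fun q _ => by
      obtain ⟨g, rfl⟩ := QuotientGroup.mk_surjective q
      obtain ⟨n, hn⟩ := exists_nat_gt (dist (g x₀) x₀)
      exact Set.mem_iUnion.2 ⟨n, g, hn, rfl⟩)
    (Monotone.directed_le fun m n hmn => Set.image_mono fun g hg =>
      lt_of_lt_of_le (show dist (g x₀) x₀ < m from hg) (Nat.cast_le.2 hmn))
  refine ⟨R + N, fun x => ?_⟩
  obtain ⟨h, hh⟩ := hco x
  obtain ⟨k, hk, hkh⟩ := hN (Set.mem_univ (h : (X ≃ᵢ X) ⧸ Γ))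
  refine ⟨k⁻¹ * h, QuotientGroup.eq.1 hkh, ?_⟩
  have h1 : dist ((k⁻¹ * h) x) (k⁻¹ x₀) ≤ R := by
    rw [IsometryEquiv.mul_apply, k⁻¹.dist_eq]
    exact hh
  have h2 : dist (k⁻¹ x₀) x₀ < N := by
    rw [← k.dist_eq, IsometryEquiv.apply_inv_self, dist_comm]
    exact hk
  exact (dist_triangle _ _ _).trans (add_le_add h1 h2.le)

/-- A discrete group of isometries is separated on a finite set. -/
theorem exists_finset_separating (hΓ : DiscreteTopology Γ) : ∃ (F : Finset X) (ε : ℝ), 0 < ε ∧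
    ∀ g ∈ Γ, (∀ y ∈ F, dist (g y) y < ε) → g = 1 := by
  obtain ⟨O, hO, hO1⟩ := isOpen_induced_iff.1 (isOpen_discrete ({1} : Set Γ))
  obtain ⟨W, hW, rfl⟩ := isOpen_induced_iff.1 hO
  have h1 : (1 : Γ) ∈ Subtype.val ⁻¹' ((fun (g : X ≃ᵢ X) x => g x) ⁻¹' W) := by
    rw [hO1]
    rfl
  obtain ⟨F, U, hU, hFU⟩ := isOpen_pi_iff.1 hW _ h1
  have hε : ∀ᶠ ε in 𝓝[>] (0 : ℝ), ∀ y ∈ F, Metric.ball y ε ⊆ U y := by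
    refine (Filter.eventually_all_finset F).2 fun y hy => ?_
    obtain ⟨ε, hε, hball⟩ := Metric.isOpen_iff.1 (hU y hy).1 y (hU y hy).2
    filter_upwards [Ioo_mem_nhdsGT hε] with δ hδ
    exact (Metric.ball_subset_ball hδ.2.le).trans hball
  obtain ⟨ε, hε, hpos⟩ := (hε.and self_mem_nhdsWithin).exists
  refine ⟨F, ε, hpos, fun g hg hgF => ?_⟩
  have h2 : (⟨g, hg⟩ : Γ) ∈ Subtype.val ⁻¹' ((fun (g : X ≃ᵢ X) x => g x) ⁻¹' W) :=
    hFU fun y hy => hε y hy (hgF y hy)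
  rw [hO1] at h2
  exact congrArg Subtype.val h2

/-- Evaluation on a finite separating set embeds `Γ` as a uniformly separated family in a finite
power of X, which is proper. -/
theorem finite_setOf_dist_le [ProperSpace X] (hΓ : DiscreteTopology Γ) (x : X) (r : ℝ) :
    {g : Γ | dist (g.1 x) x ≤ r}.Finite := by
  obtain ⟨F, ε, hε, hF⟩ := exists_finset_separating hΓ
  obtain ⟨C, hC⟩ := ((F.finite_toSet).image fun y => dist y x).bddAbove
  refine (finite_setOf_mem_closedBall (fun (g : Γ) (y : F) => g.1 y) hε ?_
    (fun y : F => (y : X)) (max 0 (2 * C + r))).subset ?_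
  · intro g h hgh
    by_contra! hlt
    refine hgh (Subtype.ext ?_)
    have := hF (h.1⁻¹ * g.1) (Γ.mul_mem (Γ.inv_mem h.2) g.2) fun y hy => by
      rw [← h.1.dist_eq, IsometryEquiv.mul_apply, IsometryEquiv.apply_inv_self]
      exact (dist_le_pi_dist (fun (y : F) => g.1 y) (fun (y : F) => h.1 y) ⟨y, hy⟩).trans_lt hlt
    exact (inv_mul_eq_one.1 this).symm
  · intro g hg
    rw [Set.mem_ofPred_eq] at hg
    rw [Set.mem_ofPred_eq, Metric.mem_closedBall, dist_pi_le_iff (le_max_left _ _)]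
    intro y
    refine le_max_of_le_right ?_
    have h1 : dist (y : X) x ≤ C := hC ⟨y, y.2, rfl⟩
    have h2 := dist_triangle4 (g.1 y) (g.1 x) x y
    rw [g.1.dist_eq, dist_comm x] at h2
    linarith

/-- A residually finite lattice has a subgroup of finite index whose nontrivial elements have large
displacement. -/
theorem exists_displacement_gt (hrf : Group.ResiduallyFinite Γ)
    (hprop : ∀ r, {g : Γ | dist (g.1 x₀) x₀ ≤ r}.Finite)
    (hco : ∀ x, ∃ g ∈ Γ, dist (g x) x₀ ≤ R) (L : ℝ) :
    ∃ Γ₀ ≤ Γ, Γ₀.relIndex Γ ≠ 0 ∧ ∀ g ∈ Γ₀, g ≠ 1 → ∀ x, L < dist (g x) x := by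
  have hN : ∀ g : Γ, ∃ N : Subgroup Γ, N.Normal ∧ N.FiniteIndex ∧ (g ≠ 1 → g ∉ N) := by
    intro g
    by_cases hg : g = 1
    · exact ⟨⊤, inferInstance, inferInstance, fun h => (h hg).elim⟩
    · obtain ⟨N, hN⟩ := Group.exists_finiteIndexNormalSubgroup_notMem g hg
      exact ⟨N.toSubgroup, inferInstance, inferInstance, fun _ => hN⟩
  choose N hnorm hfin hnot using hN
  -- An element moving some x by at most L has a conjugate in S, obtained by carrying x to within R
  -- of x₀. Normality lets the finite intersection of subgroups exclude it.
  let S : Set Γ := {g : Γ | dist (g.1 x₀) x₀ ≤ R + L + R}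
  have : Finite S := hprop _
  let M : Subgroup Γ := ⨅ s : S, N s
  have hM : M.FiniteIndex := Subgroup.finiteIndex_iInf fun s => hfin s
  refine ⟨M.map Γ.subtype, Subgroup.map_subtype_le M, ?_, ?_⟩
  · rw [Subgroup.relIndex, Subgroup.subgroupOf,
      Subgroup.comap_map_eq_self_of_injective Γ.subtype_injective]
    exact hM.index_ne_zero
  · rintro _ ⟨g, hg, rfl⟩ hg1 x
    by_contra! hle
    obtain ⟨c, hc, hcx⟩ := hco x
    let c' : Γ := ⟨c, hc⟩
    have h1 : dist ((c * g.1 * c⁻¹) x₀) ((c * g.1) x) ≤ R := by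
      rw [IsometryEquiv.mul_apply, (c * g.1).dist_eq, ← c.dist_eq, IsometryEquiv.apply_inv_self,
        dist_comm]
      exact hcx
    have h2 : dist ((c * g.1) x) (c x) ≤ L := by
      rw [IsometryEquiv.mul_apply, c.dist_eq]
      exact hle
    have hS : c' * g * c'⁻¹ ∈ S :=
      (dist_triangle4 _ _ _ _).trans (add_le_add (add_le_add h1 h2) hcx)
    have hne : c' * g * c'⁻¹ ≠ 1 := by
      rw [Ne, conj_eq_one_iff]
      rintro rfl
      exact hg1 rfl
    refine hnot _ hne ((hnorm _).conj_mem g ?_ c')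
    exact (Subgroup.mem_iInf.1 hg) ⟨_, hS⟩

theorem exists_cocompact_of_relIndex_ne_zero (hΔ : Δ.relIndex Γ ≠ 0)
    (hco : ∀ x, ∃ g ∈ Γ, dist (g x) x₀ ≤ R) : ∃ R' : ℝ, ∀ x, ∃ g ∈ Δ, dist (g x) x₀ ≤ R' := by
  have : (Δ.subgroupOf Γ).FiniteIndex := ⟨hΔ⟩
  obtain ⟨C, hC⟩ := (Set.finite_range fun q : Γ ⧸ Δ.subgroupOf Γ =>
    dist (q.out.1⁻¹ x₀) x₀).bddAbove
  refine ⟨R + C, fun x => ?_⟩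
  obtain ⟨g, hg, hgx⟩ := hco x
  let q : Γ ⧸ Δ.subgroupOf Γ := QuotientGroup.mk ⟨g, hg⟩
  refine ⟨q.out.1⁻¹ * g, ?_, ?_⟩
  · have : q.out⁻¹ * ⟨g, hg⟩ ∈ Δ.subgroupOf Γ := QuotientGroup.eq.1 (QuotientGroup.out_eq' q)
    exact this
  · refine (dist_triangle _ (q.out.1⁻¹ x₀) _).trans (add_le_add ?_ (hC ⟨q, rfl⟩))
    rw [IsometryEquiv.mul_apply, IsometryEquiv.dist_eq]
    exact hgx

/-- Cocompactness of `Δ` gives every coset a representative moving x₀ by at most R, and there are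
only finitely many such elements. -/
theorem relIndex_ne_zero_of_cocompact (hle : Δ ≤ Γ) (hprop : ∀ r, {g : Γ | dist (g.1 x₀) x₀ ≤ r}.Finite)
    (hco : ∀ x, ∃ g ∈ Δ, dist (g x) x₀ ≤ R) : Δ.relIndex Γ ≠ 0 := by
  have : Finite {g : Γ | dist (g.1 x₀) x₀ ≤ R} := hprop R
  have : Finite (Γ ⧸ Δ.subgroupOf Γ) := by
    refine Finite.of_surjective
      (fun g : {g : Γ | dist (g.1 x₀) x₀ ≤ R} => (QuotientGroup.mk g.1 : Γ ⧸ Δ.subgroupOf Γ)) ?_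
    intro q
    obtain ⟨g, rfl⟩ := QuotientGroup.mk_surjective q
    obtain ⟨δ, hδ, hd⟩ := hco (g.1⁻¹ x₀)
    refine ⟨⟨g * ⟨δ, hle hδ⟩⁻¹, ?_⟩, ?_⟩
    · change dist (g.1 (δ⁻¹ x₀)) x₀ ≤ R
      rw [← g.1⁻¹.dist_eq, IsometryEquiv.inv_apply_self, ← δ.dist_eq, IsometryEquiv.apply_inv_self,
        dist_comm]
      exact hd
    · refine QuotientGroup.mk_mul_of_mem g ((Δ.subgroupOf Γ).inv_mem ?_)
      exact hδ
  exact (Subgroup.finiteIndex_of_finite_quotient (H := Δ.subgroupOf Γ)).index_ne_zero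

theorem exists_cocompact_conj (g : X ≃ᵢ X) (hco : ∀ x, ∃ c ∈ Γ, dist (c x) x₀ ≤ R) :
    ∃ R' : ℝ, ∀ x, ∃ c ∈ Γ.map (MulAut.conj g).toMonoidHom, dist (c x) x₀ ≤ R' := by
  refine ⟨R + dist (g x₀) x₀, fun x => ?_⟩
  obtain ⟨c, hc, hd⟩ := hco (g⁻¹ x)
  refine ⟨g * c * g⁻¹, ⟨c, hc, rfl⟩, (dist_triangle _ (g x₀) _).trans (add_le_add ?_ le_rfl)⟩
  rw [IsometryEquiv.mul_apply, IsometryEquiv.mul_apply, g.dist_eq]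
  exact hd

end Lattices

/-! ### Degenerate cases and proof of the theorem -/

theorem IsHyperbolicSpaceOver.of_isometryEquiv {F : Type*} [Mul F] [Star F] {re : F → ℝ} {n : ℕ}
    {S T : Type*} [MetricSpace S] [MetricSpace T] (h : IsHyperbolicSpaceOver re n S) (e : T ≃ᵢ S) :
    IsHyperbolicSpaceOver re n T := by
  obtain ⟨c, f, hc, hf, hr, hd⟩ := h
  refine ⟨c, f ∘ e, hc, hf.comp e.injective, ?_, fun s t => ?_⟩
  · rw [e.surjective.range_comp, hr]
  · rw [← e.dist_eq]
    exact hd _ _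

theorem IsRankOneSymmetricSpace.of_isometryEquiv {S T : Type*} [MetricSpace S] [MetricSpace T]
    (h : IsRankOneSymmetricSpace S) (e : T ≃ᵢ S) : IsRankOneSymmetricSpace T := by
  rcases h with ⟨n, hn, h⟩ | ⟨n, hn, h⟩ | ⟨n, hn, h⟩ | h
  · exact Or.inl ⟨n, hn, h.of_isometryEquiv e⟩
  · exact Or.inr (Or.inl ⟨n, hn, h.of_isometryEquiv e⟩)
  · exact Or.inr (Or.inr (Or.inl ⟨n, hn, h.of_isometryEquiv e⟩))
  · exact Or.inr (Or.inr (Or.inr (h.of_isometryEquiv e)))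

namespace IdealTreeOfSpaces

variable {X : Type u} [MetricSpace X] {D : IdealTreeOfSpaces.{u, u} X}

theorem space_eq_univ {v : D.V} (hv : ∀ d : D.tree.Dart, d.fst ≠ v) : D.space v = Set.univ := by
  have hV : ∀ w, w = v := by
    intro w
    by_contra hne
    obtain ⟨p⟩ := D.isTree.connected.preconnected v w
    cases p with
    | nil => exact hne rfl
    | cons h _ => exact hv ⟨(_, _), h⟩ rfl
  refine Set.eq_univ_of_forall fun x => ?_
  rcases D.cover x with ⟨w, hw⟩ | ⟨d, -⟩
  · rwa [hV w] at hw
  · exact (hv d (hV _)).elim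

variable [hD : D.IsInvariant]

open Vert

/-- An isometry that moves all points by more than `1` neither fixes nor inverts an edge. -/
theorem not_fixes_or_inverts {g : X ≃ᵢ X} (hg : ∀ x, 1 < dist (g x) x) {u w : D.Vert}
    (huw : Adj u w) : ¬ ((g • u = u ∧ g • w = w) ∨ (g • u = w ∧ g • w = u)) := by
  have hfix : ∀ p (hp : p ∈ D.attach), g • (point p hp : D.Vert) ≠ point p hp := by
    intro p hp h
    have := hg p
    rw [Vert.point.inj h, dist_self] at this
    linarith
  cases u with
  | vertex v =>
    cases w with
    | vertex v' => exact huw.elim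
    | point p hp =>
      rintro (⟨-, h⟩ | ⟨h, -⟩)
      · exact hfix p hp h
      · exact nomatch h
  | point p hp =>
    cases w with
    | vertex v' =>
      rintro (⟨h, -⟩ | ⟨h, -⟩)
      · exact hfix p hp h
      · exact nomatch h
    | point q hq =>
      rintro (⟨h, -⟩ | ⟨h, -⟩)
      · exact hfix p hp h
      -- Inverting an edge moves its ends by exactly 1, which is why the displacement has to exceed
      -- 1.
      · obtain ⟨d, rfl, rfl⟩ := huw
        have := hg (D.edge d 0)
        rw [Vert.point.inj h, (D.edge_isometry d).dist_eq, Subtype.dist_eq] at this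
        simp at this

end IdealTreeOfSpaces

theorem mainTheorem6 {X : Type*} [MetricSpace X] (hX : IsIdealModelGeometry X)
    (hsymm : ¬ IsRankOneSymmetricSpace X) (hline : IsEmpty (X ≃ᵢ ℝ))
    (Γ Γ' : Subgroup (X ≃ᵢ X)) (hΓ : IsUniformLattice Γ) (hΓ' : IsUniformLattice Γ')
    (hΓrf : Group.ResiduallyFinite Γ) (hΓ'rf : Group.ResiduallyFinite Γ') :
    WeaklyCommensurable Γ Γ' := by
  obtain ⟨hproper, -, D, π, ⟨-, K, hK, hπ⟩, -, -⟩ := hX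
  -- A vertex without edges is the whole tree: X is then a point, with trivial isometry group, or an
  -- excluded symmetric space.
  by_cases hdart : ∃ v : D.V, ∀ d : D.tree.Dart, d.fst ≠ v
  · obtain ⟨v, hv⟩ := hdart
    have huniv := D.space_eq_univ hv
    rcases D.space_spec v with ⟨x, hx⟩ | hs
    · have hsub : Subsingleton (X ≃ᵢ X) := by
        have : ∀ y, y = x := fun y => by
          have : y ∈ D.space v := huniv ▸ Set.mem_univ y
          rwa [hx] at this
        exact ⟨fun g h => IsometryEquiv.ext fun y => (this _).trans (this _).symm⟩
      refine ⟨1, ?_⟩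
      rw [Subsingleton.elim (Γ.map (MulAut.conj (1 : X ≃ᵢ X)).toMonoidHom) Γ']
    · rw [huniv] at hs
      exact (hsymm (hs.of_isometryEquiv ⟨(Equiv.Set.univ X).symm, fun _ _ => rfl⟩)).elim
  push Not at hdart
  have hN : ∃ x : X, ¬ IsLinearPoint x := by
    by_contra! h
    exact hline.elim (D.nonempty_isometryEquiv_real h).some
  have hD := D.isInvariant hN
  obtain ⟨x₀, -⟩ := hN
  obtain ⟨R, hR⟩ := hK.isBounded.subset_closedBall x₀
  have hco : ∀ x, ∃ g : X ≃ᵢ X, dist (g x) x₀ ≤ R := fun x => by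
    obtain ⟨g, -, hg⟩ := hπ x
    exact ⟨g, hR hg⟩
  obtain ⟨R₁, hco₁⟩ := hΓ.exists_cocompact hco
  obtain ⟨R₂, hco₂⟩ := hΓ'.exists_cocompact hco
  have hprop₂ := finite_setOf_dist_le hΓ'.1 x₀
  obtain ⟨Γ₀, hle₁, hidx₁, hdisp₁⟩ := exists_displacement_gt hΓrf
    (finite_setOf_dist_le hΓ.1 x₀) hco₁ 1
  obtain ⟨Γ₀', hle₂, hidx₂, hdisp₂⟩ := exists_displacement_gt hΓ'rf hprop₂ hco₂ 1
  obtain ⟨R₃, hco₃⟩ := exists_cocompact_of_relIndex_ne_zero hidx₂ hco₂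
  obtain ⟨v₀⟩ := D.isTree.connected.nonempty
  obtain ⟨g, Δ, hΔ, hidx, hconj⟩ := (D.isTreeLike v₀).exists_conj_le
    IdealTreeOfSpaces.adj_symm IdealTreeOfSpaces.adj_irrefl IdealTreeOfSpaces.adj_smul_iff Γ₀ Γ₀'
    (fun c hc u w huw h => by
      by_contra hne
      exact IdealTreeOfSpaces.not_fixes_or_inverts (hdisp₁ c hc hne) huw h)
    (fun c hc u w huw hu hw => by
      by_contra hne
      exact IdealTreeOfSpaces.not_fixes_or_inverts (hdisp₂ c hc hne) huw (Or.inl ⟨hu, hw⟩))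
    (fun u => IdealTreeOfSpaces.finite_agreeQuotient hco₃ hdart u)
    (IdealTreeOfSpaces.exists_finite_orbit_representatives hco)
    IdealTreeOfSpaces.exists_isometry_glue
    (IdealTreeOfSpaces.eq_one_of_smul_eq hco hdart)
  have hΔΓ : Δ.relIndex Γ ≠ 0 := by
    rw [← Subgroup.relIndex_mul_relIndex Δ Γ₀ Γ hΔ hle₁]
    exact mul_ne_zero hidx hidx₁
  -- The matching gives only an inclusion of the conjugate of Δ in `Γ'`. Its finite index there
  -- follows because the conjugate is still cocompact.
  obtain ⟨R₄, hco₄⟩ := exists_cocompact_of_relIndex_ne_zero hΔΓ hco₁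
  obtain ⟨R₅, hco₅⟩ := exists_cocompact_conj g hco₄
  have hle : Δ.map (MulAut.conj g).toMonoidHom ≤ Γ' := by
    rintro _ ⟨δ, hδ, rfl⟩
    exact hle₂ (hconj δ hδ)
  have hc₁ : Subgroup.Commensurable (Γ.map (MulAut.conj g).toMonoidHom)
      (Δ.map (MulAut.conj g).toMonoidHom) := by
    refine ⟨?_, ?_⟩
    · rw [Subgroup.relIndex_eq_one.2 (Subgroup.map_mono (hΔ.trans hle₁))]
      exact one_ne_zero
    · rw [Subgroup.relIndex_map_map_of_injective Δ Γ (MulAut.conj g).injective]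
      exact hΔΓ
  have hc₂ : Subgroup.Commensurable (Δ.map (MulAut.conj g).toMonoidHom) Γ' := by
    refine ⟨relIndex_ne_zero_of_cocompact hle hprop₂ hco₅, ?_⟩
    rw [Subgroup.relIndex_eq_one.2 hle]
    exact one_ne_zero
  exact ⟨g, hc₁.trans hc₂⟩
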